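/- **Setting.** Let $\mathcal Y$ be a complex Hilbert space and $\mathcal B^r_{\mathcal X}=\{x\in\mathcal X:\|x\|_{\mathcal X}\le r\}$ for a normed space $\mathcal X$. For Banach spaces $\mathcal X,\mathcal Z$ and $\mathcal U\subseteq\mathcal X$, $\mathcal V\subseteq\mathcal Z$, write $F\in\mathcal C^k_b(\mathcal U;\mathcal V)$ if $F:\mathcal U\to\mathcal V$ is continuous, is $k$ times continuously (real) differentiable in $\operatorname{int}\mathcal U$, and its derivatives of order $\le k$ are bounded there and extend continuously to the boundary of $\operatorname{int}\mathcal U$. Assume: * (A1) $A$ is a normal operator on $\mathcal Y$ that generates a strongly continuous semigroup $e^{tA}$, and (A2) $\|e^{tA}\|\le 1$ for $t\ge0$ (hence $\operatorname{Re}\operatorname{spec}A\le 0$). For $\ell\ge0$ let $\mathcal Y_\ell=D(A^\ell)$ with inner product $\langle \mathbb P_1U,\mathbb P_1V\rangle+\langle|A|^\ell\mathbb Q_1U,|A|^\ell\mathbb Q_1V\rangle$, where $\mathbb P_1$ is the spectral projection of $A$ to the closed unit disc and $\mathbb Q_1=1-\mathbb P_1$; so $\mathcal Y_0=\mathcal Y$.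 Put $\mathcal B^r_\ell=\mathcal B^r_{\mathcal Y_\ell}$. * (B) $B:\mathcal Y\to\mathcal Y$, $L\ge0$, $I\subseteq[0,L]$, $0,L\in I$, $N\in\mathbb N$, $N>\lceil L\rceil$, and $B$ restricts to a map in $\mathcal C_b^{N-\lceil\ell\rceil}(\mathcal B^r_\ell;\mathcal Y_\ell)$ for all $\ell\in I$ and $r>0$. Let $M^{(i)}_\ell[r]$ be the supremum of $\|D^iB\|$ over the interior of $\mathcal B^r_\ell$, with $B$ regarded as a map from $\mathcal Y_\ell$ to $\mathcal Y_\ell$, and $I^-=\{\ell\in I:\ \ell-j\in I \text{ for } j=1,\dots,\lfloor\ell\rfloor\}$. * (EXP) $0\le c_1\le\dots\le c_s\le1$, and $a:\{\operatorname{Re}z\le0\}\to\mathbb C^{s\times s}$, $b:\{\operatorname{Re}z\le0\}\to\mathbb C^s$ are analytic with $M_a^{(k)}=\sup\|a^{(k)}(z)\|_\infty<\infty$ and $M_b^{(k)}=\sup\|b^{(k)}(z)\|_1<\infty$ for all $k\ge0$. The exponential Runge–Kutta method is $$W^i=e^{c_ihA}U+h\sum_{j=1}^s a_{ij}(hA)B(W^j)\quad(i=1,\dots,s),\qquad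 \Psi(U,h)=e^{hA}U+h\sum_{i=1}^s b_i(hA)B(W^i).$$ **Theorem (regularity of the numerical method).** Let $R>0$, $s,N\in\mathbb N_0$ and let $(K_i),(\bar M_a^{(i)}),(\bar M_b^{(i)})$ be real sequences. There are $h_*>0$ and constants $C_0,C_1,\dots$, depending only on these data, such that the following holds for all $\mathcal Y,A,B,L,I,a,b,c$ satisfying (A1), (A2), (B) and (EXP) with $M_a^{(k)}\le\bar M_a^{(k)}$, $M_b^{(k)}\le\bar M_b^{(k)}$ for all $k$, and $M_0^{(i)}[R]\le K_i$ for $0\le i\le N$. For all $U\in\mathcal B_0^{R/2}$ and $h\in[0,h_*]$ the stage equations have exactly one solution $W(U,h)=(W^1,\dots,W^s)$ with all $W^i\in\mathcal B^R_0$, and for every $h\in[0,h_*]$ $$W^i(\cdot,h),\ \Psi(\cdot,h)\in\mathcal C^N_b(\mathcal B_0^{R/2};\mathcal B_0^R),\qquad i=1,\dots,s,$$ with derivatives of order $m\le N$ bounded by $C_m$. Moreover, let $\ell\in I^-$ and $k\in\mathbb N_0$, $k\le\ell$, be such that also $M^{(i)}_{\ell-j}[R]\le K_i$ for $0\le j\le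 k$ and $0\le i\le N-\lceil\ell-j\rceil$. Then for every $U\in\mathcal B_\ell^{R/2}$ $$W^i(U,\cdot),\ \Psi(U,\cdot)\in\mathcal C^k_b([0,h_*];\mathcal B_0^R),\qquad i=1,\dots,s,$$ with derivatives of order $m\le k$ bounded by $C_m$. In particular, one $h_*$ serves for any finite set of $\ell\in I^-$, and for all $\ell\in I^-$ if the bounds in (B) on balls of radius $R$ are uniform in $\ell\in I$. -/

import Mathlib

open Set Filter Topology

noncomputable section

/-! ### Normal generators of strongly continuous semigroups -/

/-- A (possibly unbounded) linear operator on a complex Hilbert space is normal: it is densely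
defined, closed, and `A† A = A A†`, including equality of the domains of the two products. -/
structure IsNormalOp {Y : Type*} [NormedAddCommGroup Y] [InnerProductSpace ℂ Y] [CompleteSpace Y]
    (A : Y →ₗ.[ℂ] Y) : Prop where
  dense : Dense (A.domain : Set Y)
  closed : A.IsClosed
  comm : ∀ x z : Y,
    (∃ y, (x, y) ∈ A.graph ∧ (y, z) ∈ A.adjoint.graph) ↔
      (∃ y, (x, y) ∈ A.adjoint.graph ∧ (y, z) ∈ A.graph)

/-- `S t`, `t ≥ 0`, is a strongly continuous semigroup of bounded linear operators.
Values of `S` at negative times are irrelevant. -/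
structure IsC0Semigroup {Y : Type*} [NormedAddCommGroup Y] [NormedSpace ℂ Y]
    (S : ℝ → Y →L[ℂ] Y) : Prop where
  zero : S 0 = ContinuousLinearMap.id ℂ Y
  add : ∀ t₁ t₂ : ℝ, 0 ≤ t₁ → 0 ≤ t₂ → S (t₁ + t₂) = (S t₁).comp (S t₂)
  tendsto : ∀ x : Y, Tendsto (fun t => S t x) (𝓝[>] 0) (𝓝 x)

/-- `A` is the infinitesimal generator of `S`:  `x ∈ D(A)` and `A x = y` if and only if
`(S t x - x) / t → y` as `t ↓ 0`. -/
def IsGenerator {Y : Type*} [NormedAddCommGroup Y] [NormedSpace ℂ Y]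
    (A : Y →ₗ.[ℂ] Y) (S : ℝ → Y →L[ℂ] Y) : Prop :=
  ∀ x y : Y, (x, y) ∈ A.graph ↔
    Tendsto (fun t : ℝ => ((t⁻¹ : ℝ) : ℂ) • (S t x - x)) (𝓝[>] 0) (𝓝 y)

/-- `A` is a normal operator generating the strongly continuous semigroup `S t = exp (t A)`. -/
structure CondA1 {Y : Type*} [NormedAddCommGroup Y] [InnerProductSpace ℂ Y] [CompleteSpace Y]
    (A : Y →ₗ.[ℂ] Y) (S : ℝ → Y →L[ℂ] Y) : Prop where
  normal : IsNormalOp A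
  semigroup : IsC0Semigroup S
  generator : IsGenerator A S

/-- The semigroup is a contraction semigroup. (By the Hille-Yosida theorem this contains the
bound `Re (spec A) ≤ 0`, which is therefore not listed separately.) -/
def CondA2 {Y : Type*} [NormedAddCommGroup Y] [NormedSpace ℂ Y] (S : ℝ → Y →L[ℂ] Y) : Prop :=
  ∀ t : ℝ, 0 ≤ t → ‖S t‖ ≤ 1

/-! ### Functional calculus -/

/-- `T` is the bounded inverse of `1 - A`: it maps `Y` into `D(A)`, `(1 - A) T x = x` for all `x`
and `T (x - A x) = x` for `x ∈ D(A)`. -/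
def IsResolventAtOne {Y : Type*} [NormedAddCommGroup Y] [NormedSpace ℂ Y]
    (A : Y →ₗ.[ℂ] Y) (T : Y →L[ℂ] Y) : Prop :=
  (∀ x : Y, (T x, T x - x) ∈ A.graph) ∧ (∀ x y : Y, (x, y) ∈ A.graph → T (x - y) = x)

open Classical in
/-- The resolvent `(1 - A)⁻¹` (the zero operator if `1 - A` is not boundedly invertible;
for the generator of a contraction semigroup it always is). -/
def resolventAtOne {Y : Type*} [NormedAddCommGroup Y] [NormedSpace ℂ Y]
    (A : Y →ₗ.[ℂ] Y) : Y →L[ℂ] Y :=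
  if h : ∃ T : Y →L[ℂ] Y, IsResolventAtOne A T then h.choose else 0

open Classical in
/-- Functional calculus of an unbounded normal operator `A` with spectrum in the closed left half
plane, for functions `f` that are continuous and bounded there.

With `T = (1 - A)⁻¹`, a bounded normal operator, one has `f(A) = g(T)` for `g w = f (1 - 1/w)`.
The function `g` is bounded, but in general not continuous at `0 ∈ spec T` (the image of the point
at infinity), whereas `w ↦ w * g w` is continuous with value `0` at `0`. So
`f(A) (1 - A)⁻¹ = (w * f (1 - 1/w))(T)` is given by the continuous functional calculus of `T`, and
`f(A)` is the unique bounded operator with this property, as the range `D(A)` of `T` is dense. -/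
def funCalc {Y : Type*} [NormedAddCommGroup Y] [InnerProductSpace ℂ Y] [CompleteSpace Y]
    (A : Y →ₗ.[ℂ] Y) (f : ℂ → ℂ) : Y →L[ℂ] Y :=
  if h : ∃ X : Y →L[ℂ] Y,
      X * resolventAtOne A = cfc (fun w : ℂ => w * f (1 - w⁻¹)) (resolventAtOne A)
  then h.choose else 0

/-! ### The scale of Hilbert spaces `Y_ℓ = D(A^ℓ)` -/

/-- The bounded operator `max(1, |A|)^(-ℓ)`. -/
def smoothing {Y : Type*} [NormedAddCommGroup Y] [InnerProductSpace ℂ Y] [CompleteSpace Y]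
    (A : Y →ₗ.[ℂ] Y) (ℓ : ℝ) : Y →L[ℂ] Y :=
  funCalc A (fun z => (((max 1 ‖z‖) ^ (-ℓ) : ℝ) : ℂ))

/-- `Y_ℓ = D(A^ℓ) = D(|A|^ℓ)`, as the set of all `max(1, |A|)^(-ℓ) v`, `v ∈ Y`. -/
def scaleSubmodule {Y : Type*} [NormedAddCommGroup Y] [InnerProductSpace ℂ Y] [CompleteSpace Y]
    (A : Y →ₗ.[ℂ] Y) (ℓ : ℝ) : Submodule ℂ Y :=
  LinearMap.range (smoothing A ℓ).toLinearMap

/-- The space `Y_ℓ` as a type of its own, since it carries its own norm: the norm of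
`max(1, |A|)^(-ℓ) v` is the norm of `v` in `Y`. In other words `‖U‖_ℓ = ‖max(1, |A|)^ℓ U‖`, and as
`max(1, |z|)^(2ℓ) = 1` for `|z| ≤ 1` and `= |z|^(2ℓ)` for `|z| > 1`, this is the norm of the inner
product `⟨P₁ U, P₁ V⟩ + ⟨|A|^ℓ Q₁ U, |A|^ℓ Q₁ V⟩`, where `P₁` is the spectral projection of `A` to
the closed unit disc and `Q₁ = 1 - P₁`. -/
def ScaleSpace {Y : Type*} [NormedAddCommGroup Y] [InnerProductSpace ℂ Y] [CompleteSpace Y]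
    (A : Y →ₗ.[ℂ] Y) (ℓ : ℝ) : Type _ :=
  scaleSubmodule A ℓ

namespace ScaleSpace

variable {Y : Type*} [NormedAddCommGroup Y] [InnerProductSpace ℂ Y] [CompleteSpace Y]
  (A : Y →ₗ.[ℂ] Y) (ℓ : ℝ)

instance : AddCommGroup (ScaleSpace A ℓ) :=
  inferInstanceAs (AddCommGroup (scaleSubmodule A ℓ))

instance : Module ℂ (ScaleSpace A ℓ) :=
  inferInstanceAs (Module ℂ (scaleSubmodule A ℓ))

/-- The kernel of `max(1, |A|)^(-ℓ)` (which is `0` in all cases of interest). -/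
abbrev kernel : Submodule ℂ Y := LinearMap.ker (smoothing A ℓ).toLinearMap

instance kernel_isClosed : IsClosed (kernel A ℓ : Set Y) :=
  (smoothing A ℓ).isClosed_ker

/-- The inverse of `max(1, |A|)^(-ℓ)`, as a linear isomorphism from `Y_ℓ` onto `Y`. (The quotient
by the kernel, which is `0`, is only there to make the definition total.) -/
def lift : ScaleSpace A ℓ ≃ₗ[ℂ] (Y ⧸ kernel A ℓ) :=
  ((smoothing A ℓ).toLinearMap.quotKerEquivRange).symm

instance : NormedAddCommGroup (ScaleSpace A ℓ) :=
  NormedAddCommGroup.induced (ScaleSpace A ℓ) (Y ⧸ kernel A ℓ) (lift A ℓ) (lift A ℓ).injective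

instance : NormedSpace ℂ (ScaleSpace A ℓ) :=
  NormedSpace.induced ℂ (ScaleSpace A ℓ) (Y ⧸ kernel A ℓ) (lift A ℓ)

variable {A ℓ}

/-- The inclusion of `Y_ℓ` into `Y`. -/
def toBase (x : ScaleSpace A ℓ) : Y := Subtype.val (p := fun y => y ∈ scaleSubmodule A ℓ) x

variable (A ℓ)

/-- The element `max(1, |A|)^(-ℓ) v` of `Y_ℓ`. -/
def mk (v : Y) : ScaleSpace A ℓ := ⟨smoothing A ℓ v, ⟨v, rfl⟩⟩

theorem toBase_mk (v : Y) : (mk A ℓ v).toBase = smoothing A ℓ v := rfl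

theorem lift_mk (v : Y) : lift A ℓ (mk A ℓ v) = (kernel A ℓ).mkQ v := by
  apply (lift A ℓ).symm.injective
  rw [LinearEquiv.symm_apply_apply]
  rfl

theorem norm_mk (h : Function.Injective (smoothing A ℓ)) (v : Y) : ‖mk A ℓ v‖ = ‖v‖ := by
  have hk : kernel A ℓ = ⊥ := LinearMap.ker_eq_bot.2 h
  have h1 : ‖mk A ℓ v‖ = ‖lift A ℓ (mk A ℓ v)‖ := rfl
  rw [h1, lift_mk]
  apply le_antisymm
  · exact Submodule.Quotient.norm_mk_le _ v
  · refine le_of_forall_pos_lt_add fun ε hε => ?_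
    obtain ⟨m, hm, hlt⟩ := Submodule.Quotient.norm_mk_lt ((kernel A ℓ).mkQ v) hε
    have h2 : m - v ∈ kernel A ℓ := (Submodule.Quotient.eq _).1 hm
    rw [hk, Submodule.mem_bot, sub_eq_zero] at h2
    rwa [← h2] at hlt ⊢

end ScaleSpace

/-! ### Boundedly differentiable functions -/

/-- `F ∈ C_b^k(U; V)`, with the bounds `K 0, …, K k` on `F` and its derivatives: `F` maps `U` to
`V`, is `k` times continuously (real) differentiable in the interior of `U`, the norm of its `i`-th
derivative is at most `K i` there for `i ≤ k`, and `F` is continuous up to the boundary and its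
derivatives extend continuously to the boundary of the interior. -/
structure CbWith {X Z : Type*} [NormedAddCommGroup X] [NormedSpace ℝ X]
    [NormedAddCommGroup Z] [NormedSpace ℝ Z]
    (k : ℕ) (K : ℕ → ℝ) (F : X → Z) (U : Set X) (V : Set Z) : Prop where
  mapsTo : MapsTo F U V
  continuousOn : ContinuousOn F U
  contDiffOn : ContDiffOn ℝ k F (interior U)
  bound : ∀ i ≤ k, ∀ x ∈ interior U, ‖iteratedFDeriv ℝ i F x‖ ≤ K i
  extend : ∀ i ≤ k, ∃ G : X → ContinuousMultilinearMap ℝ (fun _ : Fin i => X) Z,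
    ContinuousOn G (closure (interior U)) ∧ EqOn G (iteratedFDeriv ℝ i F) (interior U)

/-! ### The nonlinearity -/

/-- `B` maps `Y_ℓ` to itself, and is in `C_b^k(ball of radius r in Y_ℓ; Y_ℓ)` with bounds `K`. -/
def LevelBound {Y : Type*} [NormedAddCommGroup Y] [InnerProductSpace ℂ Y] [CompleteSpace Y]
    (A : Y →ₗ.[ℂ] Y) (B : Y → Y) (ℓ r : ℝ) (k : ℕ) (K : ℕ → ℝ) : Prop :=
  ∃ Bl : ScaleSpace A ℓ → ScaleSpace A ℓ,
    (∀ x, (Bl x).toBase = B x.toBase) ∧ CbWith k K Bl (Metric.closedBall 0 r) univ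

/-- The assumption on the nonlinearity: `0, L ∈ I ⊆ [0, L]`, `N > ⌈L⌉`, and
`B ∈ C_b^(N - ⌈ℓ⌉)(ball of radius r in Y_ℓ; Y_ℓ)` for all `ℓ ∈ I`, `r > 0`. -/
structure CondB {Y : Type*} [NormedAddCommGroup Y] [InnerProductSpace ℂ Y] [CompleteSpace Y]
    (A : Y →ₗ.[ℂ] Y) (B : Y → Y) (L : ℝ) (I : Set ℝ) (N : ℕ) : Prop where
  L_nonneg : 0 ≤ L
  subset : I ⊆ Icc 0 L
  zero_mem : (0 : ℝ) ∈ I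
  L_mem : L ∈ I
  lt_N : ⌈L⌉₊ < N
  smooth : ∀ ℓ ∈ I, ∀ r : ℝ, 0 < r → ∃ K : ℕ → ℝ, LevelBound A B ℓ r (N - ⌈ℓ⌉₊) K

/-- `I⁻ = {ℓ ∈ I : ℓ - k ∈ I for k = 1, …, ⌊ℓ⌋}`. -/
def IMinus (I : Set ℝ) : Set ℝ :=
  {ℓ | ℓ ∈ I ∧ ∀ k : ℕ, 1 ≤ k → k ≤ ⌊ℓ⌋₊ → ℓ - k ∈ I}

/-! ### Exponential Runge-Kutta methods -/

/-- The closed left half plane. -/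
def leftHalfPlane : Set ℂ := {z | z.re ≤ 0}

/-- The coefficient functions are analytic on the closed left half plane and they and all their
derivatives are bounded there: `‖a⁽ᵏ⁾(z)‖_∞ ≤ Ma k` (maximal absolute row sum) and
`‖b⁽ᵏ⁾(z)‖_1 ≤ Mb k`. -/
structure CondEXP {s : ℕ} (a : ℂ → Matrix (Fin s) (Fin s) ℂ) (b : ℂ → Fin s → ℂ)
    (Ma Mb : ℕ → ℝ) : Prop where
  analytic_a : ∀ i j, AnalyticOn ℂ (fun z => a z i j) leftHalfPlane
  analytic_b : ∀ i, AnalyticOn ℂ (fun z => b z i) leftHalfPlane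
  bound_a : ∀ k : ℕ, ∀ z ∈ leftHalfPlane, ∀ i,
    ∑ j, ‖iteratedDerivWithin k (fun z => a z i j) leftHalfPlane z‖ ≤ Ma k
  bound_b : ∀ k : ℕ, ∀ z ∈ leftHalfPlane,
    ∑ i, ‖iteratedDerivWithin k (fun z => b z i) leftHalfPlane z‖ ≤ Mb k

/-- The stage equations `Wⁱ = exp(cᵢ h A) U + h ∑ⱼ aᵢⱼ(hA) B(Wʲ)`; here `S t = exp(t A)`. -/
def IsStageVector {Y : Type*} [NormedAddCommGroup Y] [InnerProductSpace ℂ Y] [CompleteSpace Y]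
    {s : ℕ} (A : Y →ₗ.[ℂ] Y) (S : ℝ → Y →L[ℂ] Y) (B : Y → Y) (c : Fin s → ℝ)
    (a : ℂ → Matrix (Fin s) (Fin s) ℂ) (U : Y) (h : ℝ) (W : Fin s → Y) : Prop :=
  ∀ i, W i = S (h * c i) U + (h : ℂ) • ∑ j, funCalc A (fun z => a (h * z) i j) (B (W j))

/-- The update `exp(h A) U + h ∑ᵢ bᵢ(hA) B(Wⁱ)` computed from the stage vectors `Wⁱ`. -/
def rkUpdate {Y : Type*} [NormedAddCommGroup Y] [InnerProductSpace ℂ Y] [CompleteSpace Y]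
    {s : ℕ} (A : Y →ₗ.[ℂ] Y) (S : ℝ → Y →L[ℂ] Y) (B : Y → Y)
    (b : ℂ → Fin s → ℂ) (U : Y) (h : ℝ) (W : Fin s → Y) : Y :=
  S h U + (h : ℂ) • ∑ i, funCalc A (fun z => b (h * z) i) (B (W i))

end

/-! The stage equations have the form `w = p + T (β w)` with `T` of size `O(h)`. For small `h` the
right side is a contraction of a ball, which gives existence and uniqueness, and the inverse
function theorem makes the solution as smooth in `p` as `β` is. The bounds must not depend on the
space. They come from `Dw = 1 + T ∘ Dβ(w) ∘ Dw`: in each order the highest derivative of `w` occurs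
on the right only with a factor at most `1/2` and can be absorbed (`exists_cbOn_solMap`).

Regularity in `h` is harder, because `exp(hA)` and `a(hA)` are in general only strongly continuous
in `h`, and each derivative costs a factor `A`, that is, one level of the scale `Y_ℓ`. As
`max(1,|A|)^(-ℓ)` maps `Y` isometrically onto `Y_ℓ`, every level can be described by coordinates in
`Y`. The inclusion of a level into the one below then becomes `J = max(1,|A|)⁻¹`, and `A` between
these levels becomes `Λ = A max(1,|A|)⁻¹`. These are commuting contractions, and functions of `A`
look the same on every level. Operator families satisfy `d/dh (α n h (J x)) = α (n+1) h (Λ x)`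
(`OpFam`), and the curves sought are `C^i` after descending `i` levels, for `i ≤ k` (`ScaleReg`).

In this setting the derivative of a solution, seen one level lower, solves the formally
differentiated equation. That equation is linear, again contractive, and demands one order less, so
induction applies (`exists_scaleReg_linear`, `exists_scaleReg_nonlinear`). Differentiability itself
is obtained by comparing the solution with its candidate tangent
(`OpFam.exists_hasDerivWithinAt_fixed`), since strong continuity does not suffice for the implicit
function theorem. On the level `ℓ - j` the nonlinearity has at least `j + 1` derivatives, exactly
what the induction consumes.

The operator theory rests on `T = (1 - A)⁻¹`. It is normal because `A† A = A A†`
(`isStarNormal_of_graph_comm`), and contractivity of the semigroup locates its spectrum. The bound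
of `f(A)` by `sup |f|` follows (`IsNormalResolvent.norm_cfc_apply_le`), and Taylor expansion of
symbols makes `φ(hA)` an operator family (`IsSymbol.opFam`). The update is treated as one more
stage, so both claims are proved only once. -/

set_option linter.unusedSectionVars false

/-! ### Functions with bounded derivatives on a set of unique differentiability -/

section Calculus

universe u v w

variable {X : Type u} [NormedAddCommGroup X] [NormedSpace ℝ X]
  {E : Type v} [NormedAddCommGroup E] [NormedSpace ℝ E]
  {F : Type w} [NormedAddCommGroup F] [NormedSpace ℝ F]

/-- `f` is `k` times continuously differentiable on `s`, and its derivatives within `s` of order at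
most `k` are bounded by `M`. -/
structure CbOn (k : ℕ) (M : ℝ) (f : X → E) (s : Set X) : Prop where
  contDiffOn : ContDiffOn ℝ k f s
  bound : ∀ i ≤ k, ∀ x ∈ s, ‖iteratedFDerivWithin ℝ i f s x‖ ≤ M

namespace CbOn

variable {k m : ℕ} {M M' : ℝ} {f g : X → E} {s : Set X}

theorem nonneg (h : CbOn k M f s) {x : X} (hx : x ∈ s) : 0 ≤ M :=
  (norm_nonneg _).trans (h.bound 0 (Nat.zero_le k) x hx)

theorem mono (h : CbOn k M f s) (hM : M ≤ M') : CbOn k M' f s :=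
  ⟨h.contDiffOn, fun i hi x hx => (h.bound i hi x hx).trans hM⟩

theorem of_le (h : CbOn k M f s) (hm : m ≤ k) : CbOn m M f s :=
  ⟨h.contDiffOn.of_le (by exact_mod_cast hm), fun i hi => h.bound i (hi.trans hm)⟩

theorem congr (h : CbOn k M f s) (hfg : EqOn g f s) : CbOn k M g s :=
  ⟨h.contDiffOn.congr hfg, fun i hi x hx => by
    rw [iteratedFDerivWithin_congr hfg hx]; exact h.bound i hi x hx⟩

theorem norm_le (h : CbOn k M f s) {x : X} (hx : x ∈ s) : ‖f x‖ ≤ M := by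
  simpa using h.bound 0 (Nat.zero_le k) x hx

theorem continuousOn (h : CbOn k M f s) : ContinuousOn f s := h.contDiffOn.continuousOn

theorem zero_iff : CbOn 0 M f s ↔ ContinuousOn f s ∧ ∀ x ∈ s, ‖f x‖ ≤ M := by
  refine ⟨fun h => ⟨h.continuousOn, fun x hx => h.norm_le hx⟩, fun h => ⟨?_, ?_⟩⟩
  · simpa using h.1
  · intro i hi x hx
    obtain rfl : i = 0 := by omega
    simpa using h.2 x hx

theorem const (c : E) : CbOn k ‖c‖ (fun _ : X => c) s := by
  refine ⟨contDiffOn_const, fun i hi x hx => ?_⟩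
  rcases i with _ | i
  · simp
  · rw [iteratedFDerivWithin_const_of_ne (by omega)]
    simp

theorem add (hs : UniqueDiffOn ℝ s) (hf : CbOn k M f s) (hg : CbOn k M' g s) :
    CbOn k (M + M') (fun x => f x + g x) s := by
  refine ⟨hf.contDiffOn.add hg.contDiffOn, fun i hi x hx => ?_⟩
  have h1 := (hf.of_le hi).contDiffOn
  have h2 := (hg.of_le hi).contDiffOn
  have := fun_iteratedFDerivWithin_add_apply (h1 x hx) (h2 x hx) hs hx
  rw [this]
  exact (norm_add_le _ _).trans (add_le_add (hf.bound i hi x hx) (hg.bound i hi x hx))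

theorem clm (hs : UniqueDiffOn ℝ s) (hf : CbOn k M f s) (L : E →L[ℝ] F) :
    CbOn k (‖L‖ * M) (fun x => L (f x)) s := by
  refine ⟨L.contDiff.comp_contDiffOn hf.contDiffOn, fun i hi x hx => ?_⟩
  refine (L.norm_iteratedFDerivWithin_comp_left (hf.contDiffOn x hx) hs hx
    (by exact_mod_cast hi)).trans ?_
  gcongr
  exact hf.bound i hi x hx

theorem clm_of_le_one (hs : UniqueDiffOn ℝ s) (hf : CbOn k M f s) (L : E →L[ℝ] F)
    (hL : ‖L‖ ≤ 1) : CbOn k M (fun x => L (f x)) s := by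
  refine ⟨(hf.clm hs L).contDiffOn, fun i hi x hx => ((hf.clm hs L).bound i hi x hx).trans ?_⟩
  exact mul_le_of_le_one_left (hf.nonneg hx) hL

theorem bilinear {G : Type*} [NormedAddCommGroup G] [NormedSpace ℝ G] (hs : UniqueDiffOn ℝ s)
    (B : E →L[ℝ] F →L[ℝ] G) (hB : ‖B‖ ≤ 1) {p : X → F}
    (hf : CbOn k M f s) (hp : CbOn k M' p s) :
    CbOn k (2 ^ k * (M * M')) (fun x => B (f x) (p x)) s := by
  refine ⟨B.isBoundedBilinearMap.contDiff.comp_contDiffOn (hf.contDiffOn.prodMk hp.contDiffOn),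
    fun i hi x hx => ?_⟩
  have hM := hf.nonneg hx
  have hM' := hp.nonneg hx
  refine (B.norm_iteratedFDerivWithin_le_of_bilinear_of_le_one hf.contDiffOn hp.contDiffOn hs hx
    (by exact_mod_cast hi) hB).trans ?_
  calc _ ≤ ∑ j ∈ Finset.range (i + 1), (i.choose j : ℝ) * (M * M') := by
        refine Finset.sum_le_sum fun j hj => ?_
        rw [mul_assoc]
        have hj' := Finset.mem_range.1 hj
        gcongr
        · exact hf.bound j (by omega) x hx
        · exact hp.bound (i - j) (by omega) x hx
    _ = 2 ^ i * (M * M') := by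
        rw [← Finset.sum_mul]
        congr 1
        exact_mod_cast Nat.sum_range_choose i
    _ ≤ 2 ^ k * (M * M') := by gcongr; norm_num

theorem clm_apply (hs : UniqueDiffOn ℝ s) {f : X → E →L[ℝ] F} {p : X → E}
    (hf : CbOn k M f s) (hp : CbOn k M' p s) :
    CbOn k (2 ^ k * (M * M')) (fun x => f x (p x)) s := by
  refine hf.bilinear hs (ContinuousLinearMap.id ℝ (E →L[ℝ] F)) ?_ hp
  exact ContinuousLinearMap.norm_id_le

theorem smul (hs : UniqueDiffOn ℝ s) {f : X → ℝ} {p : X → E}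
    (hf : CbOn k M f s) (hp : CbOn k M' p s) :
    CbOn k (2 ^ k * (M * M')) (fun x => f x • p x) s := by
  refine hf.bilinear hs (ContinuousLinearMap.lsmul ℝ ℝ) ?_ hp
  exact ContinuousLinearMap.opNorm_lsmul_le

theorem comp {t : Set E} {p : E → F} (hs : UniqueDiffOn ℝ s) (ht : UniqueDiffOn ℝ t)
    (hp : CbOn k M' p t) (hf : CbOn k M f s) (hst : MapsTo f s t) :
    CbOn k (k.factorial * M' * (max 1 M) ^ k) (fun x => p (f x)) s := by
  refine ⟨hp.contDiffOn.comp hf.contDiffOn hst, fun i hi x hx => ?_⟩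
  have hM' := hp.nonneg (hst hx)
  -- The Faà di Bruno estimate wants the `j`-th derivative of the inner function bounded by `D ^ j`;
  -- for `j ≥ 1` this follows from the bound `M` if `D = max 1 M`.
  refine (norm_iteratedFDerivWithin_comp_le (D := max 1 M) hp.contDiffOn hf.contDiffOn
    (by exact_mod_cast hi) ht hs hst hx (fun j hj => hp.bound j (hj.trans hi) _ (hst hx)) ?_).trans
    ?_
  · intro j hj1 hj
    refine ((hf.bound j (hj.trans hi) x hx).trans (le_max_right 1 M)).trans ?_
    exact le_self_pow₀ (le_max_left 1 M) (by omega)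
  · have := Nat.factorial_le hi
    gcongr
    exact le_max_left 1 M

theorem fderivWithin (hs : UniqueDiffOn ℝ s) (hf : CbOn (k + 1) M f s) :
    CbOn k M (fderivWithin ℝ f s) s := by
  refine ⟨hf.contDiffOn.fderivWithin hs (by norm_cast), fun i hi x hx => ?_⟩
  rw [norm_iteratedFDerivWithin_fderivWithin hs hx]
  exact hf.bound (i + 1) (by omega) x hx

theorem of_fderivWithin (hs : UniqueDiffOn ℝ s) (hf : DifferentiableOn ℝ f s)
    (hb : ∀ x ∈ s, ‖f x‖ ≤ M) (h : CbOn k M (_root_.fderivWithin ℝ f s) s) :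
    CbOn (k + 1) M f s := by
  refine ⟨?_, fun i hi x hx => ?_⟩
  · have := (contDiffOn_succ_iff_fderivWithin (n := (k : WithTop ℕ∞)) hs).2
      ⟨hf, by simp, h.contDiffOn⟩
    exact_mod_cast this
  · rcases i with _ | i
    · simpa using hb x hx
    · rw [← norm_iteratedFDerivWithin_fderivWithin hs hx]
      exact h.bound i (by omega) x hx

theorem comp_clm {t : Set E} {p : E → F} (ht : UniqueDiffOn ℝ t) (hp : CbOn k M p t)
    (L : X →L[ℝ] E) (hL : ‖L‖ ≤ 1) (hs : UniqueDiffOn ℝ (L ⁻¹' t)) :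
    CbOn k M (fun x => p (L x)) (L ⁻¹' t) := by
  refine ⟨hp.contDiffOn.comp L.contDiff.contDiffOn fun x hx => hx, fun i hi x hx => ?_⟩
  have := L.iteratedFDerivWithin_comp_right hp.contDiffOn ht hs hx
    (i := i) (by exact_mod_cast hi)
  change ‖iteratedFDerivWithin ℝ i (p ∘ L) _ x‖ ≤ _
  rw [this]
  refine (ContinuousMultilinearMap.norm_compContinuousLinearMap_le _ _).trans ?_
  rw [Finset.prod_const]
  refine (mul_le_of_le_one_right (norm_nonneg _) (pow_le_one₀ (norm_nonneg _) hL)).trans ?_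
  exact hp.bound i hi _ hx

theorem sum {ι : Type*} (S : Finset ι) (hs : UniqueDiffOn ℝ s) {f : ι → X → E}
    (hf : ∀ i ∈ S, CbOn k M (f i) s) : CbOn k (S.card * M) (fun x => ∑ i ∈ S, f i x) s := by
  classical
  induction S using Finset.induction_on with
  | empty =>
    simp only [Finset.sum_empty, Finset.card_empty, Nat.cast_zero, zero_mul]
    exact (const (0 : E)).mono norm_zero.le
  | insert a S ha ih =>
    have h1 := (hf a (by simp)).add hs (ih fun i hi => hf i (by simp [hi]))
    refine (h1.mono ?_).congr fun x _ => by simp [Finset.sum_insert ha]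
    rw [Finset.card_insert_of_notMem ha]
    push_cast
    linarith

end CbOn

/-- The derivative is an arbitrary function `f'`, so that explicit formulas for derivatives can be
inserted directly in inductions on the order. -/
theorem cbOn_succ_iff {k : ℕ} {M : ℝ} {f : ℝ → E} {s : Set ℝ} (hs : UniqueDiffOn ℝ s) :
    CbOn (k + 1) M f s ↔ (∀ x ∈ s, ‖f x‖ ≤ M) ∧
      ∃ f' : ℝ → E, (∀ h ∈ s, HasDerivWithinAt f (f' h) s h) ∧ CbOn k M f' s := by
  constructor
  · intro h
    refine ⟨fun x hx => h.norm_le hx, derivWithin f s, fun x hx => ?_, ?_⟩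
    · exact ((h.contDiffOn.differentiableOn (by simp)) x hx).hasDerivWithinAt
    · refine ⟨h.contDiffOn.derivWithin hs (by norm_cast), fun i hi x hx => ?_⟩
      rw [norm_iteratedFDerivWithin_eq_norm_iteratedDerivWithin,
        ← iteratedDerivWithin_succ', ← norm_iteratedFDerivWithin_eq_norm_iteratedDerivWithin]
      exact h.bound (i + 1) (by omega) x hx
  · rintro ⟨hb, f', hf', h⟩
    have he : EqOn (derivWithin f s) f' s := fun x hx => (hf' x hx).derivWithin (hs x hx)
    have h' := h.congr he
    refine ⟨?_, fun i hi x hx => ?_⟩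
    · have := (contDiffOn_succ_iff_derivWithin (n := (k : WithTop ℕ∞)) hs).2
        ⟨fun x hx => (hf' x hx).differentiableWithinAt, by simp, h'.contDiffOn⟩
      exact_mod_cast this
    · rcases i with _ | i
      · simpa using hb x hx
      · rw [norm_iteratedFDerivWithin_eq_norm_iteratedDerivWithin,
          iteratedDerivWithin_succ', ← norm_iteratedFDerivWithin_eq_norm_iteratedDerivWithin]
        exact h'.bound i (by omega) x hx

end Calculus

/-! ### The fixed point equation `w = p + T (β w)` -/

section FixedPoint

universe u

/-- The data of a fixed point equation `w = p + T (β w)`, where `β` is `N` times continuously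
differentiable with bounds `κ` on the open ball of radius `R` and continuous on the closed ball,
and `T` is so small that the equation is contractive. -/
structure IsContractive {E : Type u} [NormedAddCommGroup E] [NormedSpace ℝ E]
    (N : ℕ) (κ R : ℝ) (β : E → E) (T : E →L[ℝ] E) : Prop where
  pos : 0 < R
  one_le : 1 ≤ N
  cont : ContinuousOn β (Metric.closedBall 0 R)
  smooth : CbOn N κ β (Metric.ball 0 R)
  half : ‖T‖ * κ ≤ 1 / 2
  quarter : ‖T‖ * κ ≤ R / 4

/-- The derivative bounds hold on the open ball only, but solutions are sought in the closed one;
continuity carries the bound of order zero over. -/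
theorem norm_le_of_cbOn_ball {E : Type*} [NormedAddCommGroup E] [NormedSpace ℝ E]
    {N : ℕ} {κ R : ℝ} {β : E → E} (hR : 0 < R) (hc : ContinuousOn β (Metric.closedBall 0 R))
    (hb : CbOn N κ β (Metric.ball 0 R)) {w : E} (hw : w ∈ Metric.closedBall (0 : E) R) :
    ‖β w‖ ≤ κ := by
  have hcl : closure (Metric.ball (0 : E) R) = Metric.closedBall 0 R := closure_ball _ hR.ne'
  refine le_on_closure (f := fun w => ‖β w‖) (g := fun _ => κ) (s := Metric.ball 0 R)
    (fun x hx => hb.norm_le hx) ?_ continuousOn_const (hcl ▸ hw)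
  rw [hcl]; exact hc.norm

theorem norm_fderivWithin_le_of_cbOn {E F : Type*} [NormedAddCommGroup E] [NormedSpace ℝ E]
    [NormedAddCommGroup F] [NormedSpace ℝ F]
    {N : ℕ} {κ : ℝ} {β : E → F} {s : Set E} (hs : UniqueDiffOn ℝ s) (hN : 1 ≤ N)
    (hb : CbOn N κ β s) {w : E} (hw : w ∈ s) : ‖fderivWithin ℝ β s w‖ ≤ κ := by
  have := hb.bound 1 hN w hw
  rwa [norm_iteratedFDerivWithin_one _ (hs w hw)] at this

theorem lipschitz_of_cbOn {E F : Type*} [NormedAddCommGroup E] [NormedSpace ℝ E]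
    [NormedAddCommGroup F] [NormedSpace ℝ F]
    {N : ℕ} {κ : ℝ} {β : E → F} {s : Set E} (hs : UniqueDiffOn ℝ s) (hconv : Convex ℝ s)
    (hN : 1 ≤ N) (hb : CbOn N κ β s) {w v : E} (hw : w ∈ s) (hv : v ∈ s) :
    ‖β w - β v‖ ≤ κ * ‖w - v‖ := by
  refine hconv.norm_image_sub_le_of_norm_fderivWithin_le (𝕜 := ℝ) ?_
    (fun x hx => norm_fderivWithin_le_of_cbOn hs hN hb hx) hv hw
  exact hb.contDiffOn.differentiableOn (by exact_mod_cast (by omega : N ≠ 0))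

open Classical in
/-- The solution in the closed ball of radius `R` of `w = p + T (β w)`. -/
noncomputable def solMap {E : Type u} [NormedAddCommGroup E] [NormedSpace ℝ E] (R : ℝ) (β : E → E)
    (T : E →L[ℝ] E) (p : E) : E :=
  if h : ∃ w ∈ Metric.closedBall (0 : E) R, w = p + T (β w) then h.choose else 0

namespace IsContractive

variable {E : Type u} [NormedAddCommGroup E] [NormedSpace ℝ E]
  {N : ℕ} {κ R : ℝ} {β : E → E} {T : E →L[ℝ] E}

theorem nonneg (h : IsContractive N κ R β T) : 0 ≤ κ :=
  h.smooth.nonneg (Metric.mem_ball_self h.pos)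

theorem norm_map_le (h : IsContractive N κ R β T) {w : E} (hw : w ∈ Metric.closedBall (0 : E) R) :
    ‖T (β w)‖ ≤ R / 4 :=
  (T.le_opNorm _).trans ((mul_le_mul_of_nonneg_left
    (norm_le_of_cbOn_ball h.pos h.cont h.smooth hw) (norm_nonneg _)).trans h.quarter)

theorem lipschitz (h : IsContractive N κ R β T) {w v : E} (hw : w ∈ Metric.ball (0 : E) R)
    (hv : v ∈ Metric.ball (0 : E) R) : ‖T (β w) - T (β v)‖ ≤ 1 / 2 * ‖w - v‖ := by
  rw [← map_sub]
  refine (T.le_opNorm _).trans ?_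
  calc _ ≤ ‖T‖ * (κ * ‖w - v‖) := by
        gcongr
        exact lipschitz_of_cbOn Metric.isOpen_ball.uniqueDiffOn (convex_ball _ _) h.one_le
          h.smooth hw hv
    _ = ‖T‖ * κ * ‖w - v‖ := by ring
    _ ≤ _ := by gcongr; exact h.half

/-- The nonlinear term contributes at most `R / 4`, so data below `3 * R / 4` keep every solution in
the open ball, where `β` is differentiable. Data of norm at most `R / 2` then lie in the interior of
the admissible ones. -/
theorem mem_ball (h : IsContractive N κ R β T) {p w : E} (hp : ‖p‖ < 3 * R / 4)
    (hw : w ∈ Metric.closedBall (0 : E) R) (he : w = p + T (β w)) :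
    w ∈ Metric.ball (0 : E) R := by
  rw [mem_ball_zero_iff, he]
  have := h.norm_map_le hw
  linarith [norm_add_le p (T (β w))]

theorem eq_of_fixed (h : IsContractive N κ R β T) {p w v : E} (hp : ‖p‖ < 3 * R / 4)
    (hw : w ∈ Metric.closedBall (0 : E) R) (hwe : w = p + T (β w))
    (hv : v ∈ Metric.closedBall (0 : E) R) (hve : v = p + T (β v)) : w = v := by
  have h1 := h.lipschitz (h.mem_ball hp hw hwe) (h.mem_ball hp hv hve)
  have h2 : w - v = T (β w) - T (β v) := by
    nth_rewrite 1 [hwe]; nth_rewrite 1 [hve]; abel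
  rw [← h2] at h1
  have : ‖w - v‖ = 0 := by linarith [norm_nonneg (w - v)]
  exact sub_eq_zero.1 (norm_eq_zero.1 this)

theorem exists_fixed [CompleteSpace E] (h : IsContractive N κ R β T) {p : E}
    (hp : ‖p‖ < 3 * R / 4) : ∃ w ∈ Metric.closedBall (0 : E) R, w = p + T (β w) := by
  -- The closed ball of this radius is invariant, complete, and contained in the open ball on which
  -- the Lipschitz estimate is available.
  set r := ‖p‖ + R / 4 with hr
  have hrR : r < R := by linarith
  have hsub : Metric.closedBall (0 : E) r ⊆ Metric.ball 0 R := Metric.closedBall_subset_ball hrR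
  have hmaps : MapsTo (fun w => p + T (β w)) (Metric.closedBall (0 : E) r)
      (Metric.closedBall (0 : E) r) := by
    intro w hw
    rw [mem_closedBall_zero_iff]
    have := h.norm_map_le (Metric.ball_subset_closedBall (hsub hw))
    linarith [norm_add_le p (T (β w))]
  have hcontr : ContractingWith (1 / 2) (hmaps.restrict _ _ _) := by
    refine ⟨by norm_num, LipschitzWith.of_dist_le_mul fun x y => ?_⟩
    rw [Subtype.dist_eq, Subtype.dist_eq, dist_eq_norm, dist_eq_norm]
    have := h.lipschitz (hsub x.2) (hsub y.2)
    simp only [MapsTo.val_restrict_apply, add_sub_add_left_eq_sub]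
    simpa using this
  have h0 : (0 : E) ∈ Metric.closedBall (0 : E) r := by
    rw [mem_closedBall_zero_iff, norm_zero]; have := h.pos; positivity
  obtain ⟨w, hw, hfix, -⟩ := hcontr.exists_fixedPoint' Metric.isClosed_closedBall.isComplete
    hmaps h0 (edist_ne_top _ _)
  exact ⟨w, Metric.ball_subset_closedBall (hsub hw), hfix.symm⟩

theorem solMap_spec [CompleteSpace E] (h : IsContractive N κ R β T) {p : E}
    (hp : ‖p‖ < 3 * R / 4) :
    solMap R β T p ∈ Metric.closedBall (0 : E) R ∧
      solMap R β T p = p + T (β (solMap R β T p)) := by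
  have he := h.exists_fixed hp
  have : solMap R β T p = he.choose := dif_pos he
  rw [this]
  exact he.choose_spec

theorem solMap_mem_ball [CompleteSpace E] (h : IsContractive N κ R β T) {p : E}
    (hp : ‖p‖ < 3 * R / 4) : solMap R β T p ∈ Metric.ball (0 : E) R :=
  h.mem_ball hp (h.solMap_spec hp).1 (h.solMap_spec hp).2

theorem eq_solMap [CompleteSpace E] (h : IsContractive N κ R β T) {p w : E}
    (hp : ‖p‖ < 3 * R / 4) (hw : w ∈ Metric.closedBall (0 : E) R) (he : w = p + T (β w)) :
    w = solMap R β T p :=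
  h.eq_of_fixed hp hw he (h.solMap_spec hp).1 (h.solMap_spec hp).2

theorem differentiableAt (h : IsContractive N κ R β T) {w : E} (hw : w ∈ Metric.ball (0 : E) R) :
    HasFDerivAt β (fderivWithin ℝ β (Metric.ball 0 R) w) w :=
  ((h.smooth.contDiffOn.differentiableOn (by exact_mod_cast (by have := h.one_le; omega : N ≠ 0)))
    w hw).hasFDerivWithinAt.hasFDerivAt (Metric.isOpen_ball.mem_nhds hw)

theorem norm_comp_fderivWithin_le (h : IsContractive N κ R β T) {w : E}
    (hw : w ∈ Metric.ball (0 : E) R) :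
    ‖T.comp (fderivWithin ℝ β (Metric.ball 0 R) w)‖ ≤ 1 / 2 := by
  refine (ContinuousLinearMap.opNorm_comp_le _ _).trans (le_trans ?_ h.half)
  gcongr
  exact norm_fderivWithin_le_of_cbOn Metric.isOpen_ball.uniqueDiffOn h.one_le h.smooth hw

/-- The map `v ↦ v - T (β v)` has the derivative `1 - D` with `‖D‖ ≤ 1/2`, invertible by the Neumann
series. Its local inverse stays in the ball near `p`, hence coincides with the solution map by
uniqueness. -/
theorem contDiffAt_solMap [CompleteSpace E] (h : IsContractive N κ R β T) {p : E}
    (hp : ‖p‖ < 3 * R / 4) : ContDiffAt ℝ N (solMap R β T) p := by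
  set w := solMap R β T p with hwdef
  have hw := h.solMap_mem_ball hp
  have hwe := (h.solMap_spec hp).2
  have hN : (N : WithTop ℕ∞) ≠ 0 := by exact_mod_cast (by have := h.one_le; omega : N ≠ 0)
  set D := T.comp (fderivWithin ℝ β (Metric.ball 0 R) w) with hD
  have hD1 : ‖D‖ < 1 := (h.norm_comp_fderivWithin_le hw).trans_lt (by norm_num)
  let e : E ≃L[ℝ] E := ContinuousLinearEquiv.unitsEquiv ℝ E (Units.oneSub D hD1)
  have he : (e : E →L[ℝ] E) = ContinuousLinearMap.id ℝ E - D := rfl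
  have hΦ : ContDiffAt ℝ N (fun v => v - T (β v)) w :=
    contDiffAt_id.sub (T.contDiff.contDiffAt.comp w
      (h.smooth.contDiffOn.contDiffAt (Metric.isOpen_ball.mem_nhds hw)))
  have hΦ' : HasFDerivAt (fun v => v - T (β v)) (e : E →L[ℝ] E) w := by
    rw [he]
    exact (hasFDerivAt_id w).sub (T.hasFDerivAt.comp w (h.differentiableAt hw))
  have hval : w - T (β w) = p := sub_eq_iff_eq_add.2 hwe
  have hinv := hΦ.to_localInverse hΦ' hN
  have himg := hΦ.localInverse_apply_image hΦ' hN
  simp only [hval] at hinv himg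
  refine hinv.congr_of_eventuallyEq ?_
  have hr : ∀ᶠ q in 𝓝 (w - T (β w)), (fun v => v - T (β v)) (hΦ.localInverse hΦ' hN q) = q :=
    (hΦ.hasStrictFDerivAt' hΦ' hN).eventually_right_inverse
  rw [hval] at hr
  have hb : ∀ᶠ q in 𝓝 p, hΦ.localInverse hΦ' hN q ∈ Metric.ball (0 : E) R := by
    refine hinv.continuousAt.eventually_mem ?_
    rw [himg]
    exact Metric.isOpen_ball.mem_nhds hw
  have hq : ∀ᶠ q in 𝓝 p, ‖q‖ < 3 * R / 4 :=
    (continuous_norm.tendsto p).eventually (gt_mem_nhds hp)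
  filter_upwards [hr, hb, hq] with q h1 h2 h3
  exact (h.eq_solMap h3 (Metric.ball_subset_closedBall h2)
    (sub_eq_iff_eq_add.1 h1)).symm

theorem fderivWithin_solMap [CompleteSpace E] (h : IsContractive N κ R β T) {p : E}
    (hp : p ∈ Metric.ball (0 : E) (3 * R / 4)) :
    fderivWithin ℝ (solMap R β T) (Metric.ball 0 (3 * R / 4)) p =
      ContinuousLinearMap.id ℝ E +
        (T.comp (fderivWithin ℝ β (Metric.ball 0 R) (solMap R β T p))).comp
          (fderivWithin ℝ (solMap R β T) (Metric.ball 0 (3 * R / 4)) p) := by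
  have hp' : ‖p‖ < 3 * R / 4 := by simpa using hp
  have hN : (N : WithTop ℕ∞) ≠ 0 := by exact_mod_cast (by have := h.one_le; omega : N ≠ 0)
  have hg : HasFDerivAt (solMap R β T)
      (fderivWithin ℝ (solMap R β T) (Metric.ball 0 (3 * R / 4)) p) p := by
    rw [fderivWithin_of_isOpen Metric.isOpen_ball hp]
    exact ((h.contDiffAt_solMap hp').differentiableAt hN).hasFDerivAt
  have h2 : HasFDerivAt (fun q => q + T (β (solMap R β T q))) _ p :=
    (hasFDerivAt_id p).add
      (T.hasFDerivAt.comp p ((h.differentiableAt (h.solMap_mem_ball hp')).comp p hg))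
  refine hg.unique (h2.congr_of_eventuallyEq ?_)
  filter_upwards [Metric.isOpen_ball.mem_nhds hp] with q hq
  exact (h.solMap_spec (by simpa using hq)).2

end IsContractive

/-- Smoothness is already known; the point is that `C` is chosen before the space and the equation.
Leibniz' rule is applied to `G = 1 + (T ∘ Dβ(g)) ∘ G` with `G = Dg`. The term in which all
derivatives fall on `G` has a factor at most `1/2`, and the others are controlled by the induction
hypothesis. -/
theorem exists_cbOn_solMap_of_le (N m : ℕ) (κ R : ℝ) (hm : m ≤ N) :
    ∃ C : ℝ, ∀ (E : Type u) [NormedAddCommGroup E] [NormedSpace ℝ E] [CompleteSpace E]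
      (β : E → E) (T : E →L[ℝ] E), IsContractive N κ R β T →
        CbOn m C (solMap R β T) (Metric.ball 0 (3 * R / 4)) := by
  induction m with
  | zero =>
    refine ⟨R, fun E _ _ _ β T h => CbOn.zero_iff.2 ⟨fun p hp => ?_, fun p hp => ?_⟩⟩
    · exact (h.contDiffAt_solMap (by simpa using hp)).continuousAt.continuousWithinAt
    · simpa using (h.solMap_spec (by simpa using hp)).1
  | succ m ih =>
    obtain ⟨C, hC⟩ := ih (by omega)
    -- This will bound the derivatives of `p ↦ T ∘ Dβ(g p)`. The constant `κ` is missing because it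
    -- comes with the factor `‖T‖`, and `‖T‖ * κ ≤ 1 / 2`.
    set a : ℝ := m.factorial * (max 1 C) ^ m with ha
    -- The second entry is what `x ≤ 1 + (x / 2 + 2 ^ m * (a * C))` yields for the norm `x` of the
    -- top derivative.
    refine ⟨max C (2 * (1 + 2 ^ m * (a * C))), fun E _ _ _ β T h => ?_⟩
    set g := solMap R β T
    have hs : UniqueDiffOn ℝ (Metric.ball (0 : E) (3 * R / 4)) := Metric.isOpen_ball.uniqueDiffOn
    have ht : UniqueDiffOn ℝ (Metric.ball (0 : E) R) := Metric.isOpen_ball.uniqueDiffOn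
    have hg := hC E β T h
    have hgN : ContDiffOn ℝ N g (Metric.ball (0 : E) (3 * R / 4)) := fun p hp =>
      (h.contDiffAt_solMap (by simpa using hp)).contDiffWithinAt
    have hgm : ContDiffOn ℝ (m + 1 : ℕ) g (Metric.ball (0 : E) (3 * R / 4)) :=
      hgN.of_le (by exact_mod_cast hm)
    have hmaps : MapsTo g (Metric.ball (0 : E) (3 * R / 4)) (Metric.ball (0 : E) R) :=
      fun p hp => h.solMap_mem_ball (by simpa using hp)
    have hβ : CbOn m κ (fderivWithin ℝ β (Metric.ball 0 R)) (Metric.ball 0 R) :=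
      (h.smooth.of_le hm).fderivWithin ht
    have hβg := hβ.comp hs ht hg hmaps
    have hA := hβg.clm hs (ContinuousLinearMap.compL ℝ E E E T)
    have hTn : ‖ContinuousLinearMap.compL ℝ E E E T‖ ≤ ‖T‖ :=
      (ContinuousLinearMap.compL ℝ E E E T).opNorm_le_bound (norm_nonneg _)
        fun S => ContinuousLinearMap.opNorm_comp_le _ _
    have h0 : (0 : E) ∈ Metric.ball (0 : E) (3 * R / 4) :=
      Metric.mem_ball_self (by have := h.pos; linarith)
    have hC0 : 0 ≤ C := hg.nonneg h0
    have hκ := h.nonneg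
    have hA' : CbOn m a (fun p => ContinuousLinearMap.compL ℝ E E E T
        (fderivWithin ℝ β (Metric.ball 0 R) (g p))) (Metric.ball 0 (3 * R / 4)) := by
      refine hA.mono ?_
      calc _ ≤ ‖T‖ * (m.factorial * κ * (max 1 C) ^ m) := by gcongr
        _ = (‖T‖ * κ) * (m.factorial * (max 1 C) ^ m) := by ring
        _ ≤ 1 * (m.factorial * (max 1 C) ^ m) := by gcongr; linarith [h.half]
        _ = a := by rw [one_mul]
    have hGm : ContDiffOn ℝ m (fderivWithin ℝ g (Metric.ball (0 : E) (3 * R / 4)))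
        (Metric.ball (0 : E) (3 * R / 4)) := hgm.fderivWithin hs (by norm_cast)
    refine CbOn.of_fderivWithin hs (hgm.differentiableOn (by simp))
      (fun x hx => (hg.norm_le hx).trans (le_max_left _ _)) ⟨hGm, fun i hi x hx => ?_⟩
    rcases Nat.lt_or_ge i m with him | him
    · rw [norm_iteratedFDerivWithin_fderivWithin hs hx]
      exact (hg.bound (i + 1) him x hx).trans (le_max_left _ _)
    obtain rfl : i = m := le_antisymm hi him
    refine le_trans ?_ (le_max_right _ _)
    set G := fderivWithin ℝ g (Metric.ball (0 : E) (3 * R / 4)) with hG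
    have hcongr : EqOn G (fun p => ContinuousLinearMap.id ℝ E +
        ContinuousLinearMap.compL ℝ E E E (ContinuousLinearMap.compL ℝ E E E T
          (fderivWithin ℝ β (Metric.ball 0 R) (g p))) (G p)) (Metric.ball 0 (3 * R / 4)) :=
      fun p hp => h.fderivWithin_solMap hp
    have hbil := (ContinuousLinearMap.compL ℝ E E E).norm_iteratedFDerivWithin_le_of_bilinear_of_le_one
      hA'.contDiffOn hGm hs hx (n := i) le_rfl (ContinuousLinearMap.norm_compL_le ℝ E E E)
    have hbilc : ContDiffOn ℝ i (fun p => ContinuousLinearMap.compL ℝ E E E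
        (ContinuousLinearMap.compL ℝ E E E T
          (fderivWithin ℝ β (Metric.ball 0 R) (g p))) (G p)) (Metric.ball 0 (3 * R / 4)) :=
      (ContinuousLinearMap.compL ℝ E E E).isBoundedBilinearMap.contDiff.comp_contDiffOn
        (hA'.contDiffOn.prodMk hGm)
    have hkey : ‖iteratedFDerivWithin ℝ i G (Metric.ball 0 (3 * R / 4)) x‖ ≤
        1 + (1 / 2 * ‖iteratedFDerivWithin ℝ i G (Metric.ball 0 (3 * R / 4)) x‖ +
          2 ^ i * (a * C)) := by
      conv_lhs => rw [iteratedFDerivWithin_congr hcongr hx,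
        fun_iteratedFDerivWithin_add_apply (contDiffOn_const x hx) (hbilc x hx) hs hx]
      refine (norm_add_le _ _).trans (add_le_add ?_ (hbil.trans ?_))
      · exact ((CbOn.const (ContinuousLinearMap.id ℝ E)).bound i le_rfl x hx).trans
          ContinuousLinearMap.norm_id_le
      -- This isolates the summand `j = 0`, in which no derivative falls on the coefficient: the one
      -- to be absorbed.
      · rw [Finset.sum_range_succ', add_comm]
        refine add_le_add ?_ ?_
        · simp only [Nat.choose_zero_right, Nat.cast_one, one_mul, Nat.sub_zero,
            norm_iteratedFDerivWithin_zero]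
          gcongr
          exact h.norm_comp_fderivWithin_le (hmaps hx)
        · calc _ ≤ ∑ j ∈ Finset.range i, (i.choose (j + 1) : ℝ) * (a * C) := by
                refine Finset.sum_le_sum fun j hj => ?_
                have hj' := Finset.mem_range.1 hj
                rw [mul_assoc]
                gcongr
                · exact hA'.bound (j + 1) (by omega) x hx
                · rw [norm_iteratedFDerivWithin_fderivWithin hs hx]
                  exact hg.bound _ (by omega) x hx
            _ ≤ ∑ j ∈ Finset.range (i + 1), (i.choose j : ℝ) * (a * C) := by
                rw [Finset.sum_range_succ' _ i]
                have : 0 ≤ ((i.choose 0 : ℕ) : ℝ) * (a * C) := by positivity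
                linarith
            _ = 2 ^ i * (a * C) := by
                rw [← Finset.sum_mul]
                congr 1
                exact_mod_cast Nat.sum_range_choose i
    linarith

theorem exists_cbOn_solMap (N : ℕ) (κ R : ℝ) :
    ∃ C : ℝ, ∀ (E : Type u) [NormedAddCommGroup E] [NormedSpace ℝ E] [CompleteSpace E]
      (β : E → E) (T : E →L[ℝ] E), IsContractive N κ R β T →
        CbOn N C (solMap R β T) (Metric.ball 0 (3 * R / 4)) :=
  exists_cbOn_solMap_of_le N N κ R le_rfl

end FixedPoint

/-! ### Curves of decreasing regularity along a scale of spaces -/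

section Scale

universe u

variable {E : Type u} [NormedAddCommGroup E] [NormedSpace ℝ E]

theorem CbOn.id_of_subset {s : Set ℝ} (hs : UniqueDiffOn ℝ s) (hs1 : s ⊆ Icc 0 1) (k : ℕ) :
    CbOn k 1 (fun h : ℝ => h) s := by
  have hb : ∀ x ∈ s, ‖x‖ ≤ 1 := fun x hx => by
    rw [Real.norm_of_nonneg (hs1 hx).1]; exact (hs1 hx).2
  rcases k with _ | k
  · exact CbOn.zero_iff.2 ⟨continuousOn_id, hb⟩
  · refine (cbOn_succ_iff hs).2 ⟨hb, fun _ => 1, fun h _ => hasDerivWithinAt_id h s, ?_⟩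
    exact (CbOn.const (1 : ℝ)).mono (by simp)

/-- If `f` is the coordinate curve, on the highest level of a scale of spaces, of a curve in the
intersection of these spaces, and `J` is the inclusion of one level into the next one in terms
of coordinates, this says that the curve is `i` times continuously differentiable on the `i`-th
level, with bounds `M`, for `i ≤ k`. -/
def ScaleReg (J : E →L[ℝ] E) (k : ℕ) (M : ℝ) (f : ℝ → E) (s : Set ℝ) : Prop :=
  ∀ i ≤ k, CbOn i M (fun h => (J ^ i) (f h)) s

namespace ScaleReg

variable {J : E →L[ℝ] E} {k m : ℕ} {M M' : ℝ} {f g : ℝ → E} {s : Set ℝ}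

theorem cbOn_zero (h : ScaleReg J k M f s) : CbOn 0 M f s := by
  simpa using h 0 (Nat.zero_le k)

theorem mono (h : ScaleReg J k M f s) (hM : M ≤ M') : ScaleReg J k M' f s :=
  fun i hi => (h i hi).mono hM

theorem of_le (h : ScaleReg J k M f s) (hm : m ≤ k) : ScaleReg J m M f s :=
  fun i hi => h i (hi.trans hm)

theorem congr (h : ScaleReg J k M f s) (hfg : EqOn g f s) : ScaleReg J k M g s :=
  fun i hi => (h i hi).congr fun x hx => by simp only [hfg hx]

theorem add (hs : UniqueDiffOn ℝ s) (hf : ScaleReg J k M f s) (hg : ScaleReg J k M' g s) :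
    ScaleReg J k (M + M') (fun h => f h + g h) s :=
  fun i hi => by simpa using (hf i hi).add hs (hg i hi)

theorem clm (hs : UniqueDiffOn ℝ s) (hf : ScaleReg J k M f s) (L : E →L[ℝ] E) (hL : ‖L‖ ≤ 1)
    (hJ : ∀ x, L (J x) = J (L x)) : ScaleReg J k M (fun h => L (f h)) s := by
  intro i hi
  have hc : Commute L J := ContinuousLinearMap.ext hJ
  refine ((hf i hi).clm_of_le_one hs L hL).congr fun x _ => ?_
  exact (DFunLike.congr_fun (hc.pow_right i).eq (f x)).symm

theorem id_smul (hs : UniqueDiffOn ℝ s) (hs1 : s ⊆ Icc 0 1) (hM : 0 ≤ M)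
    (hf : ScaleReg J k M f s) : ScaleReg J k (2 ^ k * M) (fun h => h • f h) s := by
  intro i hi
  have := (CbOn.id_of_subset hs hs1 i).smul hs (hf i hi)
  refine (this.mono ?_).congr fun x _ => by simp
  rw [one_mul]
  gcongr
  norm_num

theorem zero_iff : ScaleReg J 0 M f s ↔ CbOn 0 M f s := by
  refine ⟨cbOn_zero, fun h i hi => ?_⟩
  obtain rfl : i = 0 := by omega
  simpa using h

/-- The basis of all inductions on the order: a derivative exists only after one application of `J`,
and is then itself the coordinate curve of a regular curve on the next level, because `J ^ (i + 1) ∘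
f` has the derivative `J ^ i ∘ f'`. -/
theorem succ_iff (hs : UniqueDiffOn ℝ s) (hJ : ‖J‖ ≤ 1) :
    ScaleReg J (k + 1) M f s ↔ CbOn 0 M f s ∧ ∃ f' : ℝ → E,
      (∀ h ∈ s, HasDerivWithinAt (fun h => J (f h)) (f' h) s h) ∧ ScaleReg J k M f' s := by
  constructor
  · intro h
    refine ⟨h.cbOn_zero, ?_⟩
    obtain ⟨-, f', hf', -⟩ := (cbOn_succ_iff hs).1 (h 1 (by omega))
    simp only [pow_one] at hf'
    refine ⟨f', hf', fun i hi => ?_⟩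
    obtain ⟨-, g, hg, hgc⟩ := (cbOn_succ_iff hs).1 (h (i + 1) (by omega))
    refine hgc.congr fun x hx => ?_
    have h1 := ((J ^ i).hasFDerivAt.comp_hasDerivWithinAt x (hf' x hx))
    exact (hs x hx).eq_deriv _ h1 (hg x hx)
  · rintro ⟨h0, f', hf', h⟩ i hi
    rcases i with _ | i
    · simpa using h0
    · refine (cbOn_succ_iff hs).2 ⟨fun x hx => ?_, fun x => (J ^ i) (f' x), fun x hx => ?_,
        h i (by omega)⟩
      · refine ((J ^ (i + 1)).le_opNorm _).trans ?_
        have h1 : ‖J ^ (i + 1)‖ ≤ 1 :=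
          (norm_pow_le' J (by omega)).trans (pow_le_one₀ (norm_nonneg _) hJ)
        exact (mul_le_of_le_one_left (norm_nonneg _) h1).trans (h0.norm_le hx)
      · exact ((J ^ i).hasFDerivAt.comp_hasDerivWithinAt x (hf' x hx))

/-- A family of linear operators, one for each level, which are compatible with the inclusions
and the `i`-th of which is `i` times continuously differentiable, preserves regular curves. -/
theorem clm_apply (hs : UniqueDiffOn ℝ s) (hM : 0 ≤ M) (hM' : 0 ≤ M') {F : ℕ → ℝ → E →L[ℝ] E}
    (hF : ∀ i ≤ k, CbOn i M (F i) s)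
    (hJF : ∀ i < k, ∀ h ∈ s, ∀ x, J (F i h x) = F (i + 1) h (J x))
    (hf : ScaleReg J k M' f s) : ScaleReg J k (2 ^ k * (M * M')) (fun h => F 0 h (f h)) s := by
  intro i hi
  have hpow : ∀ j ≤ k, ∀ h ∈ s, ∀ x, (J ^ j) (F 0 h x) = F j h ((J ^ j) x) := by
    intro j hj h hh x
    induction j with
    | zero => simp
    | succ j ih =>
      rw [pow_succ', mul_apply_eq_comp, mul_apply_eq_comp,
        ih (by omega), hJF j (by omega) h hh]
  refine (((hF i hi).clm_apply hs (hf i hi)).mono ?_).congr fun h hh => hpow i hi h hh _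
  gcongr
  norm_num

end ScaleReg

/-- A strongly continuous family `α 0` of bounded operators, together with its formal derivatives
`α 1`, `α 2`, …, on a scale of spaces: `α n` commutes with the inclusions `J`, and it is strongly
differentiable as a family of operators from one level to the next one, with derivative
`α (n + 1) Λ`. -/
structure OpFam (J Λ : E →L[ℝ] E) (Ma : ℕ → ℝ) (s : Set ℝ) (α : ℕ → ℝ → E →L[ℝ] E) : Prop where
  comm_J : ∀ n, ∀ h ∈ s, ∀ x, α n h (J x) = J (α n h x)
  bound : ∀ n, ∀ h ∈ s, ‖α n h‖ ≤ Ma n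
  cont : ∀ n x, ContinuousOn (fun h => α n h x) s
  deriv : ∀ n x, ∀ h ∈ s, HasDerivWithinAt (fun h => α n h (J x)) (α (n + 1) h (Λ x)) s h

namespace OpFam

variable {J Λ : E →L[ℝ] E} {Ma : ℕ → ℝ} {s : Set ℝ} {α : ℕ → ℝ → E →L[ℝ] E}

/-- Strong convergence survives a moving argument because the operators are uniformly bounded. -/
theorem tendsto_apply (hα : OpFam J Λ Ma s α) (n : ℕ) {l : Filter ℝ} (hl : ∀ᶠ h in l, h ∈ s)
    {y : ℝ → E} {y₀ z : E} (hy : Tendsto y l (𝓝 y₀)) (hz : Tendsto (fun h => α n h y₀) l (𝓝 z)) :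
    Tendsto (fun h => α n h (y h)) l (𝓝 z) := by
  have h1 : Tendsto (fun h => α n h (y h - y₀)) l (𝓝 0) := by
    have h2 : Tendsto (fun h => Ma n * ‖y h - y₀‖) l (𝓝 0) := by
      have := ((hy.sub_const y₀).norm).const_mul (Ma n)
      simpa using this
    refine squeeze_zero_norm' ?_ h2
    filter_upwards [hl] with h hh
    exact (α n h).le_of_opNorm_le (hα.bound n h hh) _
  have := h1.add hz
  simpa using this

theorem continuousOn_apply (hα : OpFam J Λ Ma s α) (n : ℕ) {y : ℝ → E} (hy : ContinuousOn y s) :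
    ContinuousOn (fun h => α n h (y h)) s := fun h hh =>
  hα.tendsto_apply n eventually_mem_nhdsWithin (hy h hh) (hα.cont n (y h) h hh)

/-- A product rule without differentiability in operator norm. The family is split into `α n h (g
h₀)`, differentiable because `g h₀` is in the range of `J`, and `α n h (g h - g h₀)`, for which
strong continuity and uniform boundedness suffice. -/
theorem hasDerivWithinAt_apply (hα : OpFam J Λ Ma s α) (n : ℕ) {h₀ : ℝ} (hh : h₀ ∈ s)
    {g : ℝ → E} {g' c : E} (hg : HasDerivWithinAt g g' s h₀) (hc : g h₀ = J c) :
    HasDerivWithinAt (fun h => α n h (g h)) (α (n + 1) h₀ (Λ c) + α n h₀ g') s h₀ := by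
  have h1 : HasDerivWithinAt (fun h => α n h (g h - g h₀)) (α n h₀ g') s h₀ := by
    rw [hasDerivWithinAt_iff_tendsto_slope] at hg ⊢
    have h2 : slope (fun h => α n h (g h - g h₀)) h₀ = fun h => α n h (slope g h₀ h) := by
      funext h
      simp [slope_def_module]
    rw [h2]
    refine hα.tendsto_apply n ?_ hg ?_
    · filter_upwards [self_mem_nhdsWithin] with h hh using hh.1
    · exact (hα.cont n g' h₀ hh).mono_left (nhdsWithin_mono _ sdiff_subset)
  refine ((hα.deriv n c h₀ hh).add h1).congr (fun h _ => ?_) ?_ <;> simp [← hc]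

/-- The derivative `α (n+1) h (Λ (f h)) + α n h (f' h)` consists of two terms of the same kind and
of one order less, hence the induction for all `n` at once. -/
theorem exists_scaleReg_apply (k : ℕ) (Ma : ℕ → ℝ) (n : ℕ) (M : ℝ) :
    ∃ C : ℝ, 0 ≤ C ∧ ∀ (E : Type u) [NormedAddCommGroup E] [NormedSpace ℝ E] (J Λ : E →L[ℝ] E)
      (s : Set ℝ) (α : ℕ → ℝ → E →L[ℝ] E) (f : ℝ → E), UniqueDiffOn ℝ s → ‖J‖ ≤ 1 → ‖Λ‖ ≤ 1 →
      (∀ x, Λ (J x) = J (Λ x)) → OpFam J Λ Ma s α → ScaleReg J k M f s →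
      ScaleReg J k C (fun h => α n h (f h)) s := by
  have hzero : ∀ (E : Type u) [NormedAddCommGroup E] [NormedSpace ℝ E] (J Λ : E →L[ℝ] E)
      (n : ℕ) (s : Set ℝ) (α : ℕ → ℝ → E →L[ℝ] E) (f : ℝ → E), OpFam J Λ Ma s α →
      CbOn 0 M f s → CbOn 0 |Ma n * M| (fun h => α n h (f h)) s := by
    intro E _ _ J Λ n s α f hα hf
    refine CbOn.zero_iff.2 ⟨hα.continuousOn_apply n hf.continuousOn, fun h hh => ?_⟩
    refine le_trans ?_ (le_abs_self _)
    have h0 : 0 ≤ Ma n := (norm_nonneg _).trans (hα.bound n h hh)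
    exact ((α n h).le_of_opNorm_le (hα.bound n h hh) _).trans
      (mul_le_mul_of_nonneg_left (hf.norm_le hh) h0)
  induction k generalizing n with
  | zero =>
    refine ⟨|Ma n * M|, abs_nonneg _, fun E _ _ J Λ s α f hs hJ hΛ hJΛ hα hf => ?_⟩
    exact ScaleReg.zero_iff.2 (hzero E J Λ n s α f hα hf.cbOn_zero)
  | succ k ih =>
    obtain ⟨C₁, hC₁, h₁⟩ := ih (n + 1)
    obtain ⟨C₀, hC₀, h₀⟩ := ih n
    refine ⟨|Ma n * M| + (C₁ + C₀), by positivity,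
      fun E _ _ J Λ s α f hs hJ hΛ hJΛ hα hf => ?_⟩
    obtain ⟨hf0, f', hf', hfr⟩ := (ScaleReg.succ_iff hs hJ).1 hf
    refine (ScaleReg.succ_iff hs hJ).2 ⟨(hzero E J Λ n s α f hα hf0).mono (by linarith),
      fun h => α (n + 1) h (Λ (f h)) + α n h (f' h), fun h hh => ?_, ?_⟩
    · refine (hα.hasDerivWithinAt_apply n hh (hf' h hh) rfl).congr (fun x hx => ?_) ?_
      · exact (hα.comm_J n x hx (f x)).symm
      · exact (hα.comm_J n h hh (f h)).symm
    · refine ScaleReg.mono (ScaleReg.add hs ?_ (h₀ E J Λ s α f' hs hJ hΛ hJΛ hα hfr))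
        (le_add_of_nonneg_left (abs_nonneg _))
      exact h₁ E J Λ s α _ hs hJ hΛ hJΛ hα ((hf.of_le (Nat.le_succ k)).clm hs Λ hΛ hJΛ)

end OpFam

/-! ### Fixed points of contractions depending on a parameter -/

/-- The triangle inequality turns the hypothesis into `‖y h - y h₀‖ ≤ 2 * ‖R h - y h₀‖`. In the
application `R` is the fixed point map with its argument frozen at `y h₀`. -/
theorem continuousWithinAt_of_norm_sub_le_half {E : Type*} [NormedAddCommGroup E] {y R : ℝ → E} {s : Set ℝ} {h₀ : ℝ}
    (hR : ContinuousWithinAt R s h₀) (hR0 : R h₀ = y h₀)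
    (h : ∀ᶠ h in 𝓝[s] h₀, ‖y h - R h‖ ≤ 1 / 2 * ‖y h - y h₀‖) : ContinuousWithinAt y s h₀ := by
  rw [ContinuousWithinAt, tendsto_iff_norm_sub_tendsto_zero] at hR ⊢
  refine squeeze_zero' (Eventually.of_forall fun _ => norm_nonneg _) ?_
    (by simpa using hR.const_mul 2)
  filter_upwards [h] with t ht
  have := norm_sub_le_norm_sub_add_norm_sub (y t) (R t) (y h₀)
  rw [hR0]
  linarith

/-- The same absorption with the tangent line instead of the frozen value: the distance of `y` from
the line is at most twice that of `R`, which is `o(h - h₀)`. -/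
theorem hasDerivWithinAt_of_norm_sub_le_half {y R : ℝ → E} {s : Set ℝ} {h₀ : ℝ} {d : E}
    (hR : HasDerivWithinAt R d s h₀) (hR0 : R h₀ = y h₀)
    (h : ∀ᶠ h in 𝓝[s] h₀, ‖y h - R h‖ ≤ 1 / 2 * ‖y h - (y h₀ + (h - h₀) • d)‖) :
    HasDerivWithinAt y d s h₀ := by
  rw [hasDerivWithinAt_iff_isLittleO] at hR ⊢
  refine Asymptotics.IsBigO.trans_isLittleO (Asymptotics.IsBigO.of_bound 2 ?_) hR
  filter_upwards [h] with t ht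
  have h1 := norm_sub_le_norm_sub_add_norm_sub (y t) (R t) (y h₀ + (t - h₀) • d)
  rw [hR0, sub_sub, sub_sub]
  linarith

theorem exists_eq_add_of_norm_le_half [CompleteSpace E] (G : E →L[ℝ] E) (hG : ‖G‖ ≤ 1 / 2)
    (b : E) : ∃ d, d = b + G d := by
  have hG1 : ‖G‖ < 1 := hG.trans_lt (by norm_num)
  let u := Units.oneSub G hG1
  refine ⟨(↑u⁻¹ : E →L[ℝ] E) b, ?_⟩
  have h1 : ((u : E →L[ℝ] E) * ↑u⁻¹) b = b := by rw [Units.mul_inv]; rfl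
  have h2 : (u : E →L[ℝ] E) = 1 - G := rfl
  rw [h2, mul_apply_eq_comp, _root_.sub_apply,
    one_apply_eq_self, sub_eq_iff_eq_add] at h1
  exact h1

namespace OpFam

variable {J Λ : E →L[ℝ] E} {Ma : ℕ → ℝ} {s : Set ℝ} {α : ℕ → ℝ → E →L[ℝ] E}

theorem continuousWithinAt_fixed (hα : OpFam J Λ Ma s α) {y q : ℝ → E} {Φ : ℝ → E → E} {h₀ : ℝ}
    (hh : h₀ ∈ s) (hy : ∀ h ∈ s, y h = q h + h • α 0 h (Φ h (y h)))
    (hq : ContinuousWithinAt q s h₀) (hΦ : ContinuousWithinAt (fun h => Φ h (y h₀)) s h₀)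
    (hc : ∀ h ∈ s, ‖h • α 0 h (Φ h (y h)) - h • α 0 h (Φ h (y h₀))‖ ≤ 1 / 2 * ‖y h - y h₀‖) :
    ContinuousWithinAt y s h₀ := by
  refine continuousWithinAt_of_norm_sub_le_half (R := fun h => q h + h • α 0 h (Φ h (y h₀)))
    (hq.add (continuousWithinAt_id.smul ?_)) (hy h₀ hh).symm ?_
  · exact hα.tendsto_apply 0 eventually_mem_nhdsWithin hΦ (hα.cont 0 _ h₀ hh)
  · filter_upwards [self_mem_nhdsWithin] with h hs
    refine le_trans (le_of_eq ?_) (hc h hs)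
    rw [sub_add_eq_sub_sub, sub_eq_iff_eq_add'.2 (hy h hs)]

/-- The candidate `d` solves the formally differentiated equation by a Neumann series. Inserting the
line `y h₀ + (h - h₀) • d` into the right side of the fixed point equation gives a curve with the
derivative `d`, and contractivity keeps `y` close to that curve. The element `c` is needed because
`α` is differentiable only on the range of `J`. -/
theorem exists_hasDerivWithinAt_fixed [CompleteSpace E] (hα : OpFam J Λ Ma s α) {y q : ℝ → E}
    {Φ : ℝ → E → E} {h₀ : ℝ} {q' e c : E} {D : E →L[ℝ] E} (hh : h₀ ∈ s)
    (hy : ∀ h ∈ s, y h = q h + h • α 0 h (Φ h (y h)))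
    (hq : HasDerivWithinAt q q' s h₀) (hJc : Φ h₀ (y h₀) = J c)
    (hD : ‖(h₀ • α 0 h₀).comp D‖ ≤ 1 / 2)
    (hΦ : ∀ d, HasDerivWithinAt (fun h => Φ h (y h₀ + (h - h₀) • d)) (e + D d) s h₀)
    (hc : ∀ d, ∀ᶠ h in 𝓝[s] h₀, ‖h • α 0 h (Φ h (y h)) - h • α 0 h (Φ h (y h₀ + (h - h₀) • d))‖ ≤
      1 / 2 * ‖y h - (y h₀ + (h - h₀) • d)‖) :
    ∃ d, HasDerivWithinAt y d s h₀ ∧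
      d = (q' + (α 0 h₀ (J c) + h₀ • (α 1 h₀ (Λ c) + α 0 h₀ e))) + h₀ • α 0 h₀ (D d) := by
  obtain ⟨d, hd⟩ := exists_eq_add_of_norm_le_half ((h₀ • α 0 h₀).comp D) hD
    (q' + (α 0 h₀ (J c) + h₀ • (α 1 h₀ (Λ c) + α 0 h₀ e)))
  refine ⟨d, ?_, hd⟩
  have h1 := hα.hasDerivWithinAt_apply 0 hh (hΦ d) (c := c) (by simpa using hJc)
  have h2 := hq.add ((hasDerivWithinAt_id h₀ s).smul h1)
  refine hasDerivWithinAt_of_norm_sub_le_half (h2.congr_deriv ?_) ?_ ?_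
  · conv_rhs => rw [hd]
    simp only [id, sub_self, zero_smul, add_zero, hJc, map_add, smul_add, zero_add, one_smul,
      ContinuousLinearMap.comp_apply, _root_.smul_apply]
    abel
  · simpa using (hy h₀ hh).symm
  · filter_upwards [self_mem_nhdsWithin, hc d] with h hs hcd
    refine le_trans (le_of_eq ?_) hcd
    simp only [Pi.add_apply, Pi.smul_apply', id]
    rw [sub_add_eq_sub_sub, sub_eq_iff_eq_add'.2 (hy h hs)]

end OpFam

end Scale

/-! ### Regularity along the scale of solutions of fixed point equations. -/

section ScaleFixedPoint

universe u

/-- The derivative of `J ∘ v` solves an equation of the same type with the shifted coefficients `F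
(i + 1)`. Its inhomogeneity involves `q'` and `v`, the latter with order `k` only, so the induction
hypothesis is used twice: for `v`, and then for `v'` with a larger bound on the data. Hence the
generalization over `M`. -/
theorem exists_scaleReg_linear (k : ℕ) (Ma : ℕ → ℝ) (M : ℝ) (hM : 0 ≤ M) :
    ∃ C : ℝ, 0 ≤ C ∧ ∀ (E : Type u) [NormedAddCommGroup E] [NormedSpace ℝ E] [CompleteSpace E]
      (J Λ : E →L[ℝ] E) (s : Set ℝ) (α : ℕ → ℝ → E →L[ℝ] E) (q v : ℝ → E) (F : ℕ → ℝ → E →L[ℝ] E),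
      UniqueDiffOn ℝ s → s ⊆ Icc 0 1 → ‖J‖ ≤ 1 → ‖Λ‖ ≤ 1 → (∀ x, Λ (J x) = J (Λ x)) →
      OpFam J Λ Ma s α → ScaleReg J k M q s → (∀ i ≤ k, CbOn i M (F i) s) →
      (∀ i < k, ∀ h ∈ s, ∀ x, J (F i h x) = F (i + 1) h (J x)) →
      (∀ i ≤ k, ∀ h ∈ s, ‖(h • α 0 h).comp (F i h)‖ ≤ 1 / 2) →
      (∀ h ∈ s, v h = q h + h • α 0 h (F 0 h (v h))) → ScaleReg J k C v s := by
  have hcontr : ∀ (E : Type u) [NormedAddCommGroup E] [NormedSpace ℝ E]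
      (T S : E →L[ℝ] E) (h : ℝ), ‖(h • T).comp S‖ ≤ 1 / 2 → ∀ x y : E,
        ‖h • T (S x) - h • T (S y)‖ ≤ 1 / 2 * ‖x - y‖ := by
    intro E _ _ T S h hTS x y
    have := ((h • T).comp S).le_of_opNorm_le hTS (x - y)
    rw [← smul_sub]
    simpa using this
  induction k generalizing M with
  | zero =>
    refine ⟨2 * M, by positivity,
      fun E _ _ _ J Λ s α q v F hs hs1 hJ hΛ hJΛ hα hq hF hJF hαF hv => ?_⟩
    refine ScaleReg.zero_iff.2 (CbOn.zero_iff.2 ⟨fun h hh => ?_, fun h hh => ?_⟩)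
    · refine hα.continuousWithinAt_fixed (Φ := fun h x => F 0 h x) hh hv
        (hq.cbOn_zero.continuousOn h hh) ?_ ?_
      · exact ((hF 0 le_rfl).continuousOn h hh).clm_apply continuousWithinAt_const
      · exact fun t ht => hcontr E _ _ t (hαF 0 le_rfl t ht) _ _
    · have h1 := hcontr E _ _ h (hαF 0 le_rfl h hh) (v h) 0
      simp only [map_zero, smul_zero, sub_zero] at h1
      have h2 := norm_add_le (q h) (h • α 0 h (F 0 h (v h)))
      rw [← hv h hh] at h2
      have h3 := hq.cbOn_zero.norm_le hh
      linarith
  | succ k ih =>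
    obtain ⟨C₀, hC₀, h₀⟩ := ih M hM
    set P : ℝ := 2 ^ k * (M * C₀) with hP
    obtain ⟨C₁, hC₁, h₁⟩ := OpFam.exists_scaleReg_apply.{u} k Ma 0 P
    obtain ⟨C₂, hC₂, h₂⟩ := OpFam.exists_scaleReg_apply.{u} k Ma 1 P
    set Q : ℝ := M + (C₁ + 2 ^ k * (C₂ + C₁)) with hQ
    have hMQ : M ≤ Q := le_add_of_nonneg_right (by positivity)
    obtain ⟨C₃, hC₃, h₃⟩ := ih Q (hM.trans hMQ)
    refine ⟨C₀ + C₃, by positivity,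
      fun E _ _ _ J Λ s α q v F hs hs1 hJ hΛ hJΛ hα hq hF hJF hαF hv => ?_⟩
    have hvk : ScaleReg J k C₀ v s := h₀ E J Λ s α q v F hs hs1 hJ hΛ hJΛ hα
      (hq.of_le (Nat.le_succ k)) (fun i hi => hF i (hi.trans (Nat.le_succ k)))
      (fun i hi => hJF i (by omega)) (fun i hi => hαF i (by omega)) hv
    obtain ⟨-, q', hq', hqr⟩ := (ScaleReg.succ_iff hs hJ).1 hq
    have hF' : ∀ i ≤ k, ∃ F' : ℝ → E →L[ℝ] E,
        (∀ h ∈ s, HasDerivWithinAt (F (i + 1)) (F' h) s h) ∧ CbOn i M F' s := fun i hi =>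
      ((cbOn_succ_iff hs).1 (hF (i + 1) (by omega))).2
    choose! F' hFd hFc using hF'
    have hJF' : ∀ i < k, ∀ h ∈ s, ∀ x, J (F' i h x) = F' (i + 1) h (J x) := by
      intro i hi h hh x
      have h1 := J.hasFDerivAt.comp_hasDerivWithinAt h
        ((hFd i (by omega) h hh).clm_apply (hasDerivWithinAt_const h s x))
      have h2 := (hFd (i + 1) (by omega) h hh).clm_apply (hasDerivWithinAt_const h s (J x))
      have h3 := h2.congr (f₁ := J ∘ fun h => F (i + 1) h x)
        (fun t ht => hJF (i + 1) (by omega) t ht x) (hJF (i + 1) (by omega) h hh x)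
      simpa using (hs h hh).eq_deriv _ h1 h3
    have hJv : ∀ h ∈ s, J (v h) = J (q h) + h • α 0 h (F 1 h (J (v h))) := by
      intro h hh
      conv_lhs => rw [hv h hh]
      rw [map_add, map_smul, ← hα.comm_J 0 h hh, hJF 0 (by omega) h hh]
    have hder : ∀ h ∈ s, ∃ d, HasDerivWithinAt (fun h => J (v h)) d s h ∧
        d = (q' h + (α 0 h (J (F 0 h (v h))) + h • (α 1 h (Λ (F 0 h (v h))) +
          α 0 h (F' 0 h (J (v h)))))) + h • α 0 h (F 1 h d) := by
      intro h hh
      refine hα.exists_hasDerivWithinAt_fixed (Φ := fun h x => F 1 h x) hh hJv (hq' h hh)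
        (hJF 0 (by omega) h hh _).symm (hαF 1 (by omega) h hh) (fun d => ?_) (fun d => ?_)
      · have h1 : HasDerivWithinAt (fun t => J (v h) + (t - h) • d) d s h := by
          simpa using (((hasDerivWithinAt_id h s).sub_const h).smul_const d).const_add (J (v h))
        simpa using (hFd 0 (by omega) h hh).clm_apply h1
      · filter_upwards [self_mem_nhdsWithin] with t ht
        exact hcontr E _ _ t (hαF 1 (by omega) t ht) _ _
    choose! v' hv' hve using hder
    refine (ScaleReg.succ_iff hs hJ).2 ⟨hvk.cbOn_zero.mono (by linarith), v', hv', ?_⟩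
    have hJvk := hvk.clm hs J hJ fun _ => rfl
    have hFv : ScaleReg J k P (fun h => F 0 h (v h)) s := hvk.clm_apply hs hM hC₀
      (fun i hi => hF i (by omega)) (fun i hi => hJF i (by omega))
    have hFJv : ScaleReg J k P (fun h => F' 0 h (J (v h))) s :=
      hJvk.clm_apply hs hM hC₀ hFc hJF'
    have hq1 := hqr.add hs ((h₁ E J Λ s α _ hs hJ hΛ hJΛ hα (hFv.clm hs J hJ fun _ => rfl)).add hs
      (((h₂ E J Λ s α _ hs hJ hΛ hJΛ hα (hFv.clm hs Λ hΛ hJΛ)).add hs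
        (h₁ E J Λ s α _ hs hJ hΛ hJΛ hα hFJv)).id_smul hs hs1 (by positivity)))
    refine ScaleReg.mono ?_ (le_add_of_nonneg_left hC₀)
    exact h₃ E J Λ s α _ v' (fun i => F (i + 1)) hs hs1 hJ hΛ hJΛ hα hq1
      (fun i hi => ((hF (i + 1) (by omega)).of_le (Nat.le_succ i)).mono hMQ)
      (fun i hi => hJF (i + 1) (by omega)) (fun i hi => hαF (i + 1) (by omega)) hve

/-- The derivative of `J ∘ w` solves a linear equation whose coefficients are the derivatives of `β
(i + 1)` at `J ^ (i + 1) (w h)`. Their regularity follows from that of `w` of order `k`, known by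
induction, and the linear result then gives the missing order. -/
theorem exists_scaleReg_nonlinear (k : ℕ) (Ma : ℕ → ℝ) (M κ R : ℝ) (hM : 0 ≤ M) (hκ : 0 ≤ κ) :
    ∃ C : ℝ, 0 ≤ C ∧ ∀ (E : Type u) [NormedAddCommGroup E] [NormedSpace ℝ E] [CompleteSpace E]
      (J Λ : E →L[ℝ] E) (s : Set ℝ) (α : ℕ → ℝ → E →L[ℝ] E) (q w : ℝ → E) (β : ℕ → E → E),
      UniqueDiffOn ℝ s → s ⊆ Icc 0 1 → ‖J‖ ≤ 1 → ‖Λ‖ ≤ 1 → (∀ x, Λ (J x) = J (Λ x)) →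
      OpFam J Λ Ma s α → ScaleReg J k M q s →
      (∀ i ≤ k, ∀ h ∈ s, IsContractive (i + 1) κ R (β i) (h • α 0 h)) →
      (∀ i < k, ∀ x, J (β i x) = β (i + 1) (J x)) →
      (∀ h ∈ s, w h ∈ Metric.ball (0 : E) R) →
      (∀ h ∈ s, w h = q h + h • α 0 h (β 0 (w h))) → ScaleReg J k C w s := by
  induction k with
  | zero =>
    refine ⟨|R|, abs_nonneg _,
      fun E _ _ _ J Λ s α q w β hs hs1 hJ hΛ hJΛ hα hq hβ hJβ hwR hw => ?_⟩
    refine ScaleReg.zero_iff.2 (CbOn.zero_iff.2 ⟨fun h hh => ?_, fun h hh => ?_⟩)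
    · refine hα.continuousWithinAt_fixed (Φ := fun _ x => β 0 x) hh hw
        (hq.cbOn_zero.continuousOn h hh) continuousWithinAt_const fun t ht => ?_
      simpa using (hβ 0 le_rfl t ht).lipschitz (hwR t ht) (hwR h hh)
    · exact (mem_ball_zero_iff.1 (hwR h hh)).le.trans (le_abs_self R)
  | succ k ih =>
    obtain ⟨C₀, hC₀, h₀⟩ := ih
    set P : ℝ := k.factorial * κ * (max 1 C₀) ^ k with hP
    have hP0 : 0 ≤ P := by positivity
    have hPi : ∀ i ≤ k, i.factorial * κ * (max 1 C₀) ^ i ≤ P := by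
      intro i hi
      have := Nat.factorial_le hi
      rw [hP]
      gcongr
      exact le_max_left _ _
    obtain ⟨C₁, hC₁, h₁⟩ := OpFam.exists_scaleReg_apply.{u} k Ma 0 P
    obtain ⟨C₂, hC₂, h₂⟩ := OpFam.exists_scaleReg_apply.{u} k Ma 1 P
    set Q : ℝ := P + (M + (C₁ + 2 ^ k * C₂)) with hQ
    obtain ⟨C₃, hC₃, h₃⟩ := exists_scaleReg_linear.{u} k Ma Q (by positivity)
    refine ⟨C₀ + C₃, by positivity,
      fun E _ _ _ J Λ s α q w β hs hs1 hJ hΛ hJΛ hα hq hβ hJβ hwR hw => ?_⟩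
    have hwk : ScaleReg J k C₀ w s := h₀ E J Λ s α q w β hs hs1 hJ hΛ hJΛ hα
      (hq.of_le (Nat.le_succ k)) (fun i hi => hβ i (by omega)) (fun i hi => hJβ i (by omega)) hwR hw
    have hball : UniqueDiffOn ℝ (Metric.ball (0 : E) R) := Metric.isOpen_ball.uniqueDiffOn
    have hJball : ∀ x ∈ Metric.ball (0 : E) R, J x ∈ Metric.ball (0 : E) R := fun x hx => by
      rw [mem_ball_zero_iff] at hx ⊢
      exact (J.le_of_opNorm_le hJ x).trans_lt (by simpa using hx)
    have hJiball : ∀ i, ∀ h ∈ s, (J ^ i) (w h) ∈ Metric.ball (0 : E) R := by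
      intro i h hh
      induction i with
      | zero => simpa using hwR h hh
      | succ i ihi => rw [pow_succ', mul_apply_eq_comp]; exact hJball _ ihi
    obtain ⟨-, q', hq', hqr⟩ := (ScaleReg.succ_iff hs hJ).1 hq
    have hJw : ∀ h ∈ s, J (w h) = J (q h) + h • α 0 h (β 1 (J (w h))) := by
      intro h hh
      conv_lhs => rw [hw h hh]
      rw [map_add, map_smul, ← hα.comm_J 0 h hh, hJβ 0 (by omega)]
    set F : ℕ → ℝ → E →L[ℝ] E := fun i h =>
      fderivWithin ℝ (β i) (Metric.ball 0 R) ((J ^ i) (w h)) with hF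
    have hFn : ∀ i ≤ k + 1, ∀ h ∈ s, ‖(h • α 0 h).comp (F i h)‖ ≤ 1 / 2 := fun i hi h hh =>
      (hβ i hi h hh).norm_comp_fderivWithin_le (hJiball i h hh)
    have hFd : ∀ i ≤ k + 1, ∀ h ∈ s, HasFDerivAt (β i) (F i h) ((J ^ i) (w h)) :=
      fun i hi h hh => (hβ i hi h hh).differentiableAt (hJiball i h hh)
    have hder : ∀ h ∈ s, ∃ d, HasDerivWithinAt (fun h => J (w h)) d s h ∧
        d = (q' h + (α 0 h (J (β 0 (w h))) + h • (α 1 h (Λ (β 0 (w h))) + α 0 h 0))) +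
          h • α 0 h (F 1 h d) := by
      intro h hh
      refine hα.exists_hasDerivWithinAt_fixed (Φ := fun _ x => β 1 x) hh hJw (hq' h hh)
        (hJβ 0 (by omega) _).symm (hFn 1 (by omega) h hh) (fun d => ?_) (fun d => ?_)
      · have h1 : HasDerivWithinAt (fun t => J (w h) + (t - h) • d) d s h := by
          simpa using (((hasDerivWithinAt_id h s).sub_const h).smul_const d).const_add (J (w h))
        have h2 := hFd 1 (by omega) h hh
        rw [pow_one] at h2
        have h3 : HasFDerivAt (β 1) (F 1 h) (J (w h) + (h - h) • d) := by simpa using h2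
        rw [zero_add]
        exact h3.comp_hasDerivWithinAt h h1
      · have hcont : ContinuousWithinAt (fun t => J (w h) + (t - h) • d) s h := by fun_prop
        have hmem : ∀ᶠ t in 𝓝[s] h, J (w h) + (t - h) • d ∈ Metric.ball (0 : E) R := by
          refine hcont.eventually_mem ?_
          refine Metric.isOpen_ball.mem_nhds ?_
          simpa using hJball _ (hwR h hh)
        filter_upwards [self_mem_nhdsWithin, hmem] with t ht htm
        simpa using (hβ 1 (by omega) t ht).lipschitz (hJball _ (hwR t ht)) htm
    choose! w' hw' hwe using hder
    refine (ScaleReg.succ_iff hs hJ).2 ⟨hwk.cbOn_zero.mono (by linarith), w', hw', ?_⟩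
    have hJβi : ∀ i ≤ k, ∀ h, (J ^ i) (β 0 (w h)) = β i ((J ^ i) (w h)) := by
      intro i hi h
      induction i with
      | zero => simp
      | succ i ihi =>
        rw [pow_succ', mul_apply_eq_comp, mul_apply_eq_comp, ihi (by omega), hJβ i (by omega)]
    -- The smoothness of `β` is part of the contractivity at some parameter in `s`, so a point of
    -- `s` is needed to use it.
    rcases s.eq_empty_or_nonempty with rfl | ⟨t₀, ht₀⟩
    · exact fun i hi => ⟨contDiffOn_empty, fun _ _ _ hx => absurd hx (notMem_empty _)⟩
    have hβw : ScaleReg J k P (fun h => β 0 (w h)) s := by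
      intro i hi
      have h1 := (((hβ i (by omega) t₀ ht₀).smooth.of_le (Nat.le_succ i)).comp hs hball (hwk i hi)
        (fun h hh => hJiball i h hh)).mono (hPi i hi)
      exact h1.congr fun h _ => hJβi i hi h
    have hFc : ∀ i ≤ k, CbOn i P (F (i + 1)) s := by
      intro i hi
      -- Level `i + 1` offers `i + 2` derivatives of `β`, hence more than the `i` that are needed of
      -- its derivative. The inner curve has order `i` as the image under `J` of one that does.
      have h1 := ((hβ (i + 1) (by omega) t₀ ht₀).smooth.fderivWithin hball).of_le (Nat.le_succ i)
      have h2 : CbOn i C₀ (fun h => (J ^ (i + 1)) (w h)) s := by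
        simpa [pow_succ'] using (hwk i hi).clm_of_le_one hs J hJ
      exact (h1.comp hs hball h2 fun h hh => hJiball (i + 1) h hh).mono (hPi i hi)
    have hJF : ∀ i ≤ k, ∀ h ∈ s, ∀ x, J (F i h x) = F (i + 1) h (J x) := by
      intro i hi h hh x
      have h1 := J.hasFDerivAt.comp _ (hFd i (by omega) h hh)
      have h2 := hFd (i + 1) (by omega) h hh
      rw [pow_succ', mul_apply_eq_comp] at h2
      have h3 := h2.comp _ J.hasFDerivAt
      have h4 : J ∘ β i = β (i + 1) ∘ J := funext fun y => hJβ i (by omega) y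
      rw [h4] at h1
      exact DFunLike.congr_fun (h1.unique h3) x
    have hq1 : ScaleReg J k (M + (C₁ + 2 ^ k * C₂)) (fun h => q' h + (α 0 h (J (β 0 (w h))) +
        h • (α 1 h (Λ (β 0 (w h))) + α 0 h 0))) s := by
      have h1 := hqr.add hs
        ((h₁ E J Λ s α _ hs hJ hΛ hJΛ hα (hβw.clm hs J hJ fun _ => rfl)).add hs
          ((h₂ E J Λ s α _ hs hJ hΛ hJΛ hα (hβw.clm hs Λ hΛ hJΛ)).id_smul hs hs1 hC₂))
      exact h1.congr fun h _ => by simp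
    refine ScaleReg.mono ?_ (le_add_of_nonneg_left hC₀)
    exact h₃ E J Λ s α _ w' (fun i => F (i + 1)) hs hs1 hJ hΛ hJΛ hα
      (hq1.mono (le_add_of_nonneg_left hP0))
      (fun i hi => (hFc i hi).mono (le_add_of_nonneg_right (by positivity)))
      (fun i hi => hJF (i + 1) (by omega)) (fun i hi => hFn (i + 1) (by omega)) hwe

end ScaleFixedPoint


/-! ### The resolvent of a normal generator of a contraction semigroup -/

section Resolvent

variable {Y : Type*} [NormedAddCommGroup Y] [InnerProductSpace ℂ Y] [CompleteSpace Y]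
  {A : Y →ₗ.[ℂ] Y} {S : ℝ → Y →L[ℂ] Y}

local notation "⟪" x ", " y "⟫" => inner ℂ x y

/-- Dissipativity: `Re ⟨S t x, x⟩ ≤ ‖x‖²` for a contraction, divided by `t` in the limit. -/
theorem IsGenerator.re_inner_le (hg : IsGenerator A S) (hS : CondA2 S) {x y : Y}
    (h : (x, y) ∈ A.graph) : (⟪y, x⟫).re ≤ 0 := by
  have h1 := (hg x y).1 h
  have h2 : Tendsto (fun t : ℝ => (⟪((t⁻¹ : ℝ) : ℂ) • (S t x - x), x⟫).re) (𝓝[>] 0)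
      (𝓝 (⟪y, x⟫).re) :=
    (Complex.continuous_re.tendsto _).comp (h1.inner tendsto_const_nhds)
  refine le_of_tendsto h2 ?_
  filter_upwards [self_mem_nhdsWithin] with t ht
  have ht' : (0 : ℝ) < t := ht
  rw [inner_smul_left, Complex.conj_ofReal, Complex.re_ofReal_mul, inner_sub_left, Complex.sub_re]
  refine mul_nonpos_of_nonneg_of_nonpos (by positivity) (sub_nonpos.2 ?_)
  have h3 : (⟪x, x⟫).re = ‖x‖ ^ 2 := by
    have := inner_self_eq_norm_sq (𝕜 := ℂ) x
    simpa using this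
  rw [h3]
  calc (⟪S t x, x⟫).re ≤ ‖⟪S t x, x⟫‖ := Complex.re_le_norm _
    _ ≤ ‖S t x‖ * ‖x‖ := norm_inner_le_norm _ _
    _ ≤ (1 * ‖x‖) * ‖x‖ := by gcongr; exact (S t).le_of_opNorm_le (hS t ht'.le) x
    _ = ‖x‖ ^ 2 := by ring

theorem IsGenerator.norm_add_le_norm_sub (hg : IsGenerator A S) (hS : CondA2 S) {x y : Y}
    (h : (x, y) ∈ A.graph) : ‖x + y‖ ≤ ‖x - y‖ := by
  have h1 := hg.re_inner_le hS h
  have h2 := norm_add_sq (𝕜 := ℂ) x y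
  have h3 := norm_sub_sq (𝕜 := ℂ) x y
  have h4 : RCLike.re ⟪x, y⟫ = (⟪y, x⟫).re := by
    rw [← inner_conj_symm, RCLike.conj_re]; rfl
  rw [h4] at h2 h3
  refine (sq_le_sq₀ (norm_nonneg _) (norm_nonneg _)).1 ?_
  rw [h2, h3]; linarith

theorem IsGenerator.norm_le_norm_sub (hg : IsGenerator A S) (hS : CondA2 S) {x y : Y}
    (h : (x, y) ∈ A.graph) : ‖x‖ ≤ ‖x - y‖ := by
  have h1 := hg.norm_add_le_norm_sub hS h
  have h2 : (2 : ℝ) * ‖x‖ ≤ ‖x + y‖ + ‖x - y‖ := by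
    have h3 : (2 : ℝ) • x = (x + y) + (x - y) := by rw [two_smul]; abel
    have h4 : ‖(2 : ℝ) • x‖ = 2 * ‖x‖ := by rw [norm_smul]; simp
    rw [← h4, h3]
    exact norm_add_le _ _
  linarith

namespace IsC0Semigroup

theorem commute (hs : IsC0Semigroup S) {t r : ℝ} (ht : 0 ≤ t) (hr : 0 ≤ r) (x : Y) :
    S t (S r x) = S r (S t x) := by
  have h1 := DFunLike.congr_fun (hs.add t r ht hr) x
  have h2 := DFunLike.congr_fun (hs.add r t hr ht) x
  rw [add_comm r t] at h2
  exact h1.symm.trans h2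

theorem norm_sub_le (hs : IsC0Semigroup S) (hS : CondA2 S) {t r : ℝ} (ht : 0 ≤ t) (hr : 0 ≤ r)
    (x : Y) : ‖S r x - S t x‖ ≤ ‖S |r - t| x - x‖ := by
  wlog htr : t ≤ r generalizing t r
  · rw [norm_sub_rev, abs_sub_comm]; exact this hr ht (le_of_not_ge htr)
  have h1 := DFunLike.congr_fun (hs.add t (r - t) ht (sub_nonneg.2 htr)) x
  rw [add_sub_cancel, ContinuousLinearMap.comp_apply] at h1
  rw [abs_of_nonneg (sub_nonneg.2 htr), h1, ← map_sub]
  simpa using (S t).le_of_opNorm_le (hS t ht) (S (r - t) x - x)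

theorem continuousOn (hs : IsC0Semigroup S) (hS : CondA2 S) (x : Y) :
    ContinuousOn (fun t => S t x) (Ici 0) := by
  intro t ht
  have h0 : ContinuousWithinAt (fun τ => S τ x) (Ici 0) 0 := by
    rw [← continuousWithinAt_Ioi_iff_Ici]
    have := hs.tendsto x
    rw [ContinuousWithinAt, hs.zero]
    exact this
  have h1 : Tendsto (fun r : ℝ => |r - t|) (𝓝[Ici 0] t) (𝓝[Ici 0] 0) := by
    refine tendsto_nhdsWithin_iff.2 ⟨?_, Eventually.of_forall fun r => mem_Ici.2 (abs_nonneg _)⟩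
    have : Tendsto (fun r : ℝ => |r - t|) (𝓝 t) (𝓝 |t - t|) := by
      apply Continuous.tendsto; fun_prop
    rw [sub_self, abs_zero] at this
    exact this.mono_left nhdsWithin_le_nhds
  have h2 := tendsto_iff_norm_sub_tendsto_zero.1 (h0.tendsto.comp h1)
  rw [ContinuousWithinAt, tendsto_iff_norm_sub_tendsto_zero]
  refine squeeze_zero' (Eventually.of_forall fun _ => norm_nonneg _) ?_ h2
  filter_upwards [self_mem_nhdsWithin] with r hr
  have := hs.norm_sub_le hS ht hr x
  simpa [hs.zero] using this

theorem hasDerivWithinAt (hs : IsC0Semigroup S) (hS : CondA2 S) (hg : IsGenerator A S) {x y : Y}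
    (h : (x, y) ∈ A.graph) {t : ℝ} (ht : 0 ≤ t) :
    HasDerivWithinAt (fun t => S t x) (S t y) (Ici 0) t := by
  rw [hasDerivWithinAt_iff_tendsto_slope, tendsto_iff_norm_sub_tendsto_zero]
  have h1 : Tendsto (fun r : ℝ => |r - t|) (𝓝[Ici 0 \ {t}] t) (𝓝[>] 0) := by
    refine tendsto_nhdsWithin_iff.2 ⟨?_, ?_⟩
    · have : Tendsto (fun r : ℝ => |r - t|) (𝓝 t) (𝓝 |t - t|) := by
        apply Continuous.tendsto; fun_prop
      rw [sub_self, abs_zero] at this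
      exact this.mono_left nhdsWithin_le_nhds
    · filter_upwards [self_mem_nhdsWithin] with r hr
      exact abs_pos.2 (sub_ne_zero.2 hr.2)
  have h2 := tendsto_iff_norm_sub_tendsto_zero.1 (((hg x y).1 h).comp h1)
  have h3 : Tendsto (fun r => ‖S r y - S t y‖) (𝓝[Ici 0 \ {t}] t) (𝓝 0) :=
    tendsto_iff_norm_sub_tendsto_zero.1
      ((hs.continuousOn hS y t ht).tendsto.mono_left (nhdsWithin_mono _ sdiff_subset))
  refine squeeze_zero' (Eventually.of_forall fun _ => norm_nonneg _) ?_
    (by simpa using h2.add h3)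
  filter_upwards [self_mem_nhdsWithin] with r hr
  have hr0 : 0 ≤ r := hr.1
  simp only [slope_def_module]
  -- For `r < t` the quotient is `S r`, not `S t`, applied to a one-sided quotient at `0`; the
  -- additional term `S r y - S t y` tends to zero by strong continuity.
  rcases lt_or_gt_of_ne (show r ≠ t from hr.2) with hrt | hrt
  · have h4 := DFunLike.congr_fun (hs.add r (t - r) hr0 (sub_nonneg.2 hrt.le)) x
    rw [add_sub_cancel, ContinuousLinearMap.comp_apply] at h4
    rw [abs_of_neg (sub_neg.2 hrt), neg_sub, ← Complex.ofReal_inv, Complex.coe_smul]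
    set z := (t - r)⁻¹ • (S (t - r) x - x) with hz
    have h5 : (r - t)⁻¹ • (S r x - S t x) = S r z := by
      rw [hz, (S r).map_smul_of_tower, map_sub, ← h4, ← neg_sub t r, inv_neg, neg_smul, ← smul_neg, neg_sub]
    have h6 : S r z - S t y = S r (z - y) + (S r y - S t y) := by rw [map_sub]; abel
    rw [h5, h6]
    refine (norm_add_le _ _).trans (add_le_add ?_ le_rfl)
    simpa using (S r).le_of_opNorm_le (hS r hr0) (z - y)
  · have h4 := DFunLike.congr_fun (hs.add t (r - t) ht (sub_nonneg.2 hrt.le)) x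
    rw [add_sub_cancel, ContinuousLinearMap.comp_apply] at h4
    rw [abs_of_pos (sub_pos.2 hrt), ← Complex.ofReal_inv, Complex.coe_smul]
    set z := (r - t)⁻¹ • (S (r - t) x - x) with hz
    have h5 : (r - t)⁻¹ • (S r x - S t x) = S t z := by
      rw [hz, (S t).map_smul_of_tower, map_sub, ← h4]
    rw [h5, ← map_sub]
    refine le_add_of_le_of_nonneg ?_ (norm_nonneg _)
    simpa using (S t).le_of_opNorm_le (hS t ht) (z - y)

theorem mem_graph (hs : IsC0Semigroup S) (hg : IsGenerator A S) {x y : Y}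
    (h : (x, y) ∈ A.graph) {t : ℝ} (ht : 0 ≤ t) : (S t x, S t y) ∈ A.graph := by
  rw [hg]
  refine (((S t).continuous.tendsto y).comp ((hg x y).1 h)).congr' ?_
  filter_upwards [self_mem_nhdsWithin] with r hr
  simp only [Function.comp_apply, map_smul, map_sub]
  rw [hs.commute ht (le_of_lt hr)]

end IsC0Semigroup

/-- `1 - A` has dense range. -/
theorem eq_zero_of_inner_sub_eq_zero (h1 : CondA1 A S) (h2 : CondA2 S) {v : Y}
    (hv : ∀ x y, (x, y) ∈ A.graph → ⟪v, x - y⟫ = 0) : v = 0 := by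
  refine h1.normal.dense.eq_zero_of_inner_left ℂ ?_
  intro x hx
  obtain ⟨y, hy⟩ := LinearPMap.mem_domain_iff.1 hx
  -- Orthogonality of `v` to the range of `1 - A` means `d/dt ⟨v, S t x⟩ = ⟨v, S t x⟩`. So this
  -- product is constant, while contractivity makes it decay.
  have hder : ∀ t : ℝ, 0 ≤ t → HasDerivWithinAt (fun t : ℝ => Complex.exp (-t) * ⟪v, S t x⟫) 0 (Ici 0) t := by
    intro t ht
    have h3 : HasDerivWithinAt (fun t : ℝ => ⟪v, S t x⟫) ⟪v, S t y⟫ (Ici 0) t :=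
      ((innerSL ℂ v).restrictScalars ℝ).hasFDerivAt.comp_hasDerivWithinAt t
        (h1.semigroup.hasDerivWithinAt h2 h1.generator hy ht)
    have h4 : HasDerivWithinAt (fun t : ℝ => Complex.exp (-t)) (Complex.exp (-t) * (-1)) (Ici 0) t :=
      ((Complex.hasDerivAt_exp _).comp t (Complex.ofRealCLM.hasDerivAt.neg)).hasDerivWithinAt
    refine (h4.mul h3).congr_deriv ?_
    have h5 := hv _ _ (h1.semigroup.mem_graph h1.generator hy ht)
    rw [inner_sub_right] at h5
    linear_combination (-Complex.exp (-t)) * h5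
  have hconst : ∀ t : ℝ, 0 ≤ t → Complex.exp (-t) * ⟪v, S t x⟫ = ⟪v, x⟫ := by
    intro t ht
    have := constant_of_has_deriv_right_zero
      (f := fun t : ℝ => Complex.exp (-t) * ⟪v, S t x⟫) (a := 0) (b := t)
      (fun r hr => (hder r hr.1).continuousWithinAt.mono Icc_subset_Ici_self)
      (fun r hr => (hder r hr.1).mono (Ici_subset_Ici.2 hr.1)) t ⟨ht, le_rfl⟩
    simpa [h1.semigroup.zero] using this
  have hlim : Tendsto (fun t : ℝ => Real.exp (-t) * (‖v‖ * ‖x‖)) atTop (𝓝 0) := by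
    simpa using (Real.tendsto_exp_neg_atTop_nhds_zero).mul_const (‖v‖ * ‖x‖)
  have hle : ‖⟪v, x⟫‖ ≤ 0 := by
    refine ge_of_tendsto hlim ?_
    filter_upwards [eventually_ge_atTop 0] with t ht
    rw [← hconst t ht, norm_mul, Complex.norm_exp]
    simp only [Complex.neg_re, Complex.ofReal_re]
    gcongr
    refine (norm_inner_le_norm _ _).trans ?_
    gcongr
    simpa using (S t).le_of_opNorm_le (h2 t ht) x
  exact norm_le_zero_iff.1 hle

/-- By dissipativity `1 - A` is bounded below on the graph of `A`, which is complete, so its range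
is closed; it is dense because its orthogonal complement vanishes. -/
theorem exists_isResolventAtOne (h1 : CondA1 A S) (h2 : CondA2 S) :
    ∃ T : Y →L[ℂ] Y, IsResolventAtOne A T := by
  have hle : ∀ g : A.graph, ‖g.1.1‖ ≤ ‖g.1.1 - g.1.2‖ := fun g =>
    h1.generator.norm_le_norm_sub h2 g.2
  have : CompleteSpace A.graph := h1.normal.closed.completeSpace_coe
  let D : A.graph →L[ℂ] Y :=
    (ContinuousLinearMap.fst ℂ Y Y - ContinuousLinearMap.snd ℂ Y Y).comp A.graph.subtypeL
  have hD : ∀ g, D g = g.1.1 - g.1.2 := fun g => rfl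
  have hanti : AntilipschitzWith 2 D := by
    refine D.antilipschitz_of_bound fun g => ?_
    have h3 := hle g
    rw [← hD] at h3
    have h4 : ‖g.1.2‖ ≤ ‖g.1.1‖ + ‖D g‖ := by
      have : g.1.2 = g.1.1 - D g := by rw [hD]; abel
      rw [this]; exact norm_sub_le _ _
    have h5 : ‖g‖ = max ‖g.1.1‖ ‖g.1.2‖ := rfl
    rw [h5]
    have : ((2 : NNReal) : ℝ) = 2 := rfl
    rw [this]
    exact max_le (by linarith [norm_nonneg (D g)]) (by linarith)
  have hclosed : IsClosed (D.range : Set Y) := hanti.isClosed_range D.uniformContinuous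
  have hrange : D.range = ⊤ := by
    rw [← hclosed.submodule_topologicalClosure_eq, Submodule.topologicalClosure_eq_top_iff,
      Submodule.eq_bot_iff]
    intro v hv
    refine eq_zero_of_inner_sub_eq_zero h1 h2 fun x y hxy => ?_
    exact (Submodule.mem_orthogonal' _ _).1 hv _ ⟨⟨(x, y), hxy⟩, rfl⟩
  let e : A.graph ≃ₗ[ℂ] Y := LinearEquiv.ofBijective D.toLinearMap
    ⟨hanti.injective, LinearMap.range_eq_top.1 hrange⟩
  have he : ∀ u, (e.symm u).1.1 - (e.symm u).1.2 = u := fun u => e.apply_symm_apply u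
  refine ⟨((LinearMap.fst ℂ Y Y).comp (A.graph.subtype.comp e.symm.toLinearMap)).mkContinuous 1
    fun u => ?_, fun u => ?_, fun x y hxy => ?_⟩
  · have := hle (e.symm u)
    rw [he] at this
    simpa using this
  · have h3 : (e.symm u).1.1 - u = (e.symm u).1.2 := by
      nth_rewrite 2 [← he u]; abel
    change ((e.symm u).1.1, (e.symm u).1.1 - u) ∈ A.graph
    rw [h3]
    exact (e.symm u).2
  · have : e.symm (x - y) = ⟨(x, y), hxy⟩ := e.symm_apply_eq.2 rfl
    change (e.symm (x - y)).1.1 = x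
    rw [this]

theorem isResolventAtOne_resolventAtOne (h1 : CondA1 A S) (h2 : CondA2 S) :
    IsResolventAtOne A (resolventAtOne A) := by
  have h := exists_isResolventAtOne h1 h2
  rw [resolventAtOne, dif_pos h]
  exact h.choose_spec

namespace IsResolventAtOne

variable {T : Y →L[ℂ] Y}

theorem injective (hT : IsResolventAtOne A T) : Function.Injective T := by
  refine (injective_iff_map_eq_zero T).2 fun x hx => ?_
  have h := hT.1 x
  rw [hx, zero_sub] at h
  exact neg_eq_zero.1 (LinearPMap.graph_fst_eq_zero_snd A h rfl)

theorem range_eq (hT : IsResolventAtOne A T) : range T = (A.domain : Set Y) := by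
  ext x
  constructor
  · rintro ⟨u, rfl⟩
    exact LinearPMap.mem_domain_iff.2 ⟨_, hT.1 u⟩
  · intro hx
    obtain ⟨y, hy⟩ := LinearPMap.mem_domain_iff.1 hx
    exact ⟨x - y, hT.2 x y hy⟩

theorem denseRange (hT : IsResolventAtOne A T) (hA : Dense (A.domain : Set Y)) : DenseRange T := by
  rw [DenseRange, hT.range_eq]; exact hA

theorem mem_graph_iff (hT : IsResolventAtOne A T) {x y : Y} :
    (x, y) ∈ A.graph ↔ ∃ p, x = T p ∧ y = T p - p := by
  constructor
  · intro h
    have h3 := hT.2 x y h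
    exact ⟨x - y, h3.symm, by rw [h3]; abel⟩
  · rintro ⟨p, rfl, rfl⟩
    exact hT.1 p

/-- The adjoint is `1 - (T*)⁻¹`, so normality of `A` can be expressed by the bounded operators `T`
and `T*` alone. -/
theorem mem_adjoint_graph_iff (hT : IsResolventAtOne A T) (hA : Dense (A.domain : Set Y))
    {x y : Y} : (x, y) ∈ A.adjoint.graph ↔ ∃ p, x = star T p ∧ y = star T p - p := by
  rw [LinearPMap.adjoint_graph_eq_graph_adjoint hA, Submodule.mem_adjoint_iff,
    ContinuousLinearMap.star_eq_adjoint]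
  constructor
  · intro h
    have h3 : ContinuousLinearMap.adjoint T (x - y) = x := by
      refine ext_inner_left ℂ fun u => ?_
      rw [ContinuousLinearMap.adjoint_inner_right, inner_sub_right]
      have := h _ _ (hT.1 u)
      simp only [inner_sub_left] at this
      linear_combination this
    exact ⟨x - y, h3.symm, by rw [h3]; abel⟩
  · rintro ⟨p, rfl, rfl⟩ a b hab
    have h3 := hT.2 a b hab
    rw [map_sub, sub_eq_iff_eq_add] at h3
    simp only [inner_sub_right, ContinuousLinearMap.adjoint_inner_right]
    rw [h3, inner_add_left]
    ring

end IsResolventAtOne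

end Resolvent


/-! ### Normality and spectrum of the resolvent. -/

section Normality

variable {Y : Type*} [NormedAddCommGroup Y] [InnerProductSpace ℂ Y] [CompleteSpace Y]

local notation "⟪" x ", " y "⟫" => inner ℂ x y

/-- For `T = (1 - A)⁻¹`, this is `T* (1 + A† A) T`. -/
noncomputable def resolventForm (T : Y →L[ℂ] Y) : Y →L[ℂ] Y := star T * T + (star T - 1) * (T - 1)

/-- Coercivity: the quadratic form is `‖T p‖² + ‖T p - p‖²`, which is at least `‖p‖² / 2`. -/
theorem isUnit_resolventForm (T : Y →L[ℂ] Y) : IsUnit (resolventForm T) := by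
  refine ContinuousLinearMap.isUnit_of_forall_le_norm_inner_map _ (c := 1 / 2) (by norm_num)
    fun p => ?_
  have h1 : ⟪resolventForm T p, p⟫ = ((‖T p‖ ^ 2 + ‖T p - p‖ ^ 2 : ℝ) : ℂ) := by
    have h2 : resolventForm T p = ContinuousLinearMap.adjoint T (T p) +
        (ContinuousLinearMap.adjoint T (T p - p) - (T p - p)) := rfl
    rw [h2, inner_add_left, inner_sub_left, ContinuousLinearMap.adjoint_inner_left,
      ContinuousLinearMap.adjoint_inner_left, ← inner_sub_right, inner_self_eq_norm_sq_to_K,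
      inner_self_eq_norm_sq_to_K]
    push_cast
    rfl
  rw [h1, Complex.norm_real, Real.norm_of_nonneg (by positivity)]
  have h3 : ‖p‖ ≤ ‖T p‖ + ‖T p - p‖ := by
    have : p = T p - (T p - p) := by abel
    nth_rewrite 1 [this]
    exact norm_sub_le _ _
  have h4 : ‖p‖ ^ 2 ≤ (‖T p‖ + ‖T p - p‖) ^ 2 := by gcongr
  have h5 : ((1 / 2 : NNReal) : ℝ) = 1 / 2 := by simp
  rw [h5]
  nlinarith [sq_nonneg (‖T p‖ - ‖T p - p‖)]

theorem star_resolventForm (T : Y →L[ℂ] Y) : star (resolventForm T) = resolventForm T := by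
  simp [resolventForm]

/-- If `A = 1 - T⁻¹` satisfies `A† A = A A†`, then `T` is normal. The two sides of the hypothesis
are the graphs of `A† A` and of `A A†`. -/
theorem isStarNormal_of_graph_comm {T : Y →L[ℂ] Y} (hinj : Function.Injective T)
    (hdense : DenseRange T)
    (hcomm : ∀ x z, (∃ p r, x = T p ∧ T p - p = star T r ∧ z = star T r - r) →
      (∃ p r, x = star T p ∧ star T p - p = T r ∧ z = T r - r)) : IsStarNormal T := by
  have hinj' : Function.Injective ⇑(star T) := by
    refine (injective_iff_map_eq_zero (star T)).2 fun x hx => ?_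
    refine hdense.eq_zero_of_inner_right ℂ fun u => ?_
    rw [← ContinuousLinearMap.adjoint_inner_right]
    rw [ContinuousLinearMap.star_eq_adjoint] at hx
    rw [hx, inner_zero_right]
  obtain ⟨Q, hQ⟩ := isUnit_resolventForm T
  obtain ⟨Q', hQ'⟩ := isUnit_resolventForm (star T)
  set Qi : Y →L[ℂ] Y := (↑Q⁻¹ : Y →L[ℂ] Y) with hQi
  set Qi' : Y →L[ℂ] Y := (↑Q'⁻¹ : Y →L[ℂ] Y) with hQi'
  have hQQ : ∀ x, resolventForm T (Qi x) = x := fun x => by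
    rw [← hQ, hQi, ← mul_apply_eq_comp, Units.mul_inv, one_apply_eq_self]
  have hQQ' : ∀ x, Qi' (resolventForm (star T) x) = x := fun x => by
    rw [← hQ', hQi', ← mul_apply_eq_comp, Units.inv_mul, one_apply_eq_self]
  have hform : ∀ x, resolventForm T x = star T (T x) + (star T (T x - x) - (T x - x)) :=
    fun x => rfl
  have hform' : ∀ x, resolventForm (star T) x = T (star T x) + (T (star T x - x) - (star T x - x)) :=
    fun x => by rw [resolventForm, star_star]; rfl
  -- This is `(1 + A† A)⁻¹`; correspondingly, `star T * Qi' * T` is `(1 + A A†)⁻¹`.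
  set R : Y →L[ℂ] Y := T * Qi * star T with hR
  have hRapp : ∀ u, R u = T (Qi (star T u)) := fun u => rfl
  have hgraph : ∀ u, star T (T (Qi (star T u)) + (T (Qi (star T u)) - Qi (star T u)) - u) =
      T (Qi (star T u)) - Qi (star T u) := by
    intro u
    have h1 := hQQ (star T u)
    rw [hform] at h1
    generalize Qi (star T u) = p at h1 ⊢
    rw [map_sub, map_add, ← h1]
    abel
  have hR' : ∀ p r, star T p - p = T r → (star T * Qi' * T) (star T p + (T r - r)) = star T p := by
    intro p r h
    have h1 : T (star T p + (T r - r)) = resolventForm (star T) p := by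
      rw [hform', h, map_add, map_sub]
    rw [mul_apply_eq_comp, mul_apply_eq_comp, h1, hQQ']
  -- Only here the hypothesis enters: the two products have the same graph, hence the same bounded
  -- inverses.
  have hRR' : R = star T * Qi' * T := by
    ext u
    obtain ⟨p', r', h1, h2, h3⟩ := hcomm (R u) (u - R u)
      ⟨Qi (star T u), T (Qi (star T u)) + (T (Qi (star T u)) - Qi (star T u)) - u, hRapp u,
        (hgraph u).symm, by rw [hgraph, hRapp]; abel⟩
    have h4 := hR' p' r' h2
    rw [← h3, ← h1, add_sub_cancel] at h4
    exact h4.symm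
  have hRinj : Function.Injective R := by
    refine (injective_iff_map_eq_zero R).2 fun u hu => ?_
    rw [hRapp] at hu
    have h1 : Qi (star T u) = 0 := hinj (by rw [hu, map_zero])
    have h2 := hQQ (star T u)
    rw [h1, map_zero] at h2
    exact hinj' (by rw [← h2, map_zero])
  -- In general `A` intertwines `1 + A† A` and `1 + A A†`. As `R` is the inverse of both, it
  -- commutes with `A` and so with `T`.
  have hRT : R * T = T * R := by
    ext q
    set p := Qi (star T (T q)) with hp
    have h1 := hgraph (T q)
    rw [← hp] at h1
    have h2 := hR' (T p + (T p - p) - T q) (q - p) (by rw [h1, map_sub]; abel)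
    rw [h1, ← hRR', map_sub] at h2
    have h3 : T p - p + (T q - T p - (q - p)) = T q - q := by abel
    have h4 : R (T q) = T p := rfl
    rw [h3, map_sub, h4] at h2
    have h5 : R q = p := sub_right_injective h2
    exact h4.trans (congrArg T h5.symm)
  have hstarR : star R = R := by
    have h1 : star Qi = Qi := by
      have h2 : star Q = Q := Units.ext (by rw [Units.coe_star, hQ]; exact star_resolventForm T)
      rw [hQi, ← Units.coe_star_inv, h2]
    rw [hR, star_mul, star_mul, star_star, h1, mul_assoc]
  have hRT' : R * star T = star T * R := by
    have := congrArg star hRT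
    rw [star_mul R T, star_mul T R, hstarR] at this
    exact this.symm
  have hRQ : Commute R Qi := by
    rw [hQi]
    refine Commute.units_inv_right ?_
    rw [hQ]
    have h1 : Commute R T := hRT
    have h2 : Commute R (star T) := hRT'
    exact (h2.mul_right h1).add_right
      ((h2.sub_right (Commute.one_right R)).mul_right (h1.sub_right (Commute.one_right R)))
  have hX : T * Qi = Qi' * T := by
    have h1 : R * (Qi' * T) = R * (T * Qi) := by
      calc R * (Qi' * T) = (T * Qi) * (star T * Qi' * T) := by rw [hR]; noncomm_ring
        _ = (T * Qi) * R := by rw [← hRR']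
        _ = R * (T * Qi) := by rw [mul_assoc, ← hRQ.eq, ← mul_assoc, ← hRT, mul_assoc]
    ext u
    exact (hRinj (DFunLike.congr_fun h1 u)).symm
  have hfin : resolventForm (star T) * T = T * resolventForm T := by
    have h1 : (Q' : Y →L[ℂ] Y) * (T * Qi) * Q = Q' * (Qi' * T) * Q := by rw [hX]
    rw [hQi, hQi'] at h1
    rw [← hQ, ← hQ']
    calc (Q' : Y →L[ℂ] Y) * T = Q' * (T * ↑Q⁻¹) * Q := by
          rw [mul_assoc, mul_assoc, Units.inv_mul, mul_one]
      _ = _ := h1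
      _ = T * Q := by rw [← mul_assoc, Units.mul_inv, one_mul]
  refine ⟨?_⟩
  -- On the right the cubic terms and the squares of `T` cancel, leaving the commutator.
  have h1 : star T * T - T * star T = T * resolventForm T - resolventForm (star T) * T := by
    rw [resolventForm, resolventForm, star_star]
    noncomm_ring
  rw [hfin, sub_self] at h1
  exact sub_eq_zero.1 h1

theorem IsResolventAtOne.isStarNormal {A : Y →ₗ.[ℂ] Y} {T : Y →L[ℂ] Y}
    (hT : IsResolventAtOne A T) (hA : IsNormalOp A) : IsStarNormal T := by
  refine isStarNormal_of_graph_comm hT.injective (hT.denseRange hA.dense) fun x z h => ?_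
  obtain ⟨p, r, h1, h2, h3⟩ := h
  obtain ⟨y, hy1, hy2⟩ := (hA.comm x z).1 ⟨T p - p, hT.mem_graph_iff.2 ⟨p, h1, rfl⟩,
    (hT.mem_adjoint_graph_iff hA.dense).2 ⟨r, h2, h3⟩⟩
  obtain ⟨p', hp1, hp2⟩ := (hT.mem_adjoint_graph_iff hA.dense).1 hy1
  obtain ⟨r', hr1, hr2⟩ := hT.mem_graph_iff.1 hy2
  exact ⟨p', r', hp1, hp2.symm.trans hr1, hr2⟩

/-- The spectrum of `(1 - A)⁻¹` lies in the disc with the diameter `[0, 1]`. -/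
theorem IsResolventAtOne.norm_two_smul_sub_one_le {A : Y →ₗ.[ℂ] Y} {S : ℝ → Y →L[ℂ] Y}
    {T : Y →L[ℂ] Y} (hT : IsResolventAtOne A T) (hg : IsGenerator A S) (hS : CondA2 S) :
    ‖(2 : ℂ) • T - 1‖ ≤ 1 := by
  refine ContinuousLinearMap.opNorm_le_bound _ zero_le_one fun u => ?_
  have h := hg.norm_add_le_norm_sub hS (hT.1 u)
  rw [sub_sub_cancel] at h
  rw [one_mul]
  refine le_trans (le_of_eq ?_) h
  congr 1
  rw [_root_.sub_apply, _root_.smul_apply, one_apply_eq_self, two_smul]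
  abel

/-- For `w ≠ 0`, the inequality `|2w - 1| ≤ 1` says `|w|² ≤ Re w`, which is `Re (1/w) ≥ 1`. -/
theorem IsResolventAtOne.re_le_zero_of_mem_spectrum {A : Y →ₗ.[ℂ] Y} {S : ℝ → Y →L[ℂ] Y}
    {T : Y →L[ℂ] Y} (hT : IsResolventAtOne A T) (hg : IsGenerator A S) (hS : CondA2 S) {w : ℂ}
    (hw : w ∈ spectrum ℂ T) (h0 : w ≠ 0) : 1 - w⁻¹ ∈ leftHalfPlane := by
  have h1 : 2 * w - 1 ∈ spectrum ℂ ((2 : ℂ) • T - 1) := by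
    have h2 : (2 : ℂ) * w ∈ spectrum ℂ ((2 : ℂ) • T) := by
      have := (spectrum.smul_mem_smul_iff (R := ℂ) (a := T) (s := w) (r := Units.mk0 2 two_ne_zero)).2 hw
      simpa [Units.smul_def] using this
    have h3 := spectrum.sub_singleton_eq (R := ℂ) ((2 : ℂ) • T) 1
    rw [map_one] at h3
    rw [← h3]
    exact ⟨_, h2, 1, rfl, rfl⟩
  have h2 : ‖2 * w - 1‖ ≤ 1 := by
    rcases subsingleton_or_nontrivial Y with hY | hY
    · have : Subsingleton (Y →L[ℂ] Y) := ⟨fun a b => ContinuousLinearMap.ext fun x =>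
        Subsingleton.elim _ _⟩
      rw [spectrum.of_subsingleton] at hw
      exact absurd hw (notMem_empty _)
    · exact (spectrum.norm_le_norm_of_mem h1).trans (hT.norm_two_smul_sub_one_le hg hS)
  have h3 : (2 * w.re - 1) ^ 2 + (2 * w.im) ^ 2 ≤ 1 := by
    have h4 := Complex.sq_norm (2 * w - 1)
    rw [Complex.normSq_apply] at h4
    have h5 : ‖2 * w - 1‖ ^ 2 ≤ 1 := pow_le_one₀ (norm_nonneg _) h2
    rw [h4] at h5
    simp at h5
    nlinarith
  have h4 : 0 < Complex.normSq w := Complex.normSq_pos.2 h0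
  change (1 - w⁻¹).re ≤ 0
  rw [Complex.sub_re, Complex.inv_re, Complex.one_re, sub_nonpos, one_le_div h4,
    Complex.normSq_apply]
  nlinarith

end Normality


/-! ### Bounded functional calculus through the resolvent. -/

section FunctionalCalculus

variable {Y : Type*} [NormedAddCommGroup Y] [InnerProductSpace ℂ Y] [CompleteSpace Y]

/-- `f` is continuous and bounded by `M` on the closed left half plane. -/
structure BddLeft (M : ℝ) (f : ℂ → ℂ) : Prop where
  cont : ContinuousOn f leftHalfPlane
  bound : ∀ z ∈ leftHalfPlane, ‖f z‖ ≤ M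

namespace BddLeft

variable {M M' : ℝ} {f g : ℂ → ℂ}

theorem nonneg (h : BddLeft M f) : 0 ≤ M :=
  (norm_nonneg _).trans (h.bound 0 (by simp [leftHalfPlane]))

theorem add (hf : BddLeft M f) (hg : BddLeft M' g) : BddLeft (M + M') (fun z => f z + g z) :=
  ⟨hf.cont.add hg.cont, fun z hz =>
    (norm_add_le _ _).trans (add_le_add (hf.bound z hz) (hg.bound z hz))⟩

theorem mul (hf : BddLeft M f) (hg : BddLeft M' g) : BddLeft (M * M') (fun z => f z * g z) :=
  ⟨hf.cont.mul hg.cont, fun z hz => by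
    rw [norm_mul]
    exact mul_le_mul (hf.bound z hz) (hg.bound z hz) (norm_nonneg _) hf.nonneg⟩

theorem const (c : ℂ) : BddLeft ‖c‖ (fun _ => c) := ⟨continuousOn_const, fun _ _ => le_rfl⟩

theorem const_mul (hf : BddLeft M f) (c : ℂ) : BddLeft (‖c‖ * M) (fun z => c * f z) :=
  (const c).mul hf

end BddLeft

/-- The properties of the resolvent `T = (1 - A)⁻¹` of a normal generator of a contraction semigroup
on which its functional calculus relies. -/
structure IsNormalResolvent (T : Y →L[ℂ] Y) : Prop where
  normal : IsStarNormal T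
  injective : Function.Injective T
  dense : DenseRange T
  spec : ∀ w ∈ spectrum ℂ T, w ≠ 0 → 1 - w⁻¹ ∈ leftHalfPlane

theorem isNormalResolvent_resolventAtOne {A : Y →ₗ.[ℂ] Y} {S : ℝ → Y →L[ℂ] Y} (h1 : CondA1 A S)
    (h2 : CondA2 S) : IsNormalResolvent (resolventAtOne A) := by
  have hT := isResolventAtOne_resolventAtOne h1 h2
  exact ⟨hT.isStarNormal h1.normal, hT.injective, hT.denseRange h1.normal.dense,
    fun w hw h0 => hT.re_le_zero_of_mem_spectrum h1.generator h2 hw h0⟩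

namespace IsNormalResolvent

variable {T : Y →L[ℂ] Y} {M : ℝ} {f : ℂ → ℂ}

theorem norm_mul_le (hT : IsNormalResolvent T) (hf : BddLeft M f) {w : ℂ} (hw : w ∈ spectrum ℂ T) :
    ‖w * f (1 - w⁻¹)‖ ≤ M * ‖w‖ := by
  by_cases h0 : w = 0
  · simp [h0]
  · rw [norm_mul, mul_comm]
    gcongr
    exact hf.bound _ (hT.spec w hw h0)

theorem continuousOn (hT : IsNormalResolvent T) (hf : BddLeft M f) :
    ContinuousOn (fun w : ℂ => w * f (1 - w⁻¹)) (spectrum ℂ T) := by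
  intro w hw
  by_cases h0 : w = 0
  · subst h0
    rw [ContinuousWithinAt, zero_mul]
    have h1 : Tendsto (fun w : ℂ => M * ‖w‖) (𝓝[spectrum ℂ T] 0) (𝓝 0) := by
      have : Continuous fun w : ℂ => M * ‖w‖ := by fun_prop
      simpa using (this.tendsto 0).mono_left nhdsWithin_le_nhds
    refine squeeze_zero_norm' ?_ h1
    filter_upwards [self_mem_nhdsWithin] with v hv using hT.norm_mul_le hf hv
  · have h1 : ContinuousWithinAt (fun w : ℂ => w * f (1 - w⁻¹)) (spectrum ℂ T ∩ {0}ᶜ) w := by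
      refine continuousWithinAt_id.mul ?_
      refine ContinuousWithinAt.comp (t := leftHalfPlane) (hf.cont _ (hT.spec w hw h0)) ?_
        fun v hv => hT.spec v hv.1 hv.2
      exact continuousWithinAt_const.sub (continuousWithinAt_id.inv₀ h0)
    refine h1.mono_of_mem_nhdsWithin ?_
    exact inter_mem self_mem_nhdsWithin
      (mem_nhdsWithin_of_mem_nhds (isOpen_compl_singleton.mem_nhds h0))

/-- With `k = √(M²|w|² - |g|²)` the calculus gives `g(T)* g(T) + k(T)* k(T) = M² T* T`, thus `‖g(T)
x‖² ≤ M² ‖T x‖²`. This is what makes `f(A)` bounded on the range of `T`. -/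
theorem norm_cfc_apply_le (hT : IsNormalResolvent T) (hf : BddLeft M f) (x : Y) :
    ‖cfc (fun w : ℂ => w * f (1 - w⁻¹)) T x‖ ≤ M * ‖T x‖ := by
  have := hT.normal
  set g : ℂ → ℂ := fun w => w * f (1 - w⁻¹) with hg
  have hgc : ContinuousOn g (spectrum ℂ T) := hT.continuousOn hf
  set k : ℂ → ℂ := fun w => ((Real.sqrt ((M * ‖w‖) ^ 2 - ‖g w‖ ^ 2) : ℝ) : ℂ) with hk
  have hkc : ContinuousOn k (spectrum ℂ T) := by
    refine Complex.continuous_ofReal.comp_continuousOn (Real.continuous_sqrt.comp_continuousOn ?_)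
    exact ContinuousOn.sub (by fun_prop) (hgc.norm.pow 2)
  have h1 : star (cfc g T) * cfc g T + star (cfc k T) * cfc k T = ((M : ℂ) ^ 2) • (star T * T) := by
    rw [← cfc_star, ← cfc_star, ← cfc_mul _ _ T (by fun_prop) hgc, ← cfc_mul _ _ T (by fun_prop) hkc,
      ← cfc_add _ _ _ (by fun_prop) (by fun_prop)]
    have h2 : (star T * T : Y →L[ℂ] Y) = cfc (fun w : ℂ => star w * w) T := by
      rw [cfc_mul _ _ T (by fun_prop) (by fun_prop), cfc_star_id (a := T), cfc_id' ℂ T]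
    rw [h2, ← cfc_const_mul _ _ _ (by fun_prop)]
    refine cfc_congr fun w hw => ?_
    have h3 : ‖g w‖ ≤ M * ‖w‖ := hT.norm_mul_le hf hw
    have h4 : 0 ≤ (M * ‖w‖) ^ 2 - ‖g w‖ ^ 2 := by
      rw [sub_nonneg]; gcongr
    have h5 : ∀ z : ℂ, star z * z = ((‖z‖ ^ 2 : ℝ) : ℂ) := fun z => by
      rw [Complex.star_def, mul_comm, Complex.mul_conj, Complex.normSq_eq_norm_sq]
    simp only [h5]
    rw [hk]
    simp only [Complex.norm_real, Real.norm_of_nonneg (Real.sqrt_nonneg _), Real.sq_sqrt h4]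
    push_cast
    ring
  have h2 : ∀ (B : Y →L[ℂ] Y), RCLike.re (inner ℂ ((star B * B) x) x) = ‖B x‖ ^ 2 := by
    intro B
    rw [mul_apply_eq_comp, ContinuousLinearMap.star_eq_adjoint,
      ContinuousLinearMap.adjoint_inner_left, inner_self_eq_norm_sq]
  have h3 := congrArg (fun B : Y →L[ℂ] Y => RCLike.re (inner ℂ (B x) x)) h1
  simp only [_root_.add_apply, inner_add_left, map_add, h2, _root_.smul_apply,
    inner_smul_left] at h3
  have h4 : RCLike.re ((starRingEnd ℂ) ((M : ℂ) ^ 2) * inner ℂ ((star T * T) x) x) =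
      M ^ 2 * ‖T x‖ ^ 2 := by
    rw [← Complex.ofReal_pow, Complex.conj_ofReal]
    have := h2 T
    change (((M ^ 2 : ℝ) : ℂ) * inner ℂ ((star T * T) x) x).re = _
    rw [Complex.re_ofReal_mul]
    congr 1
  rw [h4] at h3
  refine le_of_sq_le_sq ?_ (mul_nonneg hf.nonneg (norm_nonneg _))
  rw [mul_pow]
  linarith [sq_nonneg ‖cfc k T x‖]

theorem eq_of_mul_eq (hT : IsNormalResolvent T) {X X' : Y →L[ℂ] Y} (h : X * T = X' * T) :
    X = X' := by
  refine ContinuousLinearMap.coeFn_injective ?_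
  exact hT.dense.equalizer X.continuous X'.continuous (funext fun x => DFunLike.congr_fun h x)

theorem exists_mul_eq_cfc (hT : IsNormalResolvent T) (hf : BddLeft M f) :
    ∃ X : Y →L[ℂ] Y, X * T = cfc (fun w : ℂ => w * f (1 - w⁻¹)) T := by
  refine ⟨(cfc (fun w : ℂ => w * f (1 - w⁻¹)) T).toLinearMap.extendOfNorm T.toLinearMap, ?_⟩
  ext x
  exact LinearMap.extendOfNorm_eq (f := (cfc (fun w : ℂ => w * f (1 - w⁻¹)) T).toLinearMap)
    (e := T.toLinearMap) hT.dense ⟨M, fun x => hT.norm_cfc_apply_le hf x⟩ x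

end IsNormalResolvent

section

variable {A : Y →ₗ.[ℂ] Y} {M M' : ℝ} {f g : ℂ → ℂ}

theorem funCalc_mul_resolvent (hT : IsNormalResolvent (resolventAtOne A)) (hf : BddLeft M f) :
    funCalc A f * resolventAtOne A = cfc (fun w : ℂ => w * f (1 - w⁻¹)) (resolventAtOne A) := by
  have h := hT.exists_mul_eq_cfc hf
  rw [funCalc, dif_pos h]
  exact h.choose_spec

theorem funCalc_eq (hT : IsNormalResolvent (resolventAtOne A)) (hf : BddLeft M f)
    {X : Y →L[ℂ] Y} (hX : X * resolventAtOne A =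
      cfc (fun w : ℂ => w * f (1 - w⁻¹)) (resolventAtOne A)) : funCalc A f = X :=
  hT.eq_of_mul_eq ((funCalc_mul_resolvent hT hf).trans hX.symm)

theorem norm_funCalc_apply_le (hT : IsNormalResolvent (resolventAtOne A)) (hf : BddLeft M f)
    (x : Y) : ‖funCalc A f x‖ ≤ M * ‖x‖ := by
  refine hT.dense.induction_on (p := fun x => ‖funCalc A f x‖ ≤ M * ‖x‖) x
    (isClosed_le (by fun_prop) (by fun_prop)) fun u => ?_
  have := DFunLike.congr_fun (funCalc_mul_resolvent hT hf) u
  rw [mul_apply_eq_comp] at this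
  rw [this]
  exact hT.norm_cfc_apply_le hf u

theorem norm_funCalc_le (hT : IsNormalResolvent (resolventAtOne A)) (hf : BddLeft M f) :
    ‖funCalc A f‖ ≤ M :=
  ContinuousLinearMap.opNorm_le_bound _ hf.nonneg (norm_funCalc_apply_le hT hf)

theorem funCalc_congr (hT : IsNormalResolvent (resolventAtOne A)) (hf : BddLeft M f)
    (h : EqOn f g leftHalfPlane) : funCalc A f = funCalc A g := by
  have hg : BddLeft M g := ⟨hf.cont.congr h.symm, fun z hz => by rw [← h hz]; exact hf.bound z hz⟩
  refine funCalc_eq hT hf ((funCalc_mul_resolvent hT hg).trans (cfc_congr fun w hw => ?_))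
  by_cases h0 : w = 0
  · simp [h0]
  · simp only [h (hT.spec w hw h0)]

/-- An operator commuting with the normal operator `T` commutes with `T*` by Fuglede's theorem,
hence with continuous functions of `T`. -/
theorem commute_funCalc (hT : IsNormalResolvent (resolventAtOne A)) (hf : BddLeft M f)
    {B : Y →L[ℂ] Y} (hB : Commute B (resolventAtOne A)) : Commute B (funCalc A f) := by
  refine hT.eq_of_mul_eq ?_
  have h1 : Commute (cfc (fun w : ℂ => w * f (1 - w⁻¹)) (resolventAtOne A)) B :=
    hB.symm.cfc (hT.normal.commute_star_right hB).symm _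
  rw [mul_assoc, funCalc_mul_resolvent hT hf, mul_assoc, hB.eq, ← mul_assoc,
    funCalc_mul_resolvent hT hf, h1.eq]

theorem commute_funCalc_resolvent (hT : IsNormalResolvent (resolventAtOne A)) (hf : BddLeft M f) :
    Commute (resolventAtOne A) (funCalc A f) :=
  commute_funCalc hT hf (Commute.refl _)

theorem commute_funCalc_funCalc (hT : IsNormalResolvent (resolventAtOne A)) (hf : BddLeft M f)
    (hg : BddLeft M' g) : Commute (funCalc A f) (funCalc A g) :=
  commute_funCalc hT hg (commute_funCalc_resolvent hT hf).symm

theorem funCalc_mul (hT : IsNormalResolvent (resolventAtOne A)) (hf : BddLeft M f)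
    (hg : BddLeft M' g) : funCalc A (fun z => f z * g z) = funCalc A f * funCalc A g := by
  have := hT.normal
  -- Each of the two factors needs its own `T` to become a continuous function of `T`, so the
  -- identity is checked after one more multiplication by `T`.
  refine funCalc_eq hT (hf.mul hg) (hT.eq_of_mul_eq ?_)
  have h1 : funCalc A f * funCalc A g * resolventAtOne A * resolventAtOne A =
      cfc (fun w : ℂ => w * f (1 - w⁻¹)) (resolventAtOne A) *
        cfc (fun w : ℂ => w * g (1 - w⁻¹)) (resolventAtOne A) := by
    rw [← funCalc_mul_resolvent hT hf, ← funCalc_mul_resolvent hT hg]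
    have h2 := (commute_funCalc_resolvent hT hg).eq
    calc _ = funCalc A f * (funCalc A g * resolventAtOne A) * resolventAtOne A := by
          simp only [mul_assoc]
      _ = funCalc A f * (resolventAtOne A * funCalc A g) * resolventAtOne A := by rw [h2]
      _ = _ := by simp only [mul_assoc]
  rw [h1, ← cfc_mul _ _ _ (hT.continuousOn hf) (hT.continuousOn hg)]
  nth_rewrite 3 [← cfc_id' ℂ (resolventAtOne A)]
  rw [← cfc_mul _ _ _ (hT.continuousOn (hf.mul hg)) (by fun_prop)]
  exact cfc_congr fun w _ => by ring

theorem funCalc_add (hT : IsNormalResolvent (resolventAtOne A)) (hf : BddLeft M f)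
    (hg : BddLeft M' g) : funCalc A (fun z => f z + g z) = funCalc A f + funCalc A g := by
  refine funCalc_eq hT (hf.add hg) ?_
  rw [add_mul, funCalc_mul_resolvent hT hf, funCalc_mul_resolvent hT hg,
    ← cfc_add _ _ _ (hT.continuousOn hf) (hT.continuousOn hg)]
  exact cfc_congr fun w _ => by ring

theorem funCalc_const (hT : IsNormalResolvent (resolventAtOne A)) (c : ℂ) :
    funCalc A (fun _ => c) = c • 1 := by
  have := hT.normal
  refine funCalc_eq hT (BddLeft.const c) ?_
  rw [smul_mul_assoc, one_mul]
  simp only [mul_comm _ c]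
  exact (cfc_const_mul_id c _).symm

theorem funCalc_const_mul (hT : IsNormalResolvent (resolventAtOne A)) (hf : BddLeft M f) (c : ℂ) :
    funCalc A (fun z => c * f z) = c • funCalc A f := by
  rw [funCalc_mul hT (BddLeft.const c) hf, funCalc_const hT, smul_mul_assoc, one_mul]

theorem funCalc_resolvent (hT : IsNormalResolvent (resolventAtOne A))
    (h : BddLeft M fun z => (1 - z)⁻¹) : funCalc A (fun z => (1 - z)⁻¹) = resolventAtOne A := by
  have := hT.normal
  refine funCalc_eq hT h ?_
  nth_rewrite 1 [← cfc_id' ℂ (resolventAtOne A)]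
  nth_rewrite 2 [← cfc_id' ℂ (resolventAtOne A)]
  rw [← cfc_mul _ _ _ (by fun_prop) (by fun_prop)]
  exact cfc_congr fun w _ => by simp

end

end FunctionalCalculus


/-! ### Operators on the scale and their dependence on the step size. -/

section Families

variable {Y : Type*} [NormedAddCommGroup Y] [InnerProductSpace ℂ Y] [CompleteSpace Y]
  {A : Y →ₗ.[ℂ] Y} {S : ℝ → Y →L[ℂ] Y}

theorem convex_leftHalfPlane : Convex ℝ leftHalfPlane := convex_halfSpace_re_le 0

theorem mul_mem_leftHalfPlane {h : ℝ} (hh : 0 ≤ h) {z : ℂ} (hz : z ∈ leftHalfPlane) :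
    (h : ℂ) * z ∈ leftHalfPlane := by
  change ((h : ℂ) * z).re ≤ 0
  rw [Complex.re_ofReal_mul]
  exact mul_nonpos_of_nonneg_of_nonpos hh hz

theorem uniqueDiffOn_leftHalfPlane : UniqueDiffOn ℂ leftHalfPlane := by
  have h : UniqueDiffOn ℝ leftHalfPlane := by
    refine uniqueDiffOn_convex convex_leftHalfPlane ⟨-1, ?_⟩
    refine mem_interior.2 ⟨{z | z.re < 0}, fun z hz => (le_of_lt hz : z.re ≤ 0), ?_, by simp⟩
    exact isOpen_lt Complex.continuous_re continuous_const
  exact h.mono_field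

theorem one_le_max_norm (z : ℂ) : 1 ≤ max 1 ‖z‖ := le_max_left _ _

/-! ### Smoothing operators -/

theorem bddLeft_smoothing {ℓ : ℝ} (hℓ : 0 ≤ ℓ) :
    BddLeft 1 (fun z => (((max 1 ‖z‖) ^ (-ℓ) : ℝ) : ℂ)) := by
  refine ⟨Continuous.continuousOn ?_, fun z _ => ?_⟩
  · refine Complex.continuous_ofReal.comp (Continuous.rpow_const (by fun_prop) fun z => ?_)
    exact Or.inl (by linarith [one_le_max_norm z])
  · have h0 : 0 ≤ (max 1 ‖z‖) ^ (-ℓ) := Real.rpow_nonneg (by linarith [one_le_max_norm z]) _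
    rw [Complex.norm_real, Real.norm_of_nonneg h0]
    exact Real.rpow_le_one_of_one_le_of_nonpos (one_le_max_norm z) (by linarith)

/-- The symbol of the inclusion of one level of the scale into the next one. -/
noncomputable def inclSymbol (z : ℂ) : ℂ := (((max 1 ‖z‖) ^ (-(1 : ℝ)) : ℝ) : ℂ)

theorem smoothing_one_eq : smoothing A 1 = funCalc A inclSymbol := rfl

theorem bddLeft_inclSymbol : BddLeft 1 inclSymbol := bddLeft_smoothing zero_le_one

theorem inclSymbol_eq (z : ℂ) : inclSymbol z = ((max 1 ‖z‖ : ℝ) : ℂ)⁻¹ := by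
  rw [inclSymbol, Real.rpow_neg_one, Complex.ofReal_inv]

theorem norm_mul_norm_inclSymbol_le (z : ℂ) : ‖z‖ * ‖inclSymbol z‖ ≤ 1 := by
  have h := one_le_max_norm z
  rw [inclSymbol_eq, norm_inv, Complex.norm_real, Real.norm_of_nonneg (by linarith),
    ← div_eq_mul_inv, div_le_one (by linarith)]
  exact le_max_right _ _

theorem bddLeft_mul_inclSymbol : BddLeft 1 (fun z => z * inclSymbol z) :=
  ⟨continuousOn_id.mul bddLeft_inclSymbol.cont, fun z _ => by
    rw [norm_mul]; exact norm_mul_norm_inclSymbol_le z⟩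

theorem smoothing_add (hT : IsNormalResolvent (resolventAtOne A)) {ℓ m : ℝ} (hℓ : 0 ≤ ℓ)
    (hm : 0 ≤ m) : smoothing A (ℓ + m) = smoothing A ℓ * smoothing A m := by
  rw [smoothing, smoothing, smoothing, ← funCalc_mul hT (bddLeft_smoothing hℓ) (bddLeft_smoothing hm)]
  congr 1
  funext z
  rw [neg_add, Real.rpow_add (by linarith [one_le_max_norm z]), Complex.ofReal_mul]

theorem smoothing_zero (hT : IsNormalResolvent (resolventAtOne A)) : smoothing A 0 = 1 := by
  have := funCalc_const hT 1
  rw [one_smul] at this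
  rw [smoothing, ← this]
  congr 1
  funext z
  simp

theorem norm_one_sub_ge {z : ℂ} (hz : z ∈ leftHalfPlane) : max 1 ‖z‖ ≤ ‖1 - z‖ := by
  have hz' : z.re ≤ 0 := hz
  have h1 : ‖1 - z‖ ^ 2 = 1 - 2 * z.re + ‖z‖ ^ 2 := by
    rw [Complex.sq_norm, Complex.sq_norm, Complex.normSq_apply, Complex.normSq_apply]
    simp
    ring
  refine max_le ?_ ?_
  · refine le_of_sq_le_sq ?_ (norm_nonneg _)
    nlinarith [sq_nonneg ‖z‖]
  · refine le_of_sq_le_sq ?_ (norm_nonneg _)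
    nlinarith

theorem one_sub_ne_zero {z : ℂ} (hz : z ∈ leftHalfPlane) : 1 - z ≠ 0 := by
  have h := norm_one_sub_ge hz
  have h1 := one_le_max_norm z
  exact norm_pos_iff.1 (by linarith)

theorem bddLeft_resolvent : BddLeft 1 (fun z => (1 - z)⁻¹) := by
  refine ⟨ContinuousOn.inv₀ (by fun_prop) fun z hz => one_sub_ne_zero hz, fun z hz => ?_⟩
  rw [norm_inv]
  exact inv_le_one_of_one_le₀ ((one_le_max_norm z).trans (norm_one_sub_ge hz))

/-- On the left half plane `max(1,|z|) / |1 - z| ≤ 1`. The factorization on both sides passes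
injectivity and dense range from the resolvent to the smoothing operator. -/
theorem exists_resolvent_eq_smoothing_mul (hT : IsNormalResolvent (resolventAtOne A)) :
    ∃ X : Y →L[ℂ] Y, resolventAtOne A = smoothing A 1 * X ∧
      resolventAtOne A = X * smoothing A 1 := by
  have hX : BddLeft 1 (fun z => ((max 1 ‖z‖ : ℝ) : ℂ) * (1 - z)⁻¹) := by
    refine ⟨ContinuousOn.mul (by fun_prop) bddLeft_resolvent.cont, fun z hz => ?_⟩
    rw [norm_mul, norm_inv, Complex.norm_real,
      Real.norm_of_nonneg (by linarith [one_le_max_norm z]), ← div_eq_mul_inv]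
    exact div_le_one_of_le₀ (norm_one_sub_ge hz) (norm_nonneg _)
  have h1 : ∀ z : ℂ, ((max 1 ‖z‖ : ℝ) : ℂ) ≠ 0 := fun z => by
    rw [Complex.ofReal_ne_zero]; linarith [one_le_max_norm z]
  refine ⟨funCalc A (fun z => ((max 1 ‖z‖ : ℝ) : ℂ) * (1 - z)⁻¹), ?_, ?_⟩
  · rw [smoothing_one_eq, ← funCalc_mul hT bddLeft_inclSymbol hX]
    refine (funCalc_resolvent hT bddLeft_resolvent).symm.trans (congrArg _ (funext fun z => ?_))
    rw [inclSymbol_eq, inv_mul_cancel_left₀ (h1 z)]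
  · rw [smoothing_one_eq, ← funCalc_mul hT hX bddLeft_inclSymbol]
    refine (funCalc_resolvent hT bddLeft_resolvent).symm.trans (congrArg _ (funext fun z => ?_))
    rw [inclSymbol_eq, mul_comm, inv_mul_cancel_left₀ (h1 z)]

theorem smoothing_one_injective (hT : IsNormalResolvent (resolventAtOne A)) :
    Function.Injective (smoothing A 1) := by
  obtain ⟨X, -, hX⟩ := exists_resolvent_eq_smoothing_mul hT
  have h := hT.injective
  rw [hX] at h
  exact Function.Injective.of_comp (f := X) h

theorem smoothing_one_denseRange (hT : IsNormalResolvent (resolventAtOne A)) :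
    DenseRange (smoothing A 1) := by
  obtain ⟨X, hX, -⟩ := exists_resolvent_eq_smoothing_mul hT
  have h := hT.dense
  rw [hX] at h
  exact h.mono (range_comp_subset_range X (smoothing A 1))

/-- Integer powers are compositions of injective maps, and any exponent occurs as the right factor
of the integer power `⌈ℓ⌉₊`. -/
theorem smoothing_injective (hT : IsNormalResolvent (resolventAtOne A)) {ℓ : ℝ} (hℓ : 0 ≤ ℓ) :
    Function.Injective (smoothing A ℓ) := by
  have hn : ∀ n : ℕ, Function.Injective (smoothing A n) := by
    intro n
    induction n with
    | zero =>
      rw [Nat.cast_zero, smoothing_zero hT]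
      exact fun _ _ h => h
    | succ n ih =>
      rw [Nat.cast_add, Nat.cast_one, smoothing_add hT (Nat.cast_nonneg n) zero_le_one]
      exact ih.comp (smoothing_one_injective hT)
  have h := hn ⌈ℓ⌉₊
  rw [← sub_add_cancel (⌈ℓ⌉₊ : ℝ) ℓ, smoothing_add hT (sub_nonneg.2 (Nat.le_ceil ℓ)) hℓ] at h
  exact Function.Injective.of_comp (f := smoothing A (⌈ℓ⌉₊ - ℓ)) h

/-- In coordinates, this says that `A` maps a level to the next one as `genR A`. -/
theorem smoothing_mem_graph (hT : IsNormalResolvent (resolventAtOne A))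
    (hA : IsResolventAtOne A (resolventAtOne A)) (x : Y) :
    (smoothing A 1 x, funCalc A (fun z => z * inclSymbol z) x) ∈ A.graph := by
  have hZ : BddLeft 2 (fun z => (1 - z) * inclSymbol z) := by
    refine ⟨ContinuousOn.mul (by fun_prop) bddLeft_inclSymbol.cont, fun z hz => ?_⟩
    have h1 : (1 - z) * inclSymbol z = inclSymbol z - z * inclSymbol z := by ring
    rw [h1]
    refine (norm_sub_le _ _).trans ?_
    linarith [bddLeft_inclSymbol.bound z hz, bddLeft_mul_inclSymbol.bound z hz]
  have h1 : smoothing A 1 = resolventAtOne A * funCalc A (fun z => (1 - z) * inclSymbol z) := by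
    rw [smoothing_one_eq, ← funCalc_resolvent hT bddLeft_resolvent,
      ← funCalc_mul hT bddLeft_resolvent hZ]
    exact funCalc_congr hT bddLeft_inclSymbol fun z hz =>
      (inv_mul_cancel_left₀ (one_sub_ne_zero hz) _).symm
  have h2 : funCalc A (fun z => (1 - z) * inclSymbol z) +
      funCalc A (fun z => z * inclSymbol z) = smoothing A 1 := by
    rw [smoothing_one_eq, ← funCalc_add hT hZ bddLeft_mul_inclSymbol]
    congr 1
    funext z
    ring
  have h3 := hA.1 (funCalc A (fun z => (1 - z) * inclSymbol z) x)
  rw [← mul_apply_eq_comp, ← h1] at h3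
  have h4 : smoothing A 1 x - funCalc A (fun z => (1 - z) * inclSymbol z) x =
      funCalc A (fun z => z * inclSymbol z) x := by
    rw [← h2]
    exact add_sub_cancel_left _ _
  rwa [h4] at h3

/-! ### The semigroup as a differentiable family -/

theorem commute_semigroup_resolvent (h1 : CondA1 A S)
    (hA : IsResolventAtOne A (resolventAtOne A)) {t : ℝ} (ht : 0 ≤ t) :
    Commute (S t) (resolventAtOne A) := by
  ext u
  have h := hA.2 _ _ (h1.semigroup.mem_graph h1.generator (hA.1 u) ht)
  rw [← map_sub, sub_sub_cancel] at h
  exact h.symm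

/-- The real linear operator underlying the inclusion of one level of the scale into the next. -/
noncomputable def inclR (A : Y →ₗ.[ℂ] Y) : Y →L[ℝ] Y := (smoothing A 1).restrictScalars ℝ

/-- The real linear operator underlying `A`, as an operator from one level of the scale to the next,
in terms of coordinates. -/
noncomputable def genR (A : Y →ₗ.[ℂ] Y) : Y →L[ℝ] Y :=
  (funCalc A (fun z => z * inclSymbol z)).restrictScalars ℝ

theorem norm_inclR_le (hT : IsNormalResolvent (resolventAtOne A)) : ‖inclR A‖ ≤ 1 := by
  rw [inclR, ContinuousLinearMap.norm_restrictScalars]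
  exact norm_funCalc_le hT bddLeft_inclSymbol

theorem norm_genR_le (hT : IsNormalResolvent (resolventAtOne A)) : ‖genR A‖ ≤ 1 := by
  rw [genR, ContinuousLinearMap.norm_restrictScalars]
  exact norm_funCalc_le hT bddLeft_mul_inclSymbol

theorem genR_inclR (hT : IsNormalResolvent (resolventAtOne A)) (x : Y) :
    genR A (inclR A x) = inclR A (genR A x) :=
  DFunLike.congr_fun (commute_funCalc_funCalc hT bddLeft_mul_inclSymbol bddLeft_inclSymbol).eq x

/-- The derivatives of `h ↦ S (c h)`. -/
noncomputable def semigroupFam (S : ℝ → Y →L[ℂ] Y) (c : ℝ) (n : ℕ) (h : ℝ) : Y →L[ℝ] Y :=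
  c ^ n • (S (h * c)).restrictScalars ℝ

theorem opFam_semigroup (h1 : CondA1 A S) (h2 : CondA2 S) {c : ℝ} (hc : c ∈ Icc (0 : ℝ) 1)
    {s : Set ℝ} (hs : s ⊆ Ici 0) :
    OpFam (inclR A) (genR A) (fun _ => 1) s (semigroupFam S c) := by
  have hT := isNormalResolvent_resolventAtOne h1 h2
  have hA := isResolventAtOne_resolventAtOne h1 h2
  have hhc : ∀ h ∈ s, 0 ≤ h * c := fun h hh => mul_nonneg (hs hh) hc.1
  refine ⟨fun n h hh x => ?_, fun n h hh => ?_, fun n x => ?_, fun n x h hh => ?_⟩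
  · have := DFunLike.congr_fun (commute_funCalc hT bddLeft_inclSymbol
      (commute_semigroup_resolvent h1 hA (hhc h hh))).eq x
    change c ^ n • S (h * c) (smoothing A 1 x) = smoothing A 1 (c ^ n • S (h * c) x)
    rw [(smoothing A 1).map_smul_of_tower]
    exact congrArg _ this
  · rw [semigroupFam, norm_smul, ContinuousLinearMap.norm_restrictScalars, norm_pow,
      Real.norm_of_nonneg hc.1]
    exact mul_le_one₀ (pow_le_one₀ hc.1 hc.2) (norm_nonneg _) (h2 _ (hhc h hh))
  · refine ContinuousOn.const_smul ?_ (c ^ n)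
    exact (h1.semigroup.continuousOn h2 x).comp (t := Ici 0) (by fun_prop) fun h hh => hhc h hh
  · have h3 := h1.semigroup.hasDerivWithinAt h2 h1.generator (smoothing_mem_graph hT hA x)
      (hhc h hh)
    have h4 : HasDerivWithinAt (fun h : ℝ => h * c) c s h := by
      simpa using (hasDerivWithinAt_id h s).mul_const c
    have h5 := (h3.scomp h h4 fun h hh => hhc h hh).const_smul (c ^ n)
    refine h5.congr_deriv ?_
    rw [smul_smul, ← pow_succ]
    rfl

/-! ### Functions of `h A` as differentiable families -/

/-- The uniform Lipschitz bound makes the error of replacing `x` by a nearby element of `D`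
proportional to `|h - h₀|`. -/
theorem hasDerivWithinAt_of_dense {G : ℝ → Y →L[ℝ] Y} {G' : Y →L[ℝ] Y} {s : Set ℝ} {h₀ C : ℝ}
    {D : Set Y} (hD : Dense D) (hG : ∀ h ∈ s, ∀ x, ‖G h x - G h₀ x‖ ≤ C * |h - h₀| * ‖x‖)
    (h : ∀ x ∈ D, HasDerivWithinAt (fun h => G h x) (G' x) s h₀) (x : Y) :
    HasDerivWithinAt (fun h => G h x) (G' x) s h₀ := by
  rw [hasDerivWithinAt_iff_isLittleO, Asymptotics.isLittleO_iff]
  intro ε hε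
  set K := |C| + ‖G'‖ + 1 with hK
  have hK0 : 0 < K := by positivity
  obtain ⟨y, hyD, hy⟩ := Metric.mem_closure_iff.1 (hD x) (ε / (2 * K)) (by positivity)
  have h1 := h y hyD
  rw [hasDerivWithinAt_iff_isLittleO, Asymptotics.isLittleO_iff] at h1
  filter_upwards [h1 (half_pos hε), self_mem_nhdsWithin] with t ht hts
  have h2 : G t x - G h₀ x - (t - h₀) • G' x = (G t y - G h₀ y - (t - h₀) • G' y) +
      ((G t (x - y) - G h₀ (x - y)) - (t - h₀) • G' (x - y)) := by
    simp only [map_sub, smul_sub]; abel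
  rw [h2]
  have h3 := hG t hts (x - y)
  have h4 : ‖(t - h₀) • G' (x - y)‖ ≤ |t - h₀| * (‖G'‖ * ‖x - y‖) := by
    rw [norm_smul, Real.norm_eq_abs]
    gcongr
    exact G'.le_opNorm _
  have h5 : ‖x - y‖ ≤ ε / (2 * K) := by rw [← dist_eq_norm]; exact hy.le
  have h6 : C * |t - h₀| * ‖x - y‖ ≤ |C| * |t - h₀| * ‖x - y‖ := by
    gcongr; exact le_abs_self C
  have h7 : (|C| + ‖G'‖) * ‖x - y‖ ≤ ε / 2 := by
    calc (|C| + ‖G'‖) * ‖x - y‖ ≤ K * (ε / (2 * K)) := by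
          gcongr; rw [hK]; linarith
      _ = ε / 2 := by field_simp
  have h8 : |t - h₀| * ((|C| + ‖G'‖) * ‖x - y‖) ≤ |t - h₀| * (ε / 2) := by gcongr
  have h9 := norm_add_le (G t y - G h₀ y - (t - h₀) • G' y)
    ((G t (x - y) - G h₀ (x - y)) - (t - h₀) • G' (x - y))
  have h10 := norm_sub_le (G t (x - y) - G h₀ (x - y)) ((t - h₀) • G' (x - y))
  rw [Real.norm_eq_abs] at ht ⊢
  nlinarith

/-- A function on the closed left half plane with its derivatives, which are bounded. -/
structure IsSymbol (M : ℕ → ℝ) (φ : ℕ → ℂ → ℂ) : Prop where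
  deriv : ∀ n, ∀ z ∈ leftHalfPlane, HasDerivWithinAt (φ n) (φ (n + 1) z) leftHalfPlane z
  bound : ∀ n, ∀ z ∈ leftHalfPlane, ‖φ n z‖ ≤ M n

namespace IsSymbol

variable {M : ℕ → ℝ} {φ : ℕ → ℂ → ℂ}

theorem bddLeft (hφ : IsSymbol M φ) (n : ℕ) {h : ℝ} (hh : 0 ≤ h) :
    BddLeft (M n) (fun z => φ n (h * z)) := by
  refine ⟨?_, fun z hz => hφ.bound n _ (mul_mem_leftHalfPlane hh hz)⟩
  have h1 : ContinuousOn (φ n) leftHalfPlane := fun z hz =>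
    (hφ.deriv n z hz).continuousWithinAt
  exact h1.comp (by fun_prop) fun z hz => mul_mem_leftHalfPlane hh hz

theorem norm_sub_le (hφ : IsSymbol M φ) (n : ℕ) {h h₀ : ℝ} (hh : 0 ≤ h) (hh₀ : 0 ≤ h₀) {z : ℂ}
    (hz : z ∈ leftHalfPlane) : ‖φ n (h * z) - φ n (h₀ * z)‖ ≤ M (n + 1) * (|h - h₀| * ‖z‖) := by
  have h1 := convex_leftHalfPlane.norm_image_sub_le_of_norm_hasDerivWithin_le (hφ.deriv n)
    (hφ.bound (n + 1)) (mul_mem_leftHalfPlane hh₀ hz) (mul_mem_leftHalfPlane hh hz)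
  rwa [← sub_mul, norm_mul, ← Complex.ofReal_sub, Complex.norm_real, Real.norm_eq_abs] at h1

/-- Taylor's formula, from the mean value inequality for `ζ ↦ φ n ζ - ζ * φ (n + 1) a` on the
segment; the sharper factor `1/2` is not needed. -/
theorem norm_sub_sub_le (hφ : IsSymbol M φ) (n : ℕ) {h h₀ : ℝ} (hh : 0 ≤ h) (hh₀ : 0 ≤ h₀) {z : ℂ}
    (hz : z ∈ leftHalfPlane) :
    ‖φ n (h * z) - φ n (h₀ * z) - ((h - h₀ : ℝ) : ℂ) * z * φ (n + 1) (h₀ * z)‖ ≤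
      M (n + 2) * (|h - h₀| * ‖z‖) ^ 2 := by
  set a : ℂ := h₀ * z with ha
  set b : ℂ := h * z with hb
  have ham : a ∈ leftHalfPlane := mul_mem_leftHalfPlane hh₀ hz
  have hbm : b ∈ leftHalfPlane := mul_mem_leftHalfPlane hh hz
  have hab : ‖b - a‖ = |h - h₀| * ‖z‖ := by
    rw [ha, hb, ← sub_mul, norm_mul, ← Complex.ofReal_sub, Complex.norm_real, Real.norm_eq_abs]
  have hsub : segment ℝ a b ⊆ leftHalfPlane := convex_leftHalfPlane.segment_subset ham hbm
  have h0 : 0 ≤ M (n + 2) := (norm_nonneg _).trans (hφ.bound (n + 2) a ham)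
  have h1 := (convex_segment a b).norm_image_sub_le_of_norm_hasDerivWithin_le (𝕜 := ℂ)
    (f := fun ζ => φ n ζ - ζ * φ (n + 1) a) (f' := fun ζ => φ (n + 1) ζ - 1 * φ (n + 1) a)
    (C := M (n + 2) * ‖b - a‖)
    (fun ζ hζ => ((hφ.deriv n ζ (hsub hζ)).mono hsub).sub
      ((hasDerivWithinAt_id ζ _).mul_const _)) (fun ζ hζ => ?_)
    (left_mem_segment ℝ a b) (right_mem_segment ℝ a b)
  · rw [← hab]
    refine le_trans (le_of_eq ?_) (h1.trans (le_of_eq (by ring)))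
    congr 1
    have : b - a = ((h - h₀ : ℝ) : ℂ) * z := by rw [ha, hb]; push_cast; ring
    linear_combination (φ (n + 1) a) * this
  · rw [one_mul]
    refine (convex_leftHalfPlane.norm_image_sub_le_of_norm_hasDerivWithin_le (hφ.deriv (n + 1))
      (hφ.bound (n + 2)) ham (hsub hζ)).trans ?_
    gcongr
    exact norm_sub_le_of_mem_segment hζ

/-- The operators `φ⁽ⁿ⁾(h A)`. -/
noncomputable def fam (A : Y →ₗ.[ℂ] Y) (φ : ℕ → ℂ → ℂ) (n : ℕ) (h : ℝ) : Y →L[ℝ] Y :=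
  (funCalc A (fun z => φ n (h * z))).restrictScalars ℝ

theorem norm_fam_sub_le (hφ : IsSymbol M φ) (hT : IsNormalResolvent (resolventAtOne A)) (n : ℕ)
    {h h₀ : ℝ} (hh : 0 ≤ h) (hh₀ : 0 ≤ h₀) (x : Y) :
    ‖fam A φ n h (inclR A x) - fam A φ n h₀ (inclR A x)‖ ≤ M (n + 1) * |h - h₀| * ‖x‖ := by
  have hd := (hφ.bddLeft n hh).add ((hφ.bddLeft n hh₀).const_mul (-1))
  have hF := hd.mul bddLeft_inclSymbol
  have hF' : BddLeft (M (n + 1) * |h - h₀|)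
      (fun z => (φ n (h * z) + (-1) * φ n (h₀ * z)) * inclSymbol z) := by
    refine ⟨hF.cont, fun z hz => ?_⟩
    rw [norm_mul, neg_one_mul, ← sub_eq_add_neg]
    have h1 := hφ.norm_sub_le n hh hh₀ hz
    have h0 : 0 ≤ M (n + 1) := (norm_nonneg _).trans (hφ.bound (n + 1) z hz)
    calc _ ≤ M (n + 1) * (|h - h₀| * ‖z‖) * ‖inclSymbol z‖ := by gcongr
      _ = M (n + 1) * |h - h₀| * (‖z‖ * ‖inclSymbol z‖) := by ring
      _ ≤ M (n + 1) * |h - h₀| * 1 := by gcongr; exact norm_mul_norm_inclSymbol_le z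
      _ = _ := mul_one _
  have h1 := norm_funCalc_apply_le hT hF' x
  rw [funCalc_mul hT hd bddLeft_inclSymbol, funCalc_add hT (hφ.bddLeft n hh)
    ((hφ.bddLeft n hh₀).const_mul (-1)), funCalc_const_mul hT (hφ.bddLeft n hh₀), neg_one_smul,
    ← sub_eq_add_neg] at h1
  exact h1

/-- The quadratic Taylor remainder contains `|z|²`, which the two inclusions on the left absorb.
This gives the derivative for arguments in the range of `J` only; density and `norm_fam_sub_le`,
where one inclusion suffices, do the rest. -/
theorem norm_fam_sub_sub_le (hφ : IsSymbol M φ) (hT : IsNormalResolvent (resolventAtOne A)) (n : ℕ)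
    {h h₀ : ℝ} (hh : 0 ≤ h) (hh₀ : 0 ≤ h₀) (x : Y) :
    ‖fam A φ n h (inclR A (inclR A x)) - fam A φ n h₀ (inclR A (inclR A x)) -
      (h - h₀) • fam A φ (n + 1) h₀ (genR A (inclR A x))‖ ≤ M (n + 2) * |h - h₀| ^ 2 * ‖x‖ := by
  have hd := (hφ.bddLeft n hh).add ((hφ.bddLeft n hh₀).const_mul (-1))
  have hj := bddLeft_inclSymbol
  have hF := ((hd.mul hj).mul hj)
  have hE := ((hφ.bddLeft (n + 1) hh₀).mul (bddLeft_mul_inclSymbol.mul hj))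
  have hE' := hE.const_mul (-((h - h₀ : ℝ) : ℂ))
  have hG : BddLeft (M (n + 2) * |h - h₀| ^ 2)
      (fun z => (φ n (h * z) + (-1) * φ n (h₀ * z)) * inclSymbol z * inclSymbol z +
        (-((h - h₀ : ℝ) : ℂ)) * (φ (n + 1) (h₀ * z) * (z * inclSymbol z * inclSymbol z))) := by
    refine ⟨(hF.add hE').cont, fun z hz => ?_⟩
    have h1 := hφ.norm_sub_sub_le n hh hh₀ hz
    have h0 : 0 ≤ M (n + 2) := (norm_nonneg _).trans (hφ.bound (n + 2) z hz)
    have h2 : (φ n (h * z) + (-1) * φ n (h₀ * z)) * inclSymbol z * inclSymbol z +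
        (-((h - h₀ : ℝ) : ℂ)) * (φ (n + 1) (h₀ * z) * (z * inclSymbol z * inclSymbol z)) =
        (φ n (h * z) - φ n (h₀ * z) - ((h - h₀ : ℝ) : ℂ) * z * φ (n + 1) (h₀ * z)) *
          inclSymbol z ^ 2 := by ring
    rw [h2, norm_mul, norm_pow]
    calc _ ≤ M (n + 2) * (|h - h₀| * ‖z‖) ^ 2 * ‖inclSymbol z‖ ^ 2 := by gcongr
      _ = M (n + 2) * |h - h₀| ^ 2 * (‖z‖ * ‖inclSymbol z‖) ^ 2 := by ring
      _ ≤ M (n + 2) * |h - h₀| ^ 2 * 1 := by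
          gcongr
          exact pow_le_one₀ (by positivity) (norm_mul_norm_inclSymbol_le z)
      _ = _ := mul_one _
  have h1 := norm_funCalc_apply_le hT hG x
  rw [funCalc_add hT hF hE', funCalc_mul hT (hd.mul hj) hj, funCalc_mul hT hd hj,
    funCalc_add hT (hφ.bddLeft n hh) ((hφ.bddLeft n hh₀).const_mul (-1)),
    funCalc_const_mul hT (hφ.bddLeft n hh₀), neg_one_smul, ← sub_eq_add_neg,
    funCalc_const_mul hT hE, funCalc_mul hT (hφ.bddLeft (n + 1) hh₀)
      (bddLeft_mul_inclSymbol.mul hj), funCalc_mul hT bddLeft_mul_inclSymbol hj, neg_smul,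
    ← sub_eq_add_neg, Complex.coe_smul] at h1
  exact h1

theorem opFam (hφ : IsSymbol M φ) (h1 : CondA1 A S) (h2 : CondA2 S) {s : Set ℝ} (hs : s ⊆ Ici 0) :
    OpFam (inclR A) (genR A) M s (fam A φ) := by
  have hT := isNormalResolvent_resolventAtOne h1 h2
  have hnorm : ∀ n, ∀ h ∈ s, ‖fam A φ n h‖ ≤ M n := fun n h hh => by
    rw [fam, ContinuousLinearMap.norm_restrictScalars]
    exact norm_funCalc_le hT (hφ.bddLeft n (hs hh))
  have hdense : Dense (range (inclR A)) := smoothing_one_denseRange hT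
  have hderiv : ∀ n x, ∀ h ∈ s, HasDerivWithinAt (fun h => fam A φ n h (inclR A x))
      (fam A φ (n + 1) h (genR A x)) s h := by
    intro n x h₀ hh₀
    refine hasDerivWithinAt_of_dense (G := fun h => (fam A φ n h).comp (inclR A))
      (G' := (fam A φ (n + 1) h₀).comp (genR A)) (C := M (n + 1)) hdense
      (fun h hh x => hφ.norm_fam_sub_le hT n (hs hh) (hs hh₀) x) ?_ x
    rintro _ ⟨y, rfl⟩
    rw [hasDerivWithinAt_iff_isLittleO]
    have h3 : (fun h : ℝ => |h - h₀| ^ 2) =o[𝓝[s] h₀] fun h => h - h₀ := by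
      have h4 : (fun h : ℝ => (h - h₀) ^ 2) =o[𝓝 h₀] fun h => h - h₀ := by
        have := Asymptotics.isLittleO_pow_sub_sub h₀ one_lt_two
        simpa using this
      simp only [sq_abs]
      exact h4.mono nhdsWithin_le_nhds
    refine Asymptotics.IsBigO.trans_isLittleO
      (Asymptotics.IsBigO.of_bound (M (n + 2) * ‖y‖) ?_) h3
    filter_upwards [self_mem_nhdsWithin] with h hh
    refine (hφ.norm_fam_sub_sub_le hT n (hs hh) (hs hh₀) y).trans (le_of_eq ?_)
    rw [Real.norm_of_nonneg (by positivity)]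
    ring
  refine ⟨fun n h hh x => ?_, hnorm, fun n x => ?_, hderiv⟩
  · exact DFunLike.congr_fun (commute_funCalc_funCalc hT (hφ.bddLeft n (hs hh))
      bddLeft_inclSymbol).eq x
  · intro h₀ hh₀
    rw [ContinuousWithinAt, Metric.tendsto_nhds]
    intro ε hε
    have hM : 0 ≤ M n := (norm_nonneg _).trans (hnorm n h₀ hh₀)
    obtain ⟨_, ⟨y, rfl⟩, hy⟩ := Metric.mem_closure_iff.1 (hdense x) (ε / (3 * (M n + 1)))
      (by positivity)
    have h3 := Metric.tendsto_nhds.1 (hderiv n y h₀ hh₀).continuousWithinAt (ε / 3) (by positivity)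
    filter_upwards [h3, self_mem_nhdsWithin] with h hd hh
    rw [dist_eq_norm] at hd hy ⊢
    have h4 : fam A φ n h x - fam A φ n h₀ x = (fam A φ n h (inclR A y) -
        fam A φ n h₀ (inclR A y)) + (fam A φ n h (x - inclR A y) -
        fam A φ n h₀ (x - inclR A y)) := by simp only [map_sub]; abel
    have h5 : ∀ t ∈ s, ‖fam A φ n t (x - inclR A y)‖ ≤ ε / 3 := by
      intro t ht
      calc _ ≤ M n * ‖x - inclR A y‖ := (fam A φ n t).le_of_opNorm_le (hnorm n t ht) _
        _ ≤ (M n + 1) * (ε / (3 * (M n + 1))) := by gcongr; linarith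
        _ = ε / 3 := by field_simp
    rw [h4]
    have h6 := norm_add_le (fam A φ n h (inclR A y) - fam A φ n h₀ (inclR A y))
      (fam A φ n h (x - inclR A y) - fam A φ n h₀ (x - inclR A y))
    have h7 := _root_.norm_sub_le (fam A φ n h (x - inclR A y)) (fam A φ n h₀ (x - inclR A y))
    linarith [h5 h hh, h5 h₀ hh₀]

end IsSymbol

theorem isSymbol_iteratedDerivWithin {f : ℂ → ℂ} {M : ℕ → ℝ} (hf : AnalyticOn ℂ f leftHalfPlane)
    (hM : ∀ n, ∀ z ∈ leftHalfPlane, ‖iteratedDerivWithin n f leftHalfPlane z‖ ≤ M n) :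
    IsSymbol M (fun n => iteratedDerivWithin n f leftHalfPlane) := by
  refine ⟨fun n z hz => ?_, hM⟩
  rw [iteratedDerivWithin_succ]
  exact (((hf.contDiffOn uniqueDiffOn_leftHalfPlane (n := (n + 1 : ℕ))).differentiableOn_iteratedDerivWithin
    (by exact_mod_cast Nat.lt_succ_self n) uniqueDiffOn_leftHalfPlane) z hz).hasDerivWithinAt

end Families


/-! ### Products -/

section Product

variable {ι : Type*} [Fintype ι] {E : Type*} [NormedAddCommGroup E] [NormedSpace ℝ E]

/-- The operator on a power of `E` with the given matrix of operators on `E`. -/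
noncomputable def matrixOp (α : ι → ι → E →L[ℝ] E) : (ι → E) →L[ℝ] (ι → E) :=
  ContinuousLinearMap.pi fun i => ∑ j, (α i j).comp (ContinuousLinearMap.proj j)

theorem matrixOp_apply (α : ι → ι → E →L[ℝ] E) (x : ι → E) (i : ι) :
    matrixOp α x i = ∑ j, α i j (x j) := by
  simp [matrixOp]

theorem norm_matrixOp_le {α : ι → ι → E →L[ℝ] E} {M : ℝ} (hM : 0 ≤ M)
    (hα : ∀ i j, ‖α i j‖ ≤ M) : ‖matrixOp α‖ ≤ Fintype.card ι * M := by
  refine ContinuousLinearMap.opNorm_le_bound _ (by positivity) fun x => ?_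
  refine (pi_norm_le_iff_of_nonneg (by positivity)).2 fun i => ?_
  rw [matrixOp_apply]
  refine (norm_sum_le _ _).trans ?_
  refine (Finset.sum_le_sum fun j _ => ((α i j).le_of_opNorm_le (hα i j) (x j)).trans
    (mul_le_mul_of_nonneg_left (norm_le_pi_norm x j) hM)).trans (le_of_eq ?_)
  rw [Finset.sum_const, nsmul_eq_mul, Finset.card_univ, mul_assoc]

/-- The componentwise application of an operator. -/
noncomputable def diagOp (ι : Type*) [Fintype ι] (L : E →L[ℝ] E) : (ι → E) →L[ℝ] (ι → E) :=
  ContinuousLinearMap.pi fun i => L.comp (ContinuousLinearMap.proj i)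

theorem diagOp_apply (L : E →L[ℝ] E) (x : ι → E) (i : ι) : diagOp ι L x i = L (x i) := rfl

theorem norm_diagOp_le_one {L : E →L[ℝ] E} (hL : ‖L‖ ≤ 1) : ‖diagOp ι L‖ ≤ 1 := by
  refine ContinuousLinearMap.opNorm_le_bound _ zero_le_one fun x => ?_
  refine (pi_norm_le_iff_of_nonneg (by positivity)).2 fun i => ?_
  exact (L.le_of_opNorm_le hL (x i)).trans
    (mul_le_mul_of_nonneg_left (norm_le_pi_norm x i) zero_le_one)

theorem diagOp_pow_apply (L : E →L[ℝ] E) (k : ℕ) (x : ι → E) (i : ι) :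
    (diagOp ι L ^ k) x i = (L ^ k) (x i) := by
  induction k generalizing x with
  | zero => rfl
  | succ k ih => rw [pow_succ, pow_succ, mul_apply_eq_comp, mul_apply_eq_comp, ih]; rfl

theorem OpFam.zero (J Λ : E →L[ℝ] E) {Ma : ℕ → ℝ} (hMa : ∀ n, 0 ≤ Ma n) (s : Set ℝ) :
    OpFam J Λ Ma s (fun _ _ => 0) :=
  ⟨fun _ _ _ _ => (map_zero J).symm, fun n _ _ => norm_zero.trans_le (hMa n),
    fun _ _ => continuousOn_const, fun _ _ h _ => hasDerivWithinAt_const h s 0⟩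

theorem OpFam.matrix {J Λ : E →L[ℝ] E} {Ma : ℕ → ℝ} (hMa : ∀ n, 0 ≤ Ma n) {s : Set ℝ}
    {α : ι → ι → ℕ → ℝ → E →L[ℝ] E} (hα : ∀ i j, OpFam J Λ Ma s (α i j)) :
    OpFam (diagOp ι J) (diagOp ι Λ) (fun n => Fintype.card ι * Ma n) s
      (fun n h => matrixOp fun i j => α i j n h) := by
  refine ⟨fun n h hh x => ?_, fun n h hh => norm_matrixOp_le (hMa n) fun i j =>
    (hα i j).bound n h hh, fun n x => ?_, fun n x h hh => ?_⟩
  · funext i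
    simp only [matrixOp_apply, diagOp_apply, map_sum]
    exact Finset.sum_congr rfl fun j _ => (hα i j).comm_J n h hh (x j)
  · refine continuousOn_pi.2 fun i => ?_
    simp only [matrixOp_apply]
    exact continuousOn_finsetSum _ fun j _ => (hα i j).cont n (x j)
  · refine hasDerivWithinAt_pi.2 fun i => ?_
    simp only [matrixOp_apply, diagOp_apply]
    exact HasDerivWithinAt.fun_sum fun j _ => (hα i j).deriv n (x j) h hh

theorem CbOn.mono_isOpen {X F : Type*} [NormedAddCommGroup X] [NormedSpace ℝ X]
    [NormedAddCommGroup F] [NormedSpace ℝ F] {k : ℕ} {M : ℝ} {f : X → F} {s t : Set X}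
    (h : CbOn k M f t) (hs : IsOpen s) (ht : IsOpen t) (hst : s ⊆ t) : CbOn k M f s :=
  ⟨h.contDiffOn.mono hst, fun i hi x hx => by
    rw [iteratedFDerivWithin_of_isOpen i hs hx, ← iteratedFDerivWithin_of_isOpen i ht (hst hx)]
    exact h.bound i hi x (hst hx)⟩

/-- The map is the sum of its components, each composed with a projection and an embedding of norm
at most one; hence the number of components as a factor. -/
theorem cbOn_pi_map {k : ℕ} {κ R : ℝ} {β : E → E} (hβ : CbOn k κ β (Metric.ball 0 R)) :
    CbOn k (Fintype.card ι * κ) (fun (w : ι → E) i => β (w i)) (Metric.ball 0 R) := by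
  classical
  have hb : IsOpen (Metric.ball (0 : ι → E) R) := Metric.isOpen_ball
  have h1 : ∀ i ∈ (Finset.univ : Finset ι), CbOn k κ
      (fun w : ι → E => ContinuousLinearMap.single ℝ (fun _ : ι => E) i (β (w i)))
      (Metric.ball 0 R) := by
    intro i _
    have hp : ‖(ContinuousLinearMap.proj i : (ι → E) →L[ℝ] E)‖ ≤ 1 :=
      ContinuousLinearMap.opNorm_le_bound _ zero_le_one fun x => by
        rw [one_mul]; exact norm_le_pi_norm x i
    have hsi : ‖ContinuousLinearMap.single ℝ (fun _ : ι => E) i‖ ≤ 1 :=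
      ContinuousLinearMap.opNorm_le_bound _ zero_le_one fun x => by
        rw [one_mul]; exact (Pi.norm_single (G := fun _ : ι => E) x).le
    have ho : IsOpen ((ContinuousLinearMap.proj i : (ι → E) →L[ℝ] E) ⁻¹' Metric.ball 0 R) :=
      Metric.isOpen_ball.preimage (ContinuousLinearMap.continuous _)
    have h2 := hβ.comp_clm Metric.isOpen_ball.uniqueDiffOn
      (ContinuousLinearMap.proj i : (ι → E) →L[ℝ] E) hp ho.uniqueDiffOn
    refine (h2.mono_isOpen hb ho fun w hw => ?_).clm_of_le_one hb.uniqueDiffOn _ hsi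
    rw [mem_preimage, mem_ball_zero_iff]
    exact (norm_le_pi_norm w i).trans_lt (mem_ball_zero_iff.1 hw)
  have h2 := CbOn.sum Finset.univ hb.uniqueDiffOn h1
  rw [Finset.card_univ] at h2
  refine h2.congr fun w _ => ?_
  funext i
  simp [Finset.sum_apply]

theorem continuousOn_pi_map {R : ℝ} {β : E → E} (hβ : ContinuousOn β (Metric.closedBall 0 R)) :
    ContinuousOn (fun (w : ι → E) i => β (w i)) (Metric.closedBall 0 R) := by
  refine continuousOn_pi.2 fun i => hβ.comp (continuous_apply i).continuousOn fun w hw => ?_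
  rw [mem_closedBall_zero_iff] at hw ⊢
  exact (norm_le_pi_norm w i).trans hw

end Product

/-- The derivatives within `t` serve as the required continuous extensions. This covers both an open
ball around the closed ball of initial values and the closed interval of step sizes. -/
theorem CbOn.cbWith {X F : Type*} [NormedAddCommGroup X] [NormedSpace ℝ X]
    [NormedAddCommGroup F] [NormedSpace ℝ F] {k : ℕ} {M : ℝ} {f : X → F} {t U : Set X} {V : Set F}
    (hf : CbOn k M f t) (ht : UniqueDiffOn ℝ t) (hU : U ⊆ t) (hcl : closure (interior U) ⊆ t)
    (hV : MapsTo f U V) : CbWith k (fun _ => M) f U V := by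
  have hi : interior U ⊆ t := interior_subset.trans hU
  have he : ∀ i ≤ k, EqOn (iteratedFDerivWithin ℝ i f t) (iteratedFDeriv ℝ i f) (interior U) := by
    intro i hik x hx
    have hn : t ∈ 𝓝 x := mem_of_superset (isOpen_interior.mem_nhds hx) hi
    exact iteratedFDerivWithin_eq_iteratedFDeriv ht
      ((hf.contDiffOn.contDiffAt hn).of_le (by exact_mod_cast hik)) (hi hx)
  refine ⟨hV, hf.continuousOn.mono hU, hf.contDiffOn.mono hi, fun i hik x hx => ?_,
    fun i hik => ⟨iteratedFDerivWithin ℝ i f t, ?_, he i hik⟩⟩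
  · rw [← he i hik hx]
    exact hf.bound i hik x (hi hx)
  · exact (hf.contDiffOn.continuousOn_iteratedFDerivWithin (by exact_mod_cast hik) ht).mono hcl

theorem CbWith.cbOn {X F : Type*} [NormedAddCommGroup X] [NormedSpace ℝ X]
    [NormedAddCommGroup F] [NormedSpace ℝ F] {k : ℕ} {K : ℕ → ℝ} {f : X → F} {U : Set X} {V : Set F}
    {κ : ℝ} (hf : CbWith k K f U V) (hκ : ∀ i ≤ k, K i ≤ κ) : CbOn k κ f (interior U) :=
  ⟨hf.contDiffOn, fun i hi x hx => by
    rw [iteratedFDerivWithin_of_isOpen i isOpen_interior hx]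
    exact (hf.bound i hi x hx).trans (hκ i hi)⟩

/-! ### Coordinates on the levels of the scale -/

section Coordinates

variable {Y : Type*} [NormedAddCommGroup Y] [InnerProductSpace ℂ Y] [CompleteSpace Y]
  {A : Y →ₗ.[ℂ] Y} {B : Y → Y}

/-- The isometry `max(1, |A|)^(-ℓ)` from `Y` onto `Y_ℓ`. -/
noncomputable def scaleEquiv (hT : IsNormalResolvent (resolventAtOne A)) {ℓ : ℝ} (hℓ : 0 ≤ ℓ) :
    Y ≃ₗᵢ[ℝ] ScaleSpace A ℓ where
  toFun := ScaleSpace.mk A ℓ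
  map_add' x y := Subtype.ext (map_add (smoothing A ℓ) x y)
  map_smul' r x := Subtype.ext ((smoothing A ℓ).map_smul_of_tower r x)
  invFun x := x.2.choose
  left_inv x := by
    apply smoothing_injective hT hℓ
    exact (ScaleSpace.mk A ℓ x).2.choose_spec
  right_inv x := Subtype.ext x.2.choose_spec
  norm_map' x := ScaleSpace.norm_mk A ℓ (smoothing_injective hT hℓ) x

theorem toBase_scaleEquiv (hT : IsNormalResolvent (resolventAtOne A)) {ℓ : ℝ} (hℓ : 0 ≤ ℓ) (x : Y) :
    (scaleEquiv hT hℓ x).toBase = smoothing A ℓ x := rfl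

/-- The nonlinearity on the level `ℓ` in terms of coordinates has the expected regularity. -/
theorem LevelBound.exists_coord (hT : IsNormalResolvent (resolventAtOne A)) {ℓ : ℝ} (hℓ : 0 ≤ ℓ)
    {R : ℝ} (hR : 0 < R) {k n : ℕ} (hn : n ≤ k) {K : ℕ → ℝ} {κ : ℝ} (hκ : ∀ i ≤ k, K i ≤ κ)
    (h : LevelBound A B ℓ R k K) :
    ∃ β : Y → Y, (∀ x, smoothing A ℓ (β x) = B (smoothing A ℓ x)) ∧
      ContinuousOn β (Metric.closedBall 0 R) ∧ CbOn n κ β (Metric.ball 0 R) := by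
  obtain ⟨Bl, hB, hBl⟩ := h
  set e := scaleEquiv hT hℓ with he
  have hmap : ∀ x : Y, ‖e x‖ = ‖x‖ := e.norm_map
  have hint : interior (Metric.closedBall (0 : ScaleSpace A ℓ) R) = Metric.ball 0 R :=
    interior_closedBall _ hR.ne'
  have hb := hBl.cbOn hκ
  rw [hint] at hb
  have hpre : e ⁻¹' Metric.ball 0 R = Metric.ball 0 R := by
    ext x; simp
  refine ⟨fun x => e.symm (Bl (e x)), fun x => ?_, ?_, ?_⟩
  · have h1 : (e (e.symm (Bl (e x)))).toBase = B (e x).toBase := by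
      rw [e.apply_symm_apply, hB]
    exact h1
  · refine e.symm.continuous.comp_continuousOn (hBl.continuousOn.comp e.continuous.continuousOn
      fun x hx => ?_)
    rw [mem_closedBall_zero_iff] at hx ⊢
    rwa [hmap]
  · have hl : ‖(e.toContinuousLinearEquiv : Y →L[ℝ] ScaleSpace A ℓ)‖ ≤ 1 :=
      e.toLinearIsometry.norm_toContinuousLinearMap_le
    have hl' : ‖(e.symm.toContinuousLinearEquiv : ScaleSpace A ℓ →L[ℝ] Y)‖ ≤ 1 :=
      e.symm.toLinearIsometry.norm_toContinuousLinearMap_le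
    have hpre : (e.toContinuousLinearEquiv : Y →L[ℝ] ScaleSpace A ℓ) ⁻¹' Metric.ball 0 R =
      Metric.ball 0 R := hpre
    have h1 := hb.comp_clm Metric.isOpen_ball.uniqueDiffOn
      (e.toContinuousLinearEquiv : Y →L[ℝ] ScaleSpace A ℓ) hl
      (by rw [hpre]; exact Metric.isOpen_ball.uniqueDiffOn)
    rw [hpre] at h1
    exact (h1.clm_of_le_one Metric.isOpen_ball.uniqueDiffOn _ hl').of_le hn

end Coordinates


/-! ### The stage equations as a fixed point equation -/

section Stages

variable {Y : Type*} [NormedAddCommGroup Y] [InnerProductSpace ℂ Y] [CompleteSpace Y]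
  {A : Y →ₗ.[ℂ] Y} {S : ℝ → Y →L[ℂ] Y} {B : Y → Y} {s : ℕ} {c : Fin s → ℝ}
  {a : ℂ → Matrix (Fin s) (Fin s) ℂ} {b : ℂ → Fin s → ℂ} {Ma Mb : ℕ → ℝ} {R : ℝ}

/-- The nodes, where the update is regarded as an additional stage, labelled `none`. -/
def stageNode (c : Fin s → ℝ) (i : Option (Fin s)) : ℝ := i.elim 1 c

/-- The derivatives of the coefficient functions, where the update is regarded as an additional
stage, labelled `none`. -/
noncomputable def stageSymbol (a : ℂ → Matrix (Fin s) (Fin s) ℂ) (b : ℂ → Fin s → ℂ) :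
    Option (Fin s) → Option (Fin s) → ℕ → ℂ → ℂ
  | _, none => fun _ _ => 0
  | none, some j => fun n => iteratedDerivWithin n (fun z => b z j) leftHalfPlane
  | some i, some j => fun n => iteratedDerivWithin n (fun z => a z i j) leftHalfPlane

theorem isSymbol_stageSymbol (h : CondEXP a b Ma Mb) (i j : Option (Fin s)) :
    IsSymbol (fun n => |Ma n| + |Mb n|) (stageSymbol a b i j) := by
  rcases j with _ | j
  · refine ⟨fun n z _ => ?_, fun n z _ => ?_⟩
    · simpa [stageSymbol] using hasDerivWithinAt_const z leftHalfPlane (0 : ℂ)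
    · simp only [stageSymbol, norm_zero]
      positivity
  rcases i with _ | i
  · refine isSymbol_iteratedDerivWithin (h.analytic_b j) fun n z hz => ?_
    refine (Finset.single_le_sum (f := fun j => ‖iteratedDerivWithin n (fun z => b z j)
      leftHalfPlane z‖) (fun _ _ => norm_nonneg _) (Finset.mem_univ j)).trans ?_
    linarith [h.bound_b n z hz, le_abs_self (Mb n), abs_nonneg (Ma n)]
  · refine isSymbol_iteratedDerivWithin (h.analytic_a i j) fun n z hz => ?_
    refine (Finset.single_le_sum (f := fun j => ‖iteratedDerivWithin n (fun z => a z i j)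
      leftHalfPlane z‖) (fun _ _ => norm_nonneg _) (Finset.mem_univ j)).trans ?_
    linarith [h.bound_a n z hz i, le_abs_self (Ma n), abs_nonneg (Mb n)]

/-- The operators `a⁽ⁿ⁾(h A)` and `b⁽ⁿ⁾(h A)` as an operator on vectors of stages. -/
noncomputable def stageOp (A : Y →ₗ.[ℂ] Y) (a : ℂ → Matrix (Fin s) (Fin s) ℂ) (b : ℂ → Fin s → ℂ)
    (n : ℕ) (h : ℝ) : (Option (Fin s) → Y) →L[ℝ] (Option (Fin s) → Y) :=
  matrixOp fun i j => IsSymbol.fam A (stageSymbol a b i j) n h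

/-- The derivatives of `S (c h)` as an operator on vectors of stages. -/
noncomputable def stageSemigroup (S : ℝ → Y →L[ℂ] Y) (c : Fin s → ℝ) (n : ℕ) (h : ℝ) :
    (Option (Fin s) → Y) →L[ℝ] (Option (Fin s) → Y) :=
  matrixOp fun i j => (if i = j then semigroupFam S (stageNode c i) else fun _ _ => 0) n h

theorem opFam_stageOp (hE : CondEXP a b Ma Mb) (h1 : CondA1 A S) (h2 : CondA2 S) {t : Set ℝ}
    (ht : t ⊆ Ici 0) : OpFam (diagOp (Option (Fin s)) (inclR A)) (diagOp _ (genR A))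
      (fun n => Fintype.card (Option (Fin s)) * (|Ma n| + |Mb n|)) t (stageOp A a b) :=
  OpFam.matrix (α := fun i j => IsSymbol.fam A (stageSymbol a b i j)) (fun _ => by positivity)
    fun i j => (isSymbol_stageSymbol hE i j).opFam h1 h2 ht

theorem opFam_stageSemigroup (hc : ∀ i, c i ∈ Icc (0 : ℝ) 1) (h1 : CondA1 A S) (h2 : CondA2 S)
    {t : Set ℝ} (ht : t ⊆ Ici 0) :
    OpFam (diagOp (Option (Fin s)) (inclR A)) (diagOp _ (genR A))
      (fun _ => Fintype.card (Option (Fin s)) * 1) t (stageSemigroup S c) := by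
  refine OpFam.matrix (α := fun i j => if i = j then semigroupFam S (stageNode c i)
    else fun _ _ => 0) (fun _ => zero_le_one) fun i j => ?_
  split_ifs
  · refine opFam_semigroup h1 h2 ?_ ht
    rcases i with _ | i
    · simp [stageNode]
    · exact hc i
  · exact OpFam.zero _ _ (fun _ => zero_le_one) t

theorem stageSemigroup_apply (h : ℝ) (x : Option (Fin s) → Y) (i : Option (Fin s)) :
    stageSemigroup S c 0 h x i = S (h * stageNode c i) (x i) := by
  rw [stageSemigroup, matrixOp_apply, Finset.sum_eq_single i]
  · rw [if_pos rfl, semigroupFam, pow_zero, one_smul]; rfl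
  · intro j _ hj
    rw [if_neg hj.symm]; rfl
  · simp

theorem fam_stageSymbol_none (hT : IsNormalResolvent (resolventAtOne A)) (i : Option (Fin s))
    (h : ℝ) (x : Y) : IsSymbol.fam A (stageSymbol a b i none) 0 h x = 0 := by
  have h0 := funCalc_const hT 0
  rw [zero_smul] at h0
  exact DFunLike.congr_fun h0 x

theorem stageOp_apply_none (hT : IsNormalResolvent (resolventAtOne A)) (h : ℝ)
    (x : Option (Fin s) → Y) :
    stageOp A a b 0 h x none = ∑ j, funCalc A (fun z => b (h * z) j) (x (some j)) := by
  rw [stageOp, matrixOp_apply, Fintype.sum_option, fam_stageSymbol_none hT, zero_add]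
  simp only [IsSymbol.fam, stageSymbol, iteratedDerivWithin_zero]
  rfl

theorem stageOp_apply_some (hT : IsNormalResolvent (resolventAtOne A)) (h : ℝ)
    (x : Option (Fin s) → Y) (i : Fin s) :
    stageOp A a b 0 h x (some i) = ∑ j, funCalc A (fun z => a (h * z) i j) (x (some j)) := by
  rw [stageOp, matrixOp_apply, Fintype.sum_option, fam_stageSymbol_none hT, zero_add]
  simp only [IsSymbol.fam, stageSymbol, iteratedDerivWithin_zero]
  rfl

/-- The column `none` of the operator matrix is zero: the update does not feed back into the stages.
-/
theorem stageOp_congr (hT : IsNormalResolvent (resolventAtOne A)) (h : ℝ)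
    {x y : Option (Fin s) → Y} (hxy : ∀ j, x (some j) = y (some j)) :
    stageOp A a b 0 h x = stageOp A a b 0 h y := by
  funext i
  rcases i with _ | i
  · simp only [stageOp_apply_none hT, hxy]
  · simp only [stageOp_apply_some hT, hxy]

/-- The fixed point equation for all stages, including the update, is equivalent to the equations
that define the method. -/
theorem fixed_iff (hT : IsNormalResolvent (resolventAtOne A)) {h : ℝ} {U : Y}
    {w v : Option (Fin s) → Y} :
    w = stageSemigroup S c 0 h (fun _ => U) + (h • stageOp A a b 0 h) (fun i => B (v i)) ↔
      (∀ i, w (some i) = S (h * c i) U +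
        (h : ℂ) • ∑ j, funCalc A (fun z => a (h * z) i j) (B (v (some j)))) ∧
      w none = rkUpdate A S B b U h fun i => v (some i) := by
  rw [funext_iff, Option.forall, and_comm]
  simp only [Pi.add_apply, smul_apply, Pi.smul_apply, stageSemigroup_apply,
    stageOp_apply_none hT, stageOp_apply_some hT, rkUpdate, stageNode, Option.elim_none,
    Option.elim_some, mul_one, Complex.coe_smul]

/-- The vector of all stages, including the update as the last one. -/
noncomputable def stageVec (R : ℝ) (A : Y →ₗ.[ℂ] Y) (S : ℝ → Y →L[ℂ] Y) (B : Y → Y) (c : Fin s → ℝ)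
    (a : ℂ → Matrix (Fin s) (Fin s) ℂ) (b : ℂ → Fin s → ℂ) (U : Y) (h : ℝ) : Option (Fin s) → Y :=
  solMap R (fun w i => B (w i)) (h • stageOp A a b 0 h) (stageSemigroup S c 0 h fun _ => U)

theorem norm_stageSemigroup_const_le (h2 : CondA2 S) (hc : ∀ i, c i ∈ Icc (0 : ℝ) 1) {h : ℝ}
    (hh : 0 ≤ h) (U : Y) : ‖stageSemigroup S c 0 h fun _ => U‖ ≤ ‖U‖ := by
  refine (pi_norm_le_iff_of_nonneg (norm_nonneg U)).2 fun i => ?_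
  rw [stageSemigroup_apply]
  have hi : 0 ≤ stageNode c i := by
    rcases i with _ | i
    · simp [stageNode]
    · exact (hc i).1
  simpa using (S (h * stageNode c i)).le_of_opNorm_le (h2 _ (mul_nonneg hh hi)) U

/-- The maximal step size, in terms of bounds for the coefficient functions and for the
nonlinearity and its derivatives. -/
noncomputable def maxStep (s : ℕ) (m κ R : ℝ) : ℝ :=
  min 1 (min (1 / 2) (R / 4) /
    (Fintype.card (Option (Fin s)) * m * (Fintype.card (Option (Fin s)) * κ) + 1))

theorem maxStep_pos {m κ : ℝ} (hm : 0 ≤ m) (hκ : 0 ≤ κ) (hR : 0 < R) : 0 < maxStep s m κ R := by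
  rw [maxStep]
  positivity

theorem norm_smul_clm {E : Type*} [NormedAddCommGroup E] [NormedSpace ℝ E] (r : ℝ) (T : E →L[ℝ] E) :
    ‖r • T‖ = ‖r‖ * ‖T‖ := norm_smul r T

/-- Stated for any `β`: in coordinates the operators are the same on all levels, so one step size
serves for the nonlinearities of all levels with the common bound `κ`. -/
theorem isContractive_stage (hE : CondEXP a b Ma Mb) (h1 : CondA1 A S) (h2 : CondA2 S) {κ : ℝ}
    (hκ : 0 ≤ κ) (hR : 0 < R) {n : ℕ} (hn : 1 ≤ n) {β : Y → Y}
    (hc : ContinuousOn β (Metric.closedBall 0 R)) (hβ : CbOn n κ β (Metric.ball 0 R)) {h : ℝ}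
    (hh : h ∈ Icc 0 (maxStep s (|Ma 0| + |Mb 0|) κ R)) :
    IsContractive n (Fintype.card (Option (Fin s)) * κ) R
      (fun (w : Option (Fin s) → Y) i => β (w i)) (h • stageOp A a b 0 h) := by
  set d := (Nat.cast (Fintype.card (Option (Fin s))) : ℝ)
  set m : ℝ := |Ma 0| + |Mb 0| with hm
  have hm0 : 0 ≤ m := by positivity
  have hd : 0 ≤ d := Nat.cast_nonneg _
  have hkey : ‖h • stageOp A a b 0 h‖ * (d * κ) ≤ min (1 / 2) (R / 4) := by
    have h3 : ‖stageOp A a b 0 h‖ ≤ d * m :=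
      (opFam_stageOp hE h1 h2 (t := Ici 0) subset_rfl).bound 0 h hh.1
    -- Here `d * m` bounds the operator and `d * κ` the nonlinearity on vectors of stages; the
    -- summand `1` keeps the denominator positive.
    have h4 : h ≤ min (1 / 2) (R / 4) / (d * m * (d * κ) + 1) := hh.2.trans (min_le_right _ _)
    rw [le_div_iff₀ (by positivity)] at h4
    rw [norm_smul_clm, Real.norm_of_nonneg hh.1]
    calc _ ≤ h * (d * m) * (d * κ) := by gcongr; exact hh.1
      _ ≤ h * (d * m * (d * κ) + 1) := by nlinarith [hh.1]
      _ ≤ _ := h4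
  exact ⟨hR, hn, continuousOn_pi_map hc, cbOn_pi_map hβ, hkey.trans (min_le_left _ _),
    hkey.trans (min_le_right _ _)⟩

end Stages


/-! ### The solution of the stage equations and its dependence on the initial value. -/

section Method

variable {Y : Type*} [NormedAddCommGroup Y] [InnerProductSpace ℂ Y] [CompleteSpace Y]
  {A : Y →ₗ.[ℂ] Y} {S : ℝ → Y →L[ℂ] Y} {B : Y → Y} {s : ℕ} {c : Fin s → ℝ}
  {a : ℂ → Matrix (Fin s) (Fin s) ℂ} {b : ℂ → Fin s → ℂ} {Ma Mb : ℕ → ℝ} {R κ h : ℝ} {n : ℕ}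

theorem smoothing_one_pow (hT : IsNormalResolvent (resolventAtOne A)) (k : ℕ) :
    smoothing A 1 ^ k = smoothing A k := by
  induction k with
  | zero => rw [pow_zero, Nat.cast_zero, smoothing_zero hT]
  | succ k ih =>
    rw [pow_succ, ih, Nat.cast_succ, smoothing_add hT (Nat.cast_nonneg k) zero_le_one]

theorem inclR_pow_apply (hT : IsNormalResolvent (resolventAtOne A)) (k : ℕ) (x : Y) :
    (inclR A ^ k) x = smoothing A k x := by
  rw [← smoothing_one_pow hT]
  induction k generalizing x with
  | zero => rfl
  | succ k ih => rw [pow_succ, pow_succ, mul_apply_eq_comp, mul_apply_eq_comp, ih]; rfl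

/-- The stages are the only solution of the stage equations in the ball of radius `R`. -/
theorem stageVec_unique (hT : IsNormalResolvent (resolventAtOne A)) (h2 : CondA2 S)
    (hc : ∀ i, c i ∈ Icc (0 : ℝ) 1) (hh : 0 ≤ h)
    (hI : IsContractive n κ R (fun (w : Option (Fin s) → Y) i => B (w i)) (h • stageOp A a b 0 h))
    {U : Y} (hU : ‖U‖ ≤ R / 2) (V : Fin s → Y) :
    ((∀ i, V i ∈ Metric.closedBall (0 : Y) R) ∧ IsStageVector A S B c a U h V) ↔
      V = fun i => stageVec R A S B c a b U h (some i) := by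
  have hR := hI.pos
  have hp : ‖stageSemigroup S c 0 h fun _ => U‖ ≤ R / 2 :=
    (norm_stageSemigroup_const_le h2 hc hh U).trans hU
  have hp' : ‖stageSemigroup S c 0 h fun _ => U‖ < 3 * R / 4 := by linarith
  constructor
  · rintro ⟨hV, hV'⟩
    set v : Option (Fin s) → Y := fun i => i.elim 0 V with hv
    have hvb : v ∈ Metric.closedBall (0 : Option (Fin s) → Y) R := by
      refine mem_closedBall_zero_iff.2 ((pi_norm_le_iff_of_nonneg hR.le).2 fun i => ?_)
      rcases i with _ | i
      · simpa [hv] using hR.le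
      · exact mem_closedBall_zero_iff.1 (hV i)
    -- One application of the fixed point map leaves the stages as they are and replaces the
    -- arbitrary entry `0` at `none` by the update. The result is a fixed point, as that entry is
    -- never used.
    set w := stageSemigroup S c 0 h (fun _ => U) + (h • stageOp A a b 0 h) (fun i => B (v i))
      with hw
    have hws : ∀ i, w (some i) = V i := fun i =>
      (((fixed_iff hT).1 hw).1 i).trans (hV' i).symm
    have hwb : w ∈ Metric.closedBall (0 : Option (Fin s) → Y) R := by
      rw [mem_closedBall_zero_iff]
      have := hI.norm_map_le hvb
      linarith [norm_add_le (stageSemigroup S c 0 h fun _ => U)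
        ((h • stageOp A a b 0 h) (fun i => B (v i)))]
    have hwe : w = stageSemigroup S c 0 h (fun _ => U) +
        (h • stageOp A a b 0 h) (fun i => B (w i)) := by
      nth_rewrite 1 [hw]
      rw [smul_apply, smul_apply, stageOp_congr hT h
        (x := fun i => B (v i)) (y := fun i => B (w i)) fun j => congrArg B (hws j).symm]
    funext i
    rw [← hws i, hI.eq_solMap hp' hwb hwe]
    rfl
  · rintro rfl
    obtain ⟨h3, h4⟩ := hI.solMap_spec hp'
    rw [mem_closedBall_zero_iff] at h3
    exact ⟨fun i => mem_closedBall_zero_iff.2 ((norm_le_pi_norm _ _).trans h3),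
      ((fixed_iff hT).1 h4).1⟩

theorem stageVec_none (hT : IsNormalResolvent (resolventAtOne A)) (h2 : CondA2 S)
    (hc : ∀ i, c i ∈ Icc (0 : ℝ) 1) (hh : 0 ≤ h)
    (hI : IsContractive n κ R (fun (w : Option (Fin s) → Y) i => B (w i)) (h • stageOp A a b 0 h))
    {U : Y} (hU : ‖U‖ < 3 * R / 4) :
    stageVec R A S B c a b U h none =
      rkUpdate A S B b U h fun i => stageVec R A S B c a b U h (some i) :=
  ((fixed_iff hT).1 (hI.solMap_spec
    ((norm_stageSemigroup_const_le h2 hc hh U).trans_lt hU)).2).2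

theorem stageVec_mem (h2 : CondA2 S) (hc : ∀ i, c i ∈ Icc (0 : ℝ) 1) (hh : 0 ≤ h)
    (hI : IsContractive n κ R (fun (w : Option (Fin s) → Y) i => B (w i)) (h • stageOp A a b 0 h))
    {U : Y} (hU : ‖U‖ < 3 * R / 4) (i : Option (Fin s)) :
    stageVec R A S B c a b U h i ∈ Metric.closedBall (0 : Y) R := by
  have h3 := (hI.solMap_spec ((norm_stageSemigroup_const_le h2 hc hh U).trans_lt hU)).1
  rw [mem_closedBall_zero_iff] at h3 ⊢
  exact (norm_le_pi_norm _ i).trans h3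

/-- Regularity of the stages in the initial value. -/
theorem cbOn_stageVec (h2 : CondA2 S) (hc : ∀ i, c i ∈ Icc (0 : ℝ) 1) (hh : 0 ≤ h) {C : ℝ}
    (hsol : CbOn n C (solMap R (fun (w : Option (Fin s) → Y) i => B (w i)) (h • stageOp A a b 0 h))
      (Metric.ball 0 (3 * R / 4))) (i : Option (Fin s)) :
    CbOn n C (fun U => stageVec R A S B c a b U h i) (Metric.ball 0 (3 * R / 4)) := by
  set L : Y →L[ℝ] (Option (Fin s) → Y) := (stageSemigroup S c 0 h).comp
    (ContinuousLinearMap.pi fun _ => ContinuousLinearMap.id ℝ Y)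
  have hL : ∀ U, ‖L U‖ ≤ ‖U‖ := norm_stageSemigroup_const_le h2 hc hh
  have hL1 : ‖L‖ ≤ 1 := L.opNorm_le_bound zero_le_one fun U => by rw [one_mul]; exact hL U
  have ho : IsOpen (L ⁻¹' Metric.ball 0 (3 * R / 4)) := Metric.isOpen_ball.preimage L.continuous
  have h3 := (hsol.comp_clm Metric.isOpen_ball.uniqueDiffOn L hL1 ho.uniqueDiffOn).mono_isOpen
    (Metric.isOpen_ball (x := 0) (ε := 3 * R / 4)) ho fun U hU => by
      rw [mem_preimage, mem_ball_zero_iff]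
      exact (hL U).trans_lt (mem_ball_zero_iff.1 hU)
  exact h3.clm_of_le_one Metric.isOpen_ball.uniqueDiffOn
    (ContinuousLinearMap.proj i : (Option (Fin s) → Y) →L[ℝ] Y)
    (ContinuousLinearMap.opNorm_le_bound _ zero_le_one fun x => by
      rw [one_mul]; exact norm_le_pi_norm x i)

/-- Solving the stage equations commutes with the inclusion of the levels into the base space. -/
theorem smoothing_stageVec (hE : CondEXP a b Ma Mb) (h1 : CondA1 A S) (h2 : CondA2 S)
    (hc : ∀ i, c i ∈ Icc (0 : ℝ) 1) (hh : 0 ≤ h) {ℓ : ℝ} (hℓ : 0 ≤ ℓ) {β : Y → Y}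
    (hβ : ∀ x, smoothing A ℓ (β x) = B (smoothing A ℓ x)) {m : ℕ}
    (hI : IsContractive n κ R (fun (w : Option (Fin s) → Y) i => B (w i)) (h • stageOp A a b 0 h))
    (hI' : IsContractive m κ R (fun (w : Option (Fin s) → Y) i => β (w i)) (h • stageOp A a b 0 h))
    {u : Y} (hu : ‖u‖ < 3 * R / 4) (i : Option (Fin s)) :
    smoothing A ℓ (stageVec R A S β c a b u h i) =
      stageVec R A S B c a b (smoothing A ℓ u) h i := by
  have hT := isNormalResolvent_resolventAtOne h1 h2
  have hA := isResolventAtOne_resolventAtOne h1 h2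
  have hsm : ∀ x, ‖smoothing A ℓ x‖ ≤ ‖x‖ := fun x => by
    have := norm_funCalc_apply_le hT (bddLeft_smoothing hℓ) x
    rwa [one_mul] at this
  obtain ⟨h3, h4⟩ := hI'.solMap_spec ((norm_stageSemigroup_const_le h2 hc hh u).trans_lt hu)
  set w := stageVec R A S β c a b u h with hw
  change w ∈ _ at h3
  change w = _ + (h • stageOp A a b 0 h) (fun i => β (w i)) at h4
  have hdiag : (fun i => smoothing A ℓ (w i)) =
      diagOp _ ((smoothing A ℓ).restrictScalars ℝ) w := rfl
  have hop : ∀ x : Option (Fin s) → Y, diagOp _ ((smoothing A ℓ).restrictScalars ℝ)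
      (stageOp A a b 0 h x) = stageOp A a b 0 h fun i => smoothing A ℓ (x i) := by
    intro x
    funext i
    simp only [stageOp, matrixOp_apply, diagOp_apply, map_sum]
    exact Finset.sum_congr rfl fun j _ => DFunLike.congr_fun (commute_funCalc_funCalc hT
      (bddLeft_smoothing hℓ) ((isSymbol_stageSymbol hE i j).bddLeft 0 hh)).eq (x j)
  have hse : diagOp _ ((smoothing A ℓ).restrictScalars ℝ)
      (stageSemigroup S c 0 h fun _ => u) =
        stageSemigroup S c 0 h fun _ => smoothing A ℓ u := by
    funext i
    have hi : 0 ≤ stageNode c i := by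
      rcases i with _ | i
      · simp [stageNode]
      · exact (hc i).1
    rw [diagOp_apply, stageSemigroup_apply, stageSemigroup_apply]
    exact (DFunLike.congr_fun (commute_funCalc hT (bddLeft_smoothing hℓ)
      (commute_semigroup_resolvent h1 hA (mul_nonneg hh hi))).eq u).symm
  have h5 : (fun i => smoothing A ℓ (w i)) = stageVec R A S B c a b (smoothing A ℓ u) h := by
    refine hI.eq_solMap ((norm_stageSemigroup_const_le h2 hc hh _).trans_lt
      ((hsm u).trans_lt hu)) ?_ ?_
    · rw [mem_closedBall_zero_iff] at h3 ⊢
      exact (pi_norm_le_iff_of_nonneg hI.pos.le).2 fun i =>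
        (hsm _).trans ((norm_le_pi_norm w i).trans h3)
    · simp only [← hβ]
      rw [hdiag]
      nth_rewrite 1 [h4]
      rw [map_add, hse, smul_apply, smul_apply, map_smul, hop]
  exact congrFun h5 i

end Method

/-! ### Dependence on the step size. -/

section Step

universe u

/-- Regularity of the stages in the step size. -/
theorem exists_cbOn_step (s k : ℕ) (Ma Mb : ℕ → ℝ) {R κ : ℝ} (hR : 0 < R) (hκ : 0 ≤ κ) :
    ∃ C : ℝ, 0 ≤ C ∧ ∀ (Y : Type u) [NormedAddCommGroup Y] [InnerProductSpace ℂ Y] [CompleteSpace Y]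
      (A : Y →ₗ.[ℂ] Y) (S : ℝ → Y →L[ℂ] Y) (B : Y → Y) (c : Fin s → ℝ)
      (a : ℂ → Matrix (Fin s) (Fin s) ℂ) (b : ℂ → Fin s → ℂ) (β : ℕ → Y → Y) (ℓ : ℝ),
      CondA1 A S → CondA2 S → CondEXP a b Ma Mb → (∀ i, c i ∈ Icc (0 : ℝ) 1) → (k : ℝ) ≤ ℓ →
      ContinuousOn B (Metric.closedBall 0 R) → CbOn 1 κ B (Metric.ball 0 R) →
      (∀ j ≤ k, (∀ x, smoothing A (ℓ - j) (β j x) = B (smoothing A (ℓ - j) x)) ∧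
        ContinuousOn (β j) (Metric.closedBall 0 R) ∧ CbOn (j + 1) κ (β j) (Metric.ball 0 R)) →
      ∀ u : Y, ‖u‖ ≤ R / 2 → ∀ i, CbOn k C
        (fun h => stageVec R A S B c a b (smoothing A ℓ u) h i)
        (Icc 0 (maxStep s (|Ma 0| + |Mb 0|) κ R)) := by
  obtain ⟨C₀, hC₀, hq⟩ := OpFam.exists_scaleReg_apply.{u} k
    (fun _ => Fintype.card (Option (Fin s)) * 1) 0 R
  obtain ⟨C, hC, hw⟩ := exists_scaleReg_nonlinear.{u} k
    (fun n => Fintype.card (Option (Fin s)) * (|Ma n| + |Mb n|)) C₀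
    (Fintype.card (Option (Fin s)) * κ) R hC₀ (by positivity)
  refine ⟨C, hC, fun Y _ _ _ A S B c a b β ℓ h1 h2 hE hc hkℓ hBc hB hβ u hu i => ?_⟩
  have hT := isNormalResolvent_resolventAtOne h1 h2
  have hpos : 0 < maxStep s (|Ma 0| + |Mb 0|) κ R := maxStep_pos (by positivity) hκ hR
  set H := maxStep s (|Ma 0| + |Mb 0|) κ R with hH
  have hs : UniqueDiffOn ℝ (Icc 0 H) := uniqueDiffOn_Icc hpos
  -- This is the purpose of the cutoff at `1` in `maxStep`.
  have hs1 : Icc 0 H ⊆ Icc 0 1 := Icc_subset_Icc_right (min_le_left _ _)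
  have hs0 : Icc 0 H ⊆ Ici 0 := fun _ h => h.1
  have hJ : ‖diagOp (Option (Fin s)) (inclR A)‖ ≤ 1 := norm_diagOp_le_one (norm_inclR_le hT)
  have hΛ : ‖diagOp (Option (Fin s)) (genR A)‖ ≤ 1 := norm_diagOp_le_one (norm_genR_le hT)
  have hJΛ : ∀ x, diagOp (Option (Fin s)) (genR A) (diagOp _ (inclR A) x) =
      diagOp _ (inclR A) (diagOp _ (genR A) x) := fun x => funext fun i => genR_inclR hT (x i)
  have hu' : ‖u‖ < 3 * R / 4 := by linarith
  have hk0 : (0 : ℝ) ≤ k := Nat.cast_nonneg k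
  have hsub : ∀ j ≤ k, 0 ≤ ℓ - j := fun j hj => by
    have : (j : ℝ) ≤ k := by exact_mod_cast hj
    linarith
  have hcon : ∀ j ≤ k, ∀ h ∈ Icc 0 H, IsContractive (j + 1) (Fintype.card (Option (Fin s)) * κ) R
      (fun (w : Option (Fin s) → Y) i => β j (w i)) (h • stageOp A a b 0 h) := fun j hj h hh =>
    isContractive_stage hE h1 h2 hκ hR (by omega) (hβ j hj).2.1 (hβ j hj).2.2 hh
  have hconst : ScaleReg (diagOp (Option (Fin s)) (inclR A)) k R
      (fun _ : ℝ => fun _ : Option (Fin s) => u) (Icc 0 H) := by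
    intro j _
    refine (CbOn.const _).mono ((pi_norm_le_iff_of_nonneg hR.le).2 fun i => ?_)
    rw [diagOp_pow_apply, inclR_pow_apply hT]
    have := norm_funCalc_apply_le hT (bddLeft_smoothing (Nat.cast_nonneg j)) u
    rw [one_mul] at this
    exact this.trans (by linarith)
  have h3 := hq _ _ _ _ _ _ hs hJ hΛ hJΛ (opFam_stageSemigroup hc h1 h2 hs0) hconst
  have hp : ∀ h ∈ Icc 0 H, ‖stageSemigroup S c 0 h fun _ => u‖ < 3 * R / 4 := fun h hh =>
    (norm_stageSemigroup_const_le h2 hc hh.1 u).trans_lt hu'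
  -- The equation is solved on the level `ℓ`, with the coordinate `u` as initial value and `β j` as
  -- the nonlinearity on the level `ℓ - j`.
  have h4 := hw _ _ _ _ _ _ (stageVec R A S (β 0) c a b u)
    (fun j (w : Option (Fin s) → Y) i => β j (w i)) hs hs1 hJ hΛ hJΛ
    (opFam_stageOp hE h1 h2 hs0) h3 hcon ?_
    (fun h hh => (hcon 0 (Nat.zero_le k) h hh).solMap_mem_ball (hp h hh))
    (fun h hh => ((hcon 0 (Nat.zero_le k) h hh).solMap_spec (hp h hh)).2)
  · have h5 := h4 k le_rfl
    -- After `k` descents the curve is `C^k` on the level `ℓ - k`; this operator takes its `i`-th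
    -- component from there to `Y`.
    have hn : ‖((smoothing A (ℓ - k)).restrictScalars ℝ).comp
        (ContinuousLinearMap.proj i : (Option (Fin s) → Y) →L[ℝ] Y)‖ ≤ 1 := by
      refine ContinuousLinearMap.opNorm_le_bound _ zero_le_one fun x => ?_
      have := norm_funCalc_apply_le hT (bddLeft_smoothing (hsub k le_rfl)) (x i)
      rw [one_mul] at this ⊢
      exact this.trans (norm_le_pi_norm x i)
    refine (h5.clm_of_le_one hs _ hn).congr fun h hh => ?_
    have hβ0 := (hβ 0 (Nat.zero_le k)).1
    rw [Nat.cast_zero, sub_zero] at hβ0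
    change stageVec R A S B c a b (smoothing A ℓ u) h i = smoothing A (ℓ - k)
      ((diagOp (Option (Fin s)) (inclR A) ^ k) (stageVec R A S (β 0) c a b u h) i)
    rw [diagOp_pow_apply, inclR_pow_apply hT, ← mul_apply_eq_comp,
      ← smoothing_add hT (hsub k le_rfl) hk0, sub_add_cancel]
    exact (smoothing_stageVec hE h1 h2 hc hh.1 (hk0.trans hkℓ) hβ0
      (isContractive_stage hE h1 h2 hκ hR le_rfl hBc hB hh) (hcon 0 (Nat.zero_le k) h hh)
      hu' i).symm
  · intro j hj x
    funext i
    have h6 : smoothing A (ℓ - j) = smoothing A (ℓ - (j + 1 : ℕ)) * smoothing A 1 := by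
      rw [← smoothing_add hT (hsub (j + 1) hj) zero_le_one]
      congr 1
      push_cast
      ring
    -- Both sides represent the same value of `B`, and coordinates on the level `ℓ - (j + 1)` are
    -- unique.
    apply smoothing_injective hT (hsub (j + 1) hj)
    have h7 := (hβ j hj.le).1 (x i)
    rw [h6] at h7
    exact h7.trans ((hβ (j + 1) hj).1 (smoothing A 1 (x i))).symm

end Step

/-! ### Choice of the constants and proof of the theorem. -/

/-- A sequence is bounded, up to any given index, by a sum of absolute values. -/
theorem le_sum_abs (K : ℕ → ℝ) {N i : ℕ} (hi : i ≤ N) :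
    K i ≤ ∑ j ∈ Finset.range (N + 1), |K j| :=
  (le_abs_self _).trans (Finset.single_le_sum (f := fun j => |K j|) (fun _ _ => abs_nonneg _)
    (Finset.mem_range.2 (by omega)))

/-- Descending `j` levels gains exactly `j` derivatives, as `⌈ℓ - j⌉₊ = ⌈ℓ⌉₊ - j`. The strict
inequality `⌈L⌉₊ < N` supplies the one derivative required on the top level. -/
theorem natCeil_sub_add_lt {ℓ L : ℝ} {N j : ℕ} (hℓ : ℓ ≤ L) (hN : ⌈L⌉₊ < N) (hj : (j : ℝ) ≤ ℓ) :
    j + 1 ≤ N - ⌈ℓ - j⌉₊ := by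
  have h1 : ⌈ℓ - j⌉₊ + j = ⌈ℓ⌉₊ := by
    rw [← Nat.ceil_add_natCast (sub_nonneg.2 hj), sub_add_cancel]
  have h2 : ⌈ℓ⌉₊ ≤ ⌈L⌉₊ := Nat.ceil_mono hℓ
  omega

theorem theorem4p2 (s N : ℕ) (R : ℝ) (hR : 0 < R) (Ma Mb K : ℕ → ℝ) :
    ∃ hstar : ℝ, 0 < hstar ∧ ∃ C : ℕ → ℝ,
      ∀ (Y : Type*) [NormedAddCommGroup Y] [InnerProductSpace ℂ Y] [CompleteSpace Y]
        (A : Y →ₗ.[ℂ] Y) (S : ℝ → Y →L[ℂ] Y) (B : Y → Y) (L : ℝ) (I : Set ℝ)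
        (c : Fin s → ℝ) (a : ℂ → Matrix (Fin s) (Fin s) ℂ) (b : ℂ → Fin s → ℂ),
        CondA1 A S → CondA2 S → CondB A B L I N →
        Monotone c → (∀ i, c i ∈ Set.Icc (0 : ℝ) 1) → CondEXP a b Ma Mb →
        LevelBound A B 0 R N K →
        ∃ (W : Y → ℝ → Fin s → Y) (Ψ : Y → ℝ → Y),
          -- for each `U`, `h`, the stage equations have exactly one solution in the ball of
          -- radius `R`, and it is `W U h`
          (∀ U ∈ Metric.closedBall (0 : Y) (R / 2), ∀ h ∈ Set.Icc 0 hstar,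
            ∀ V : Fin s → Y,
              ((∀ i, V i ∈ Metric.closedBall (0 : Y) R) ∧ IsStageVector A S B c a U h V) ↔
                V = W U h) ∧
          (∀ U h, Ψ U h = rkUpdate A S B b U h (W U h)) ∧
          -- regularity in `U`, uniformly in `h`
          (∀ h ∈ Set.Icc 0 hstar,
            (∀ i, CbWith N C (fun U => W U h i)
              (Metric.closedBall (0 : Y) (R / 2)) (Metric.closedBall (0 : Y) R)) ∧
            CbWith N C (fun U => Ψ U h)
              (Metric.closedBall (0 : Y) (R / 2)) (Metric.closedBall (0 : Y) R)) ∧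
          -- regularity in `h`, uniformly in `U`
          (∀ ℓ ∈ IMinus I, ∀ k : ℕ, (k : ℝ) ≤ ℓ →
            (∀ j : ℕ, j ≤ k → LevelBound A B (ℓ - j) R (N - ⌈ℓ - j⌉₊) K) →
            ∀ U : ScaleSpace A ℓ, U ∈ Metric.closedBall (0 : ScaleSpace A ℓ) (R / 2) →
              (∀ i, CbWith k C (fun h => W U.toBase h i)
                (Set.Icc 0 hstar) (Metric.closedBall (0 : Y) R)) ∧
              CbWith k C (fun h => Ψ U.toBase h)
                (Set.Icc 0 hstar) (Metric.closedBall (0 : Y) R)) := by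
  -- A single bound for all orders and all levels makes the step size independent of `ℓ` and `k`.
  set κ : ℝ := ∑ j ∈ Finset.range (N + 1), |K j| with hκ
  have hκ0 : 0 ≤ κ := Finset.sum_nonneg fun _ _ => abs_nonneg _
  obtain ⟨C₀, hsol⟩ := exists_cbOn_solMap N (Fintype.card (Option (Fin s)) * κ) R
  choose C₁ hC₁ hstep using fun k => exists_cbOn_step s k Ma Mb hR hκ0
  -- Only `k < N` can occur, since `k ≤ ℓ ≤ L` and `⌈L⌉₊ < N`; so a finite sum bounds all the
  -- constants.
  set M : ℝ := |C₀| + ∑ k ∈ Finset.range N, C₁ k with hM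
  have hM0 : C₀ ≤ M := by
    linarith [le_abs_self C₀, Finset.sum_nonneg fun k (_ : k ∈ Finset.range N) => hC₁ k]
  have hM1 : ∀ k < N, C₁ k ≤ M := fun k hk => by
    linarith [abs_nonneg C₀,
      Finset.single_le_sum (f := C₁) (fun k _ => hC₁ k) (Finset.mem_range.2 hk)]
  have hH : 0 < maxStep s (|Ma 0| + |Mb 0|) κ R := maxStep_pos (by positivity) hκ0 hR
  refine ⟨maxStep s (|Ma 0| + |Mb 0|) κ R, hH, fun _ => M, ?_⟩
  intro Y _ _ _ A S B L I c a b h1 h2 hB _ hc hE hlev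
  have hT := isNormalResolvent_resolventAtOne h1 h2
  have hN : 1 ≤ N := by have := hB.lt_N; omega
  obtain ⟨β₀, hβ₀, hcont, hsmooth⟩ := hlev.exists_coord hT le_rfl hR le_rfl
    fun i hi => le_sum_abs K hi
  -- On the level `0` the coordinate map is the identity.
  have hβB : β₀ = B := by
    funext x
    simpa [smoothing_zero hT] using hβ₀ x
  rw [hβB] at hcont hsmooth
  have hcon : ∀ h ∈ Icc 0 (maxStep s (|Ma 0| + |Mb 0|) κ R), IsContractive N _ R
      (fun (w : Option (Fin s) → Y) i => B (w i)) (h • stageOp A a b 0 h) := fun h hh =>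
    isContractive_stage hE h1 h2 hκ0 hR hN hcont hsmooth hh
  have hlt : ∀ U ∈ Metric.closedBall (0 : Y) (R / 2), ‖U‖ < 3 * R / 4 := fun U hU => by
    rw [mem_closedBall_zero_iff] at hU
    linarith
  refine ⟨fun U h i => stageVec R A S B c a b U h (some i),
    fun U h => rkUpdate A S B b U h fun i => stageVec R A S B c a b U h (some i), ?_,
    fun _ _ => rfl, ?_, ?_⟩
  · intro U hU h hh V
    exact stageVec_unique hT h2 hc hh.1 (hcon h hh) (mem_closedBall_zero_iff.1 hU) V
  · intro h hh
    have hsub : Metric.closedBall (0 : Y) (R / 2) ⊆ Metric.ball 0 (3 * R / 4) :=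
      Metric.closedBall_subset_ball (by linarith)
    have hreg : ∀ (f : Y → Y) (i : Option (Fin s)),
        EqOn f (fun U => stageVec R A S B c a b U h i) (Metric.ball 0 (3 * R / 4)) →
        CbWith N (fun _ => M) f (Metric.closedBall (0 : Y) (R / 2)) (Metric.closedBall 0 R) := by
      intro f i hf
      have h3 := (cbOn_stageVec (c := c) h2 hc hh.1 (hsol _ _ _ (hcon h hh)) i).mono hM0
      refine (h3.congr hf).cbWith Metric.isOpen_ball.uniqueDiffOn hsub
        ((Metric.isClosed_closedBall.closure_interior_subset).trans hsub) fun U hU => ?_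
      rw [hf (hsub hU)]
      exact stageVec_mem h2 hc hh.1 (hcon h hh) (hlt U hU) i
    exact ⟨fun i => hreg _ (some i) fun _ _ => rfl, hreg _ none fun U hU =>
      (stageVec_none hT h2 hc hh.1 (hcon h hh) (mem_ball_zero_iff.1 hU)).symm⟩
  · intro ℓ hℓ k hkℓ hlevel U hU
    have hℓL : ℓ ≤ L := (hB.subset hℓ.1).2
    have hkN : k < N := by
      have h3 : (k : ℝ) ≤ ⌈L⌉₊ := (hkℓ.trans hℓL).trans (Nat.le_ceil L)
      exact (Nat.cast_le.1 h3).trans_lt hB.lt_N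
    have hℓ0 : 0 ≤ ℓ := (Nat.cast_nonneg k).trans hkℓ
    have hj : ∀ j ≤ k, (j : ℝ) ≤ ℓ := fun j hj => (Nat.cast_le.2 hj).trans hkℓ
    obtain ⟨u, rfl⟩ := (scaleEquiv hT hℓ0).surjective U
    rw [mem_closedBall_zero_iff, LinearIsometryEquiv.norm_map] at hU
    -- Nonlinearities exist only on the levels with `j ≤ k`; the default `0` elsewhere allows a
    -- choice for all `j`.
    have hex : ∀ j, ∃ β : Y → Y, j ≤ k →
        (∀ x, smoothing A (ℓ - j) (β x) = B (smoothing A (ℓ - j) x)) ∧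
          ContinuousOn β (Metric.closedBall 0 R) ∧ CbOn (j + 1) κ β (Metric.ball 0 R) := by
      intro j
      by_cases hjk : j ≤ k
      · obtain ⟨β, hβ⟩ := (hlevel j hjk).exists_coord hT (sub_nonneg.2 (hj j hjk)) hR
          (natCeil_sub_add_lt hℓL hB.lt_N (hj j hjk))
          fun i hi => le_sum_abs K (hi.trans (Nat.sub_le _ _))
        exact ⟨β, fun _ => hβ⟩
      · exact ⟨0, fun h => absurd h hjk⟩
    choose β hβ using hex
    have hmem : (scaleEquiv hT hℓ0 u).toBase ∈ Metric.closedBall (0 : Y) (R / 2) := by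
      have := norm_funCalc_apply_le hT (bddLeft_smoothing hℓ0) u
      rw [one_mul] at this
      rw [mem_closedBall_zero_iff, toBase_scaleEquiv]
      exact this.trans hU
    have hreg : ∀ (f : ℝ → Y) (i : Option (Fin s)),
        EqOn f (fun h => stageVec R A S B c a b (scaleEquiv hT hℓ0 u).toBase h i)
          (Icc 0 (maxStep s (|Ma 0| + |Mb 0|) κ R)) →
        CbWith k (fun _ => M) f (Icc 0 (maxStep s (|Ma 0| + |Mb 0|) κ R))
          (Metric.closedBall 0 R) := by
      intro f i hf
      have h3 := (hstep k Y A S B c a b β ℓ h1 h2 hE hc hkℓ hcont (hsmooth.of_le hN) hβ u hU i).mono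
        (hM1 k hkN)
      refine (h3.congr hf).cbWith (uniqueDiffOn_Icc hH) subset_rfl
        isClosed_Icc.closure_interior_subset fun h hh => ?_
      rw [hf hh]
      exact stageVec_mem h2 hc hh.1 (hcon h hh) (hlt _ hmem) i
    exact ⟨fun i => hreg _ (some i) fun _ _ => rfl, hreg _ none fun h hh =>
      (stageVec_none hT h2 hc hh.1 (hcon h hh) (hlt _ hmem)).symm⟩
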